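/- Let $\mathcal L_2$ be the language of second-order arithmetic. A model of $\mathsf{ACA}_0$ is a pair $\mathcal N=(M,S)$ with $S\subseteq\mathcal P(M)$ satisfying the axioms of $\mathsf{ACA}_0$; all numbers, sets and sequences below are those of $\mathcal N$, so $n\in M$ may be nonstandard. For $Y\in S$ put $(Y)_i=\{a : (a,i)\in Y\}$, where $(a,b)=(a+b)^2+a$; $Y$ codes the model $(M,\{(Y)_i : i\in M\})$, and $X\in Y$ means $X=(Y)_i$ for some $i$. For (coded) models $\mathcal M,\mathcal M'$, write $\mathcal M\subseteq_{\beta_k}\mathcal M'$ if every set of $\mathcal M$ is a set of $\mathcal M'$ and both satisfy the same $\Sigma^1_k$ formulas with parameters from $\mathcal M$. For $e,i\in\omega$, $\psi_e(i,n)$ is the statement: for every set $X$ there is a sequence $Y_0,\dots,Y_n$ of coded models of $\mathsf{ACA}_0$ with $X\in Y_0\in Y_1\in\dots\in Y_n$ and $Y_0\subseteq_{\beta_i}Y_1\subseteq_{\beta_i}\dots\subseteq_{\beta_i}Y_n\subseteq_{\beta_e}\mathcal N$. $[\Sigma^1_1]^n\text{-}\mathsf{ID}$ is the statement: for every sequence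 $\langle\Gamma_i : i<n\rangle$ of (not necessarily monotone) $\Sigma^1_1$ operators, given by a $\Sigma^1_1$ formula $\varphi(i,x,Y)$ with parameters through $x\in\Gamma_i(Y)\leftrightarrow\varphi(i,x,Y)$, the inductive definition by their combination exists, that is, there are a well-ordering with a last element and sets $T_j(\xi)$ for $j<n$ and $\xi$ in its field such that - $T_j(\xi)=\emptyset$ for all $j<n$ if $\xi$ is the first element; - if $\eta$ is the successor of $\xi$, then there is a least $i<n$ with $\Gamma_i(T_0(\xi))\not\subseteq T_0(\xi)$, and for it $T_j(\eta)=T_i(\xi)\cup\Gamma_i(T_0(\xi))$ for $j\le i$, and $T_j(\eta)=T_j(\xi)$ for $i<j<n$; - if $\lambda$ is a limit, then $T_j(\lambda)=\{m : \exists\eta<\lambda\ \forall\xi\,(\eta\le\xi<\lambda\to m\in T_j(\xi))\}$ for $j<n$; - if $\xi$ is the last element, then $\Gamma_i(T_0(\xi))\subseteq T_0(\xi)$ for all $i<n$. (So $\Gamma_0$ is iterated from $\emptyset$ to a fixed point; whenever a common fixed point of $\Gamma_0,\dots,\Gamma_{i-1}$ is reached, $\Gamma_i$ is applied to it once, the result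 is added to what $\Gamma_i$ has accumulated, and the iteration of $\Gamma_0,\dots,\Gamma_{i-1}$ starts afresh from there; this is repeated until a common fixed point of all the operators is reached.) **Lemma.** Over $\mathsf{ACA}_0$, $\forall n.[\Sigma^1_1]^n\text{-}\mathsf{ID}$ proves $\forall n.\psi_1(2,n)$. That is, every model of $\mathsf{ACA}_0$ in which $[\Sigma^1_1]^n\text{-}\mathsf{ID}$ holds for all $n$ satisfies $\psi_1(2,n)$ for all $n$. -/

import Mathlib

/-! ### The language of second-order arithmetic -/

/-- Number terms of the language of second-order arithmetic; number variables are
indexed by `ℕ`. -/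
inductive L2Term : Type
  | var : ℕ → L2Term
  | zero : L2Term
  | one : L2Term
  | add : L2Term → L2Term → L2Term
  | mul : L2Term → L2Term → L2Term

/-- Formulas of the two-sorted language of second-order arithmetic. Number variables and set
variables are two separate families, each indexed by `ℕ`. The remaining connectives are the
usual classical abbreviations. -/
inductive L2Formula : Type
  | eq : L2Term → L2Term → L2Formula
  | lt : L2Term → L2Term → L2Formula
  | mem : L2Term → ℕ → L2Formula
  | neg : L2Formula → L2Formula
  | and : L2Formula → L2Formula → L2Formula
  | allNum : ℕ → L2Formula → L2Formula
  | exNum : ℕ → L2Formula → L2Formula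
  | allSet : ℕ → L2Formula → L2Formula
  | exSet : ℕ → L2Formula → L2Formula

/-- A formula is arithmetical if it has no set quantifiers (free set variables are allowed). -/
def L2Formula.IsArithmetical : L2Formula → Prop
  | .eq _ _ => True
  | .lt _ _ => True
  | .mem _ _ => True
  | .neg φ => φ.IsArithmetical
  | .and φ ψ => φ.IsArithmetical ∧ ψ.IsArithmetical
  | .allNum _ φ => φ.IsArithmetical
  | .exNum _ φ => φ.IsArithmetical
  | .allSet _ _ => False
  | .exSet _ _ => False

/-- `IsAnalytical true k` is the class of `Σ¹ₖ` formulas and `IsAnalytical false k` is the class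
of `Π¹ₖ` formulas: `k` alternating set quantifiers, the outermost one existential in the first
case and universal in the second, followed by an arithmetical formula. -/
inductive L2Formula.IsAnalytical : Bool → ℕ → L2Formula → Prop
  | arith (b : Bool) (φ : L2Formula) : φ.IsArithmetical → IsAnalytical b 0 φ
  | ex (k X : ℕ) (φ : L2Formula) :
      IsAnalytical false k φ → IsAnalytical true (k + 1) (.exSet X φ)
  | all (k X : ℕ) (φ : L2Formula) :
      IsAnalytical true k φ → IsAnalytical false (k + 1) (.allSet X φ)

/-- `Σ¹ₖ` formulas (boldface: any free number and set variables may serve as parameters). -/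
def L2Formula.IsSigmaOne (k : ℕ) (φ : L2Formula) : Prop := L2Formula.IsAnalytical true k φ

/-! ### Structures and satisfaction

A structure for second-order arithmetic is a pair `(M, S)`: a first-order part `M` carrying
`0, 1, +, ·, <`, and a set `S` of subsets of `M` over which the set quantifiers range. -/

/-- The first-order part of a structure for second-order arithmetic. No laws are built in; they
come from the axioms in `ModelsACA0`. -/
class L1Structure (M : Type*) extends Zero M, One M, Add M, Mul M, LT M

section Semantics

variable {M : Type*} [L1Structure M]

/-- Value of a number term under an assignment of the number variables. -/
def L2Term.val (v : ℕ → M) : L2Term → M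
  | .var i => v i
  | .zero => 0
  | .one => 1
  | .add t u => t.val v + u.val v
  | .mul t u => t.val v * u.val v

/-- Satisfaction of a formula in the structure `(M, S)`, under the assignment `v` of the number
variables and the assignment `V` of the set variables (to be used with `V j ∈ S` for all `j`). -/
def L2Formula.Sat (S : Set (Set M)) : (ℕ → M) → (ℕ → Set M) → L2Formula → Prop
  | v, _, .eq t u => t.val v = u.val v
  | v, _, .lt t u => t.val v < u.val v
  | v, V, .mem t X => t.val v ∈ V X
  | v, V, .neg φ => ¬ L2Formula.Sat S v V φ
  | v, V, .and φ ψ => L2Formula.Sat S v V φ ∧ L2Formula.Sat S v V ψ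
  | v, V, .allNum i φ => ∀ a : M, L2Formula.Sat S (Function.update v i a) V φ
  | v, V, .exNum i φ => ∃ a : M, L2Formula.Sat S (Function.update v i a) V φ
  | v, V, .allSet X φ => ∀ A ∈ S, L2Formula.Sat S v (Function.update V X A) φ
  | v, V, .exSet X φ => ∃ A ∈ S, L2Formula.Sat S v (Function.update V X A) φ

/-- `(M, S)` is a model of `ACA₀`: the set sort is nonempty and the basic axioms for `0, 1, +, ·,
<`, the induction axiom for sets in `S`, and comprehension for all arithmetical formulas with
number and set parameters hold. -/
structure ModelsACA0 (S : Set (Set M)) : Prop where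
  nonempty : S.Nonempty
  succ_ne_zero : ∀ a : M, a + 1 ≠ 0
  succ_inj : ∀ a b : M, a + 1 = b + 1 → a = b
  add_zero : ∀ a : M, a + 0 = a
  add_succ : ∀ a b : M, a + (b + 1) = (a + b) + 1
  mul_zero : ∀ a : M, a * 0 = 0
  mul_succ : ∀ a b : M, a * (b + 1) = a * b + a
  not_lt_zero : ∀ a : M, ¬ a < 0
  lt_succ_iff : ∀ a b : M, a < b + 1 ↔ a < b ∨ a = b
  induction : ∀ X ∈ S, (0 : M) ∈ X → (∀ a : M, a ∈ X → a + 1 ∈ X) → ∀ a : M, a ∈ X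
  comprehension : ∀ φ : L2Formula, φ.IsArithmetical →
    ∀ (i : ℕ) (v : ℕ → M) (V : ℕ → Set M), (∀ j, V j ∈ S) →
      {a : M | φ.Sat S (Function.update v i a) V} ∈ S

/-! ### Coded models -/

/-- The pairing `(a, b) = (a + b)² + a`. -/
def l2Pair (a b : M) : M := (a + b) * (a + b) + a

/-- The slice `(Y)ᵢ = {a | (a, i) ∈ Y}`. -/
def slice (Y : Set M) (i : M) : Set M := {a | l2Pair a i ∈ Y}

/-- The second-order part `{(Y)ᵢ | i ∈ M}` of the model coded by `Y`; its first-order part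
is `M`. -/
def codedSets (Y : Set M) : Set (Set M) := Set.range (slice Y)

/-- `(M, S)` is a `βₖ`-submodel of `(M, S')`: it is a submodel, and both structures satisfy
the same `Σ¹ₖ` formulas with (number and set) parameters in `(M, S)`. -/
def IsBetaSubmodel (k : ℕ) (S S' : Set (Set M)) : Prop :=
  S ⊆ S' ∧ ∀ φ : L2Formula, φ.IsSigmaOne k →
    ∀ (v : ℕ → M) (V : ℕ → Set M), (∀ j, V j ∈ S) → (φ.Sat S v V ↔ φ.Sat S' v V)

/-- The formula `ψ_e(i, n)` evaluated in the ground model `(M, S)`; here `n : M` may be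
nonstandard, and the sequence `Y₀, …, Yₙ` is given by the slices of one set `Y`. -/
def Psi (S : Set (Set M)) (e i : ℕ) (n : M) : Prop :=
  ∀ X ∈ S, ∃ Y ∈ S,
    X ∈ codedSets (slice Y 0) ∧
    (∀ k : M, k < n → slice Y k ∈ codedSets (slice Y (k + 1))) ∧
    (∀ k : M, k < n ∨ k = n → ModelsACA0 (codedSets (slice Y k))) ∧
    (∀ k : M, k < n →
      IsBetaSubmodel i (codedSets (slice Y k)) (codedSets (slice Y (k + 1)))) ∧
    IsBetaSubmodel e (codedSets (slice Y n)) S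

/-! ### Inductive definitions by combinations of operators -/

/-- The field of the relation `ξ ≤ η ↔ (ξ, η) ∈ R` coded by `R`. -/
def relField (R : Set M) : Set M := {ξ | ∃ η, l2Pair ξ η ∈ R ∨ l2Pair η ξ ∈ R}

/-- `ξ ≤ η` in the ordering coded by `R`. -/
def ordLe (R : Set M) (ξ η : M) : Prop := l2Pair ξ η ∈ R

/-- `ξ < η` in the ordering coded by `R`. -/
def ordLt (R : Set M) (ξ η : M) : Prop := l2Pair ξ η ∈ R ∧ ξ ≠ η

/-- `R` codes a relation which is, in the sense of `(M, S)`, a well-ordering of its field: a linear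
ordering such that every set in `S` meeting the field has a least element in the field. -/
structure IsWellOrdering (S : Set (Set M)) (R : Set M) : Prop where
  refl : ∀ ξ ∈ relField R, ordLe R ξ ξ
  antisymm : ∀ ξ η : M, ordLe R ξ η → ordLe R η ξ → ξ = η
  trans : ∀ ξ η ζ : M, ordLe R ξ η → ordLe R η ζ → ordLe R ξ ζ
  total : ∀ ξ ∈ relField R, ∀ η ∈ relField R, ordLe R ξ η ∨ ordLe R η ξ
  wf : ∀ Z ∈ S, (Z ∩ relField R).Nonempty →
    ∃ ξ ∈ Z ∩ relField R, ∀ η ∈ Z ∩ relField R, ordLe R ξ η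

/-- `η` is the immediate successor of `ξ` in `R`. -/
def IsNext (R : Set M) (ξ η : M) : Prop :=
  ordLt R ξ η ∧ ∀ ζ : M, ordLt R ζ η → ordLe R ζ ξ

/-- `ξ` is a limit point of `R`: neither the least element nor an immediate successor. -/
def IsLimitPoint (R : Set M) (ξ : M) : Prop :=
  (∃ η, ordLt R η ξ) ∧ ∀ η, ordLt R η ξ → ∃ ζ, ordLt R η ζ ∧ ordLt R ζ ξ

/-- The set `T_j(ξ)` recorded for level `j` at stage `ξ` by the set `H`. -/
def stageSet (H : Set M) (ξ j : M) : Set M := slice (slice H ξ) j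

/-- `(R, H)` records the complete run of the inductive definition by the combination of the
operators `Γ_i`, `i < n` (not assumed monotone). The stages are the points of the well-ordering
`R`. At stage `ξ` the current set is `T_0(ξ)`, and `T_j(ξ)` is the part of it that was there when
the current iteration of `Γ_0, …, Γ_{j-1}` was started from it: the set accumulated by `Γ_j`.

* All sets are empty at the first stage.
* If the current set is not closed under all the operators, let `i` be the least index for which it
  is not closed under `Γ_i`. Then `Γ_i` is applied once to the current set, the result is
  added to what `Γ_i` has accumulated, and the iteration of the earlier operators is started afresh
  from there; the levels above `i` are unchanged.
* At a limit stage each level collects the points that are present from some earlier stage on. Thus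
  the outermost level that changed cofinally often takes unions, and the levels below it are
  started afresh from this union.
* The run ends when the current set is closed under all the operators. -/
structure IsCombinedInduction (S : Set (Set M)) (n : M) (Γ : M → Set M → Set M)
    (R H : Set M) : Prop where
  wellOrdering : IsWellOrdering S R
  initial : ∀ ξ ∈ relField R, (∀ η ∈ relField R, ordLe R ξ η) →
    ∀ j : M, j < n → stageSet H ξ j = ∅
  next : ∀ ξ η : M, IsNext R ξ η → ∃ i : M, i < n ∧
    ¬ (Γ i (stageSet H ξ 0) ⊆ stageSet H ξ 0) ∧
    (∀ j : M, j < i → Γ j (stageSet H ξ 0) ⊆ stageSet H ξ 0) ∧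
    (∀ j : M, j < i ∨ j = i → stageSet H η j = stageSet H ξ i ∪ Γ i (stageSet H ξ 0)) ∧
    (∀ j : M, i < j → j < n → stageSet H η j = stageSet H ξ j)
  limit : ∀ ξ : M, IsLimitPoint R ξ → ∀ j : M, j < n →
    stageSet H ξ j =
      {m | ∃ η, ordLt R η ξ ∧ ∀ ζ, ordLe R η ζ → ordLt R ζ ξ → m ∈ stageSet H ζ j}
  final : ∃ ξ ∈ relField R, (∀ η ∈ relField R, ordLe R η ξ) ∧
    ∀ i : M, i < n → Γ i (stageSet H ξ 0) ⊆ stageSet H ξ 0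

/-- The sequence of operators defined by a formula `φ` with parameters `v, V`: a number `x` is in
`Γ_i(Y)` iff `φ` holds when the number variables `0`, `1` are set to `i`, `x`, and the set
variable `0` is set to `Y`. -/
def formulaOperator (S : Set (Set M)) (φ : L2Formula) (v : ℕ → M) (V : ℕ → Set M)
    (i : M) (Y : Set M) : Set M :=
  {x | φ.Sat S (Function.update (Function.update v 0 i) 1 x) (Function.update V 0 Y)}

/-- `[Σ¹₁]ⁿ-ID` in the structure `(M, S)`, for a possibly nonstandard `n : M`: for each sequence
of `Σ¹₁` operators `Γ_i`, `i < n` (uniformly `Σ¹₁`-definable in `i`, with parameters), the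
inductive definition by their combination can be carried out: its complete run, and with it the
inductively defined set (the current set at the last stage), exists. -/
def SigmaOneOneID (S : Set (Set M)) (n : M) : Prop :=
  ∀ φ : L2Formula, φ.IsSigmaOne 1 →
    ∀ (v : ℕ → M) (V : ℕ → Set M), (∀ j, V j ∈ S) →
      ∃ R ∈ S, ∃ H ∈ S, IsCombinedInduction S n (formulaOperator S φ v V) R H

end Semantics

/-!
The proof takes place inside the given model `(M, S)`. For a set `X` of the model and a number
`n`, a single induction by `n + 1` operators is set up whose last state contains the codes of
`β`-models `Z⁽ⁿ⁾ ∋ X, …, Z⁽⁰⁾` such that `Z⁽ᵏ⁺¹⁾` is an element and a `β₂`-submodel of `Z⁽ᵏ⁾` for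
each `k < n`.

The sentences involved have a common form. A *clause system* `X` is a list of possibly infinite
clauses whose literals express `x ∈ A` or `x ∉ A`. Every `Σ¹₁` formula is equivalent to the
existence of a solution `A` of a clause system with a prescribed section
(`ModelsACA0.exists_clauses`), since the truth values of all arithmetical subformulas can be
stored in `A`, where a number quantifier becomes an infinite clause. Therefore a coded model that
contains solutions of all solvable clause systems of the model, and is closed under the finitely
many operations that generate arithmetical comprehension, is a `β`-model of `ACA₀`
(`SolvesProblems.modelsACA0`, `SolvesProblems.isBetaSubmodel_one`).

A state `T` of the induction is divided into levels and each level into cells. A cell is marked as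
decided when its content is determined, and is not changed from then on except that an operator
with a larger index erases it.

* Level `0` builds `Z⁽⁰⁾`. The cells are pairs `(m, c)`, treated in the lexicographic order. For
  the `m`-th clause system, a literal of the `c`-th clause is chosen such that some solution makes
  it and all earlier choices true. This is a `Σ¹₁` condition, and so a leftmost solution is
  determined by the iteration of one nonmonotone `Σ¹₁` operator. Unsolvable systems do no harm,
  since cells without candidates are marked as decided all the same (`ready_zero`).
* Level `k + 1` becomes active when level `k` is finished. Then `Z⁽ᵏ⁾` is a `β`-model containing
  all entries of the higher levels. If nothing has been recorded at level `k + 1`, or if there is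
  a `Σ¹₂` sentence with parameters in `Z⁽ᵏ⁺¹⁾` that holds in `Z⁽ᵏ⁾` and has not been recorded so
  far, then a new cell is opened for it, and the code of `Z⁽ᵏ⁾` is put into this cell. The sets of
  `Z⁽ᵏ⁺¹⁾` are the sets of all models recorded in this way, so the recorded sentence is now true
  in `Z⁽ᵏ⁺¹⁾`, and it remains true as `Z⁽ᵏ⁾` is a `β`-model. The lower levels are started afresh,
  with the new entry as an additional parameter (`invSucc_nextState`).

At the last stage nothing is left to be recorded, which says that `Z⁽ᵏ⁺¹⁾` is a `β₂`-submodel of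
`Z⁽ᵏ⁾` (`isBetaSubmodel_levelModel`). The invariants survive limits because either level `k` was
erased cofinally often, and then it is empty at the limit, or its decided cells only grow from
some stage on (`IsCombinedInduction.exists_extends`, `levelInv_of_directed`).

The transfinite induction over the stages applies to a property with set quantifiers, so it needs
`Σ¹₁` comprehension, which follows from the induction for one operator (`ModelsACA0.sigmaCA`). To
avoid writing down formulas, arithmetical definability with parameters is treated as a property of
predicates on contexts, consisting of numbers and sets, and is derived by instance search.
-/

universe u

/-! ### Arithmetical definability -/

/-- Renaming of the variables of a number term. -/
def L2Term.rename (ρ : ℕ → ℕ) : L2Term → L2Term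
  | .var i => .var (ρ i)
  | .zero => .zero
  | .one => .one
  | .add t s => .add (t.rename ρ) (s.rename ρ)
  | .mul t s => .mul (t.rename ρ) (s.rename ρ)

/-- Renaming of the free variables of an arithmetical formula. The bound number variables receive
the even names `2m, 2m + 2, …`, so there is no capture as long as every free number variable is
sent to an odd name or to a name below `2m`. Set quantifiers do not occur, and are left alone. -/
def L2Formula.rename : L2Formula → (ℕ → ℕ) → (ℕ → ℕ) → ℕ → L2Formula
  | .eq t s, ρ, _, _ => .eq (t.rename ρ) (s.rename ρ)
  | .lt t s, ρ, _, _ => .lt (t.rename ρ) (s.rename ρ)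
  | .mem t X, ρ, σ, _ => .mem (t.rename ρ) (σ X)
  | .neg φ, ρ, σ, m => .neg (φ.rename ρ σ m)
  | .and φ ψ, ρ, σ, m => .and (φ.rename ρ σ m) (ψ.rename ρ σ m)
  | .allNum i φ, ρ, σ, m => .allNum (2 * m) (φ.rename (Function.update ρ i (2 * m)) σ (m + 1))
  | .exNum i φ, ρ, σ, m => .exNum (2 * m) (φ.rename (Function.update ρ i (2 * m)) σ (m + 1))
  | .allSet X φ, _, _, _ => .allSet X φ
  | .exSet X φ, _, _, _ => .exSet X φ

theorem L2Formula.IsArithmetical.rename {φ : L2Formula} (h : φ.IsArithmetical) (ρ σ : ℕ → ℕ)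
    (m : ℕ) : (φ.rename ρ σ m).IsArithmetical := by
  induction φ generalizing ρ m with
  | eq | lt | mem => trivial
  | neg φ ih => exact ih h ρ m
  | and φ ψ ih₁ ih₂ => exact ⟨ih₁ h.1 ρ m, ih₂ h.2 ρ m⟩
  | allNum i φ ih => exact ih h _ _
  | exNum i φ ih => exact ih h _ _
  | allSet | exSet => exact h.elim

section Rename

variable {M : Type u}

theorem update_comp_update {ρ : ℕ → ℕ} {m : ℕ} (hρ : ∀ j, ρ j % 2 = 1 ∨ ρ j < 2 * m)
    (w : ℕ → M) (i : ℕ) (a : M) :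
    Function.update w (2 * m) a ∘ Function.update ρ i (2 * m) =
      Function.update (w ∘ ρ) i a := by
  funext j
  by_cases hj : j = i
  · subst hj; simp
  · have : ρ j ≠ 2 * m := by have := hρ j; omega
    simp [hj, this]

variable [L1Structure M]

theorem L2Term.val_rename (ρ : ℕ → ℕ) (w : ℕ → M) (t : L2Term) :
    (t.rename ρ).val w = t.val (w ∘ ρ) := by
  induction t with
  | var | zero | one => rfl
  | add t s iht ihs => simp only [L2Term.rename, L2Term.val, iht, ihs]
  | mul t s iht ihs => simp only [L2Term.rename, L2Term.val, iht, ihs]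

theorem rename_bound {ρ : ℕ → ℕ} {m : ℕ} (hρ : ∀ j, ρ j % 2 = 1 ∨ ρ j < 2 * m) (i : ℕ) (j : ℕ) :
    Function.update ρ i (2 * m) j % 2 = 1 ∨ Function.update ρ i (2 * m) j < 2 * (m + 1) := by
  by_cases hj : j = i
  · subst hj; right; simp
  · have := hρ j; simp only [Function.update_of_ne hj]; omega

/-- The satisfaction of an arithmetical formula does not depend on the range of the set
quantifiers, whence the two unrelated ranges `S`, `S'`. -/
theorem L2Formula.sat_rename {S S' : Set (Set M)} {φ : L2Formula} (h : φ.IsArithmetical)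
    (ρ σ : ℕ → ℕ) (m : ℕ) (hρ : ∀ j, ρ j % 2 = 1 ∨ ρ j < 2 * m) (w : ℕ → M) (W : ℕ → Set M) :
    (φ.rename ρ σ m).Sat S w W ↔ φ.Sat S' (w ∘ ρ) (W ∘ σ) := by
  induction φ generalizing ρ m w with
  | eq | lt | mem => simp only [L2Formula.rename, L2Formula.Sat, L2Term.val_rename, Function.comp]
  | neg φ ih => exact not_congr (ih h ρ m hρ w)
  | and φ ψ ih₁ ih₂ => exact and_congr (ih₁ h.1 ρ m hρ w) (ih₂ h.2 ρ m hρ w)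
  | allNum i φ ih =>
    refine forall_congr' fun a => ?_
    rw [ih h _ _ (rename_bound hρ i), update_comp_update hρ]
  | exNum i φ ih =>
    refine exists_congr fun a => ?_
    rw [ih h _ _ (rename_bound hρ i), update_comp_update hρ]
  | allSet | exSet => exact h.elim

theorem L2Formula.sat_iff_of_isArithmetical {S S' : Set (Set M)} {φ : L2Formula}
    (h : φ.IsArithmetical) (w : ℕ → M) (W : ℕ → Set M) : φ.Sat S w W ↔ φ.Sat S' w W := by
  induction φ generalizing w with
  | eq | lt | mem => exact Iff.rfl
  | neg φ ih => exact not_congr (ih h w)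
  | and φ ψ ih₁ ih₂ => exact and_congr (ih₁ h.1 w) (ih₂ h.2 w)
  | allNum i φ ih => exact forall_congr' fun a => ih h _
  | exNum i φ ih => exact exists_congr fun a => ih h _
  | allSet | exSet => exact h.elim

/-- A predicate of a sequence of numbers and a sequence of sets that is defined by an arithmetical
formula without further parameters. The `j`-th number is read from the variable `2j + 1`; the
even variables are kept free for quantifiers. -/
def RawDef (Q : (ℕ → M) → (ℕ → Set M) → Prop) : Prop :=
  ∃ φ : L2Formula, φ.IsArithmetical ∧ ∀ w W, φ.Sat ∅ w W ↔ Q (fun j => w (2 * j + 1)) W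

/-- The sequence `a, f 0, f 1, …`. -/
def consSeq {β : Type u} (a : β) (f : ℕ → β) : ℕ → β
  | 0 => a
  | j + 1 => f j

/-- The sequence `f 0, g 0, f 1, g 1, …`. -/
def interleave {β : Type u} (f g : ℕ → β) (j : ℕ) : β := if j % 2 = 0 then f (j / 2) else g (j / 2)

namespace RawDef

variable {Q Q' : (ℕ → M) → (ℕ → Set M) → Prop}

theorem rename (h : RawDef Q) (ρ σ : ℕ → ℕ) : RawDef (fun w W => Q (w ∘ ρ) (W ∘ σ)) := by
  obtain ⟨φ, hφ, hQ⟩ := h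
  refine ⟨φ.rename (fun j => 2 * ρ (j / 2) + 1) σ 0, hφ.rename _ _ _, fun w W => ?_⟩
  rw [L2Formula.sat_rename (S' := ∅) hφ _ _ _ (fun j => Or.inl (by omega)), hQ]
  have : ∀ j, (2 * j + 1) / 2 = j := fun j => by omega
  simp only [Function.comp_def, this]

theorem and (h : RawDef Q) (h' : RawDef Q') : RawDef (fun w W => Q w W ∧ Q' w W) := by
  obtain ⟨φ, hφ, hQ⟩ := h
  obtain ⟨ψ, hψ, hQ'⟩ := h'
  exact ⟨.and φ ψ, ⟨hφ, hψ⟩, fun w W => and_congr (hQ w W) (hQ' w W)⟩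

theorem not (h : RawDef Q) : RawDef (fun w W => ¬ Q w W) := by
  obtain ⟨φ, hφ, hQ⟩ := h
  exact ⟨.neg φ, hφ, fun w W => not_congr (hQ w W)⟩

theorem ex (h : RawDef Q) : RawDef (fun w W => ∃ a, Q (consSeq a w) W) := by
  obtain ⟨φ, hφ, hQ⟩ := h
  refine ⟨.exNum 0 (φ.rename (fun j => if j / 2 = 0 then 0 else 2 * (j / 2 - 1) + 1) id 1),
    hφ.rename _ _ _, fun w W => exists_congr fun a => ?_⟩
  rw [L2Formula.sat_rename (S' := ∅) hφ _ _ _ (fun j => by split_ifs <;> omega), hQ]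
  have h0 : ∀ j, (2 * j + 1) / 2 = j := fun j => by omega
  have : (fun j => (Function.update w 0 a ∘
      fun j => if j / 2 = 0 then 0 else 2 * (j / 2 - 1) + 1) (2 * j + 1)) =
      consSeq a (fun j => w (2 * j + 1)) := by
    funext j
    cases j with
    | zero => simp [consSeq]
    | succ j =>
      have h1 : (2 * (j + 1) + 1) / 2 = j + 1 := by omega
      simp only [Function.comp, h1, consSeq]
      simp
  rw [this]; rfl

theorem mem (i j : ℕ) : RawDef (fun (w : ℕ → M) W => w i ∈ W j) :=
  ⟨.mem (.var (2 * i + 1)) j, trivial, fun _ _ => Iff.rfl⟩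

theorem lt (i j : ℕ) : RawDef (fun (w : ℕ → M) _ => w i < w j) :=
  ⟨.lt (.var (2 * i + 1)) (.var (2 * j + 1)), trivial, fun _ _ => Iff.rfl⟩

theorem eq (i j : ℕ) : RawDef (fun (w : ℕ → M) _ => w i = w j) :=
  ⟨.eq (.var (2 * i + 1)) (.var (2 * j + 1)), trivial, fun _ _ => Iff.rfl⟩

theorem eq_add (i j k : ℕ) : RawDef (fun (w : ℕ → M) _ => w i = w j + w k) :=
  ⟨.eq (.var (2 * i + 1)) (.add (.var (2 * j + 1)) (.var (2 * k + 1))), trivial,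
    fun _ _ => Iff.rfl⟩

theorem eq_mul (i j k : ℕ) : RawDef (fun (w : ℕ → M) _ => w i = w j * w k) :=
  ⟨.eq (.var (2 * i + 1)) (.mul (.var (2 * j + 1)) (.var (2 * k + 1))), trivial,
    fun _ _ => Iff.rfl⟩

end RawDef

/-- Types of contexts: the numbers and sets on which a predicate depends. -/
class Ctx (M : Type u) [L1Structure M] (α : Type u) where
  /-- The numbers of the context, the most recent one first. -/
  num : α → ℕ → M
  /-- The sets of the context, the most recent one first. -/
  set : α → ℕ → Set M

instance : Ctx M PUnit.{u + 1} := ⟨fun _ _ => 0, fun _ _ => ∅⟩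

instance Ctx.prodNum {α : Type u} [Ctx M α] : Ctx M (α × M) :=
  ⟨fun p => consSeq p.2 (num p.1), fun p => set p.1⟩

instance Ctx.prodSet {α : Type u} [Ctx M α] : Ctx M (α × Set M) :=
  ⟨fun p => num p.1, fun p => consSeq p.2 (set p.1)⟩

/-- `Ar S P`: the predicate `P` on a context is arithmetical with number parameters and set
parameters from `S` (the empty set is always admitted). The parameters are interleaved with the
components of the context. -/
class Ar {α : Type u} [Ctx M α] (S : Set (Set M)) (P : α → Prop) : Prop where
  out : ∃ (p : ℕ → M) (V : ℕ → Set M) (Q : (ℕ → M) → (ℕ → Set M) → Prop), RawDef Q ∧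
    (∀ j, V j ∈ S ∨ V j = ∅) ∧
      ∀ x, P x ↔ Q (interleave (Ctx.num x) p) (interleave (Ctx.set x) V)

/-- A number-valued function on a context with arithmetical graph. -/
class DefFun {α : Type u} [Ctx M α] (S : Set (Set M)) (f : α → M) : Prop where
  out : Ar S (fun p : α × M => p.2 = f p.1)

/-- A set-valued function on a context with arithmetical membership relation. -/
class DefSet {α : Type u} [Ctx M α] (S : Set (Set M)) (F : α → Set M) : Prop where
  out : Ar S (fun p : α × M => p.2 ∈ F p.1)

/-- A map of contexts that forgets or duplicates components. -/
class CtxMap {α β : Type u} [Ctx M α] [Ctx M β] (f : α → β) : Prop where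
  num : ∃ ρ : ℕ → ℕ, ∀ x, Ctx.num (M := M) (f x) = Ctx.num x ∘ ρ
  set : ∃ σ : ℕ → ℕ, ∀ x, Ctx.set (M := M) (f x) = Ctx.set x ∘ σ

end Rename

section Definability

variable {M : Type u} [L1Structure M] {S : Set (Set M)} {α β : Type u} [Ctx M α] [Ctx M β]

@[simp]
theorem interleave_even {γ : Type u} (f g : ℕ → γ) (j : ℕ) :
    interleave f g (2 * j) = f j := by simp [interleave]

@[simp]
theorem interleave_zero {γ : Type u} (f g : ℕ → γ) : interleave f g 0 = f 0 :=
  interleave_even f g 0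

@[simp]
theorem interleave_odd {γ : Type u} (f g : ℕ → γ) (j : ℕ) :
    interleave f g (2 * j + 1) = g j := by
  have : (2 * j + 1) / 2 = j := by omega
  simp [interleave, this, Nat.add_mod]

theorem eq_of_even_odd {γ : Type u} {f g : ℕ → γ} (h₀ : ∀ j, f (2 * j) = g (2 * j))
    (h₁ : ∀ j, f (2 * j + 1) = g (2 * j + 1)) : f = g := by
  funext j
  obtain ⟨k, rfl | rfl⟩ : ∃ k, j = 2 * k ∨ j = 2 * k + 1 := ⟨j / 2, by omega⟩
  exacts [h₀ k, h₁ k]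

namespace Ar

variable {P Q : α → Prop}

theorem congr (h : Ar S P) (hPQ : ∀ x, Q x ↔ P x) : Ar S Q := by
  have : Q = P := funext fun x => propext (hPQ x)
  rwa [this]

theorem comp (h : Ar S P) (f : β → α) [hf : CtxMap (M := M) f] : Ar S (fun y => P (f y)) := by
  obtain ⟨p, V, Q, hQ, hV, h⟩ := h
  obtain ⟨⟨ρ, hρ⟩, ⟨σ, hσ⟩⟩ := hf
  refine ⟨p, V, _, hQ.rename (interleave (fun j => 2 * ρ j) (fun j => 2 * j + 1))
    (interleave (fun j => 2 * σ j) (fun j => 2 * j + 1)), hV, fun y => ?_⟩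
  rw [h (f y), hρ, hσ]
  apply iff_of_eq
  congr 1 <;> apply eq_of_even_odd <;> intro j <;> simp

instance and [h : Ar S P] [h' : Ar S Q] : Ar S (fun x => P x ∧ Q x) := by
  obtain ⟨p, V, Q, hQ, hV, h⟩ := h
  obtain ⟨p', V', Q', hQ', hV', h'⟩ := h'
  refine ⟨interleave p p', interleave V V', _,
    (hQ.rename (interleave (fun j => 2 * j) (fun j => 2 * (2 * j) + 1))
      (interleave (fun j => 2 * j) (fun j => 2 * (2 * j) + 1))).and
    (hQ'.rename (interleave (fun j => 2 * j) (fun j => 2 * (2 * j + 1) + 1))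
      (interleave (fun j => 2 * j) (fun j => 2 * (2 * j + 1) + 1))), fun j => ?_, fun x => ?_⟩
  · unfold interleave; split_ifs
    exacts [hV _, hV' _]
  · refine and_congr ?_ ?_
    · rw [h]; apply iff_of_eq
      congr 1 <;> apply eq_of_even_odd <;> intro j <;> simp
    · rw [h']; apply iff_of_eq
      congr 1 <;> apply eq_of_even_odd <;> intro j <;> simp

instance not [h : Ar S P] : Ar S (fun x => ¬ P x) := by
  obtain ⟨p, V, Q, hQ, hV, h⟩ := h
  exact ⟨p, V, _, hQ.not, hV, fun x => not_congr (h x)⟩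

instance ex {P : α → M → Prop} [h : Ar S (fun p : α × M => P p.1 p.2)] :
    Ar S (fun x => ∃ a, P x a) := by
  obtain ⟨p, V, Q, hQ, hV, h⟩ := h
  refine ⟨p, V, _, (hQ.rename (interleave (fun j => if j = 0 then 0 else 2 * (j - 1) + 1)
    (fun j => 2 * j + 2)) id).ex, hV, fun x => exists_congr fun a => ?_⟩
  rw [h (x, a)]; apply iff_of_eq
  congr 1; apply eq_of_even_odd
  · intro j
    cases j with
    | zero => simp [Ctx.num, consSeq]
    | succ j => simp [Ctx.num, consSeq]
  · intro j; simp [consSeq]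

instance or [Ar S P] [Ar S Q] : Ar S (fun x => P x ∨ Q x) :=
  congr (P := fun x => ¬ (¬ P x ∧ ¬ Q x)) inferInstance fun x => by tauto

instance imp [Ar S P] [Ar S Q] : Ar S (fun x => P x → Q x) :=
  congr (P := fun x => ¬ P x ∨ Q x) inferInstance fun x => by tauto

instance iff [Ar S P] [Ar S Q] : Ar S (fun x => P x ↔ Q x) :=
  congr (P := fun x => (P x → Q x) ∧ (Q x → P x)) inferInstance fun x => by tauto

instance all {P : α → M → Prop} [h : Ar S (fun p : α × M => P p.1 p.2)] :
    Ar S (fun x => ∀ a, P x a) :=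
  congr (P := fun x => ¬ ∃ a, ¬ P x a) inferInstance fun x => by simp

/-- A finite disjunction. -/
instance exFin {P : ℕ → α → Prop} (n : ℕ) [h : ∀ k, Ar S (P k)] :
    Ar S (fun x => ∃ k, k < n + 1 ∧ P k x) := by
  induction n with
  | zero => exact congr (h 0) fun x => by simp
  | succ n ih =>
    have := h (n + 1)
    refine congr (P := fun x => (∃ k, k < n + 1 ∧ P k x) ∨ P (n + 1) x) inferInstance fun x => ?_
    constructor
    · rintro ⟨k, hk, h⟩
      rcases Nat.lt_succ_iff_lt_or_eq.1 hk with hk | rfl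
      exacts [Or.inl ⟨k, hk, h⟩, Or.inr h]
    · rintro (⟨k, hk, h⟩ | h)
      exacts [⟨k, by omega, h⟩, ⟨n + 1, by omega, h⟩]

end Ar

instance CtxMap.id : CtxMap (M := M) (fun x : α => x) :=
  ⟨⟨_root_.id, fun _ => rfl⟩, ⟨_root_.id, fun _ => rfl⟩⟩

instance CtxMap.fstNum {γ : Type u} [Ctx M γ] (f : γ → α × M) [hf : CtxMap (M := M) f] :
    CtxMap (M := M) (fun x => (f x).1) := by
  obtain ⟨⟨ρ, hρ⟩, ⟨σ, hσ⟩⟩ := hf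
  exact ⟨⟨fun j => ρ (j + 1), fun x => funext fun j => congrFun (hρ x) (j + 1)⟩,
    ⟨σ, fun x => hσ x⟩⟩

instance CtxMap.fstSet {γ : Type u} [Ctx M γ] (f : γ → α × Set M) [hf : CtxMap (M := M) f] :
    CtxMap (M := M) (fun x => (f x).1) := by
  obtain ⟨⟨ρ, hρ⟩, ⟨σ, hσ⟩⟩ := hf
  exact ⟨⟨ρ, fun x => hρ x⟩,
    ⟨fun j => σ (j + 1), fun x => funext fun j => congrFun (hσ x) (j + 1)⟩⟩

namespace DefFun

theorem sndRaw {P : α × M → Prop} (Q : (ℕ → M) → (ℕ → Set M) → Prop) (hQ : RawDef Q)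
    (p : ℕ → M) (h : ∀ x, P x ↔ Q (interleave (Ctx.num x) p) (interleave (Ctx.set x) fun _ => ∅)) :
    Ar S P := ⟨p, fun _ => ∅, Q, hQ, fun _ => Or.inr rfl, h⟩

instance const (m : M) : DefFun S (fun _ : α => m) :=
  ⟨sndRaw _ (RawDef.eq 0 1) (fun _ => m) fun x => by
    simp [interleave, Ctx.num, consSeq]⟩

instance snd (f : β → α × M) [hf : CtxMap (M := M) f] : DefFun S (fun x => (f x).2) := by
  obtain ⟨⟨ρ, hρ⟩, _⟩ := hf
  refine ⟨sndRaw _ (RawDef.eq 0 (2 * (ρ 0 + 1))) (fun _ => 0) fun x => ?_⟩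
  have : (f x.1).2 = Ctx.num x.1 (ρ 0) := congrFun (hρ x.1) 0
  rw [this]
  have h0 : ∀ (g : ℕ → M) h, interleave g h 0 = g 0 := fun g h => interleave_even g h 0
  rw [interleave_even, h0]
  rfl

theorem comp {f : α → M} (h : DefFun S f) (g : β → α) [hg : CtxMap (M := M) g] :
    DefFun S (fun y => f (g y)) := by
  obtain ⟨⟨ρ, hρ⟩, ⟨σ, hσ⟩⟩ := hg
  have : CtxMap (M := M) (fun p : β × M => (g p.1, p.2)) := by
    refine ⟨⟨fun j => if j = 0 then 0 else ρ (j - 1) + 1, fun x => funext fun j => ?_⟩,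
      ⟨σ, fun x => hσ x.1⟩⟩
    cases j with
    | zero => rfl
    | succ j => exact congrFun (hρ x.1) j
  exact ⟨h.out.comp (fun p : β × M => (g p.1, p.2))⟩

/-- Substitution of a function for the last number of the context. -/
theorem subst {P : α → M → Prop} {f : α → M} (hf : DefFun S f)
    (hP : Ar S (fun p : α × M => P p.1 p.2)) : Ar S (fun x => P x (f x)) :=
  have := hf.out
  Ar.congr (P := fun x => ∃ a, a = f x ∧ P x a) inferInstance fun x => by simp

end DefFun

namespace DefSet

instance const (X : Set M) [h : Fact (X ∈ S)] : DefSet S (fun _ : α => X) :=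
  ⟨⟨fun _ => 0, fun _ => X, _, RawDef.mem 0 1, fun _ => Or.inl h.out, fun x => by
    simp [interleave, Ctx.num, consSeq]⟩⟩

instance snd (f : β → α × Set M) [hf : CtxMap (M := M) f] : DefSet S (fun x => (f x).2) := by
  obtain ⟨_, ⟨σ, hσ⟩⟩ := hf
  refine ⟨DefFun.sndRaw _ (RawDef.mem 0 (2 * σ 0)) (fun _ => 0) fun x => ?_⟩
  have : (f x.1).2 = Ctx.set x.1 (σ 0) := congrFun (hσ x.1) 0
  rw [this]
  have h0 : ∀ (g : ℕ → M) h, interleave g h 0 = g 0 := fun g h => interleave_even g h 0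
  rw [interleave_even, h0]
  rfl

theorem comp {F : α → Set M} (h : DefSet S F) (g : β → α) [hg : CtxMap (M := M) g] :
    DefSet S (fun y => F (g y)) := by
  obtain ⟨⟨ρ, hρ⟩, ⟨σ, hσ⟩⟩ := hg
  have : CtxMap (M := M) (fun p : β × M => (g p.1, p.2)) := by
    refine ⟨⟨fun j => if j = 0 then 0 else ρ (j - 1) + 1, fun x => funext fun j => ?_⟩,
      ⟨σ, fun x => hσ x.1⟩⟩
    cases j with
    | zero => rfl
    | succ j => exact congrFun (hρ x.1) j
  exact ⟨h.out.comp (fun p : β × M => (g p.1, p.2))⟩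

instance setOf {P : α → M → Prop} [h : Ar S (fun p : α × M => P p.1 p.2)] :
    DefSet S (fun x => {a | P x a}) := ⟨h⟩

end DefSet

instance (priority := low) DefFun.instComp {f : α → M} [h : DefFun S f] (g : β → α)
    [CtxMap (M := M) g] : DefFun S (fun y => f (g y)) := h.comp g

instance (priority := low) DefSet.instComp {F : α → Set M} [h : DefSet S F] (g : β → α)
    [CtxMap (M := M) g] : DefSet S (fun y => F (g y)) := h.comp g

namespace Ar

variable {f g : α → M} {F : α → Set M}

instance eq [hf : DefFun S f] [hg : DefFun S g] : Ar S (fun x => f x = g x) :=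
  have := hg.out
  hf.subst (P := fun x a => a = g x) this

instance mem [hf : DefFun S f] [hF : DefSet S F] : Ar S (fun x => f x ∈ F x) :=
  hf.subst (P := fun x a => a ∈ F x) hF.out

instance lt [hf : DefFun S f] [hg : DefFun S g] : Ar S (fun x => f x < g x) := by
  have h0 : Ar S (fun p : (α × M) × M => p.1.2 < p.2) :=
    DefFun.sndRaw _ (RawDef.lt 2 0) (fun _ => 0) fun x => by
      simp [interleave, Ctx.num, consSeq]
  have h1 : Ar S (fun p : α × M => p.2 < g p.1) :=
    DefFun.subst (P := fun (p : α × M) b => p.2 < b) (f := fun p => g p.1) inferInstance h0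
  exact hf.subst (P := fun x a => a < g x) h1

instance true : Ar S (fun _ : α => True) :=
  congr (P := fun _ => (0 : M) = 0) inferInstance fun _ => by simp

instance false : Ar S (fun _ : α => False) :=
  congr (P := fun _ => ¬ True) inferInstance fun _ => by simp

end Ar

namespace DefFun

variable {f g : α → M}

instance add [hf : DefFun S f] [hg : DefFun S g] : DefFun S (fun x => f x + g x) := by
  have h0 : Ar S (fun p : ((α × M) × M) × M => p.1.1.2 = p.1.2 + p.2) :=
    sndRaw _ (RawDef.eq_add 4 2 0) (fun _ => 0) fun x => by
      simp [interleave, Ctx.num, consSeq]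
  have h1 : Ar S (fun p : (α × M) × M => p.1.2 = p.2 + g p.1.1) :=
    DefFun.subst (P := fun (p : (α × M) × M) b => p.1.2 = p.2 + b) (f := fun p => g p.1.1)
      inferInstance h0
  exact ⟨DefFun.subst (P := fun (p : α × M) b => p.2 = b + g p.1) (f := fun p => f p.1)
      inferInstance h1⟩

instance mul [hf : DefFun S f] [hg : DefFun S g] : DefFun S (fun x => f x * g x) := by
  have h0 : Ar S (fun p : ((α × M) × M) × M => p.1.1.2 = p.1.2 * p.2) :=
    sndRaw _ (RawDef.eq_mul 4 2 0) (fun _ => 0) fun x => by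
      simp [interleave, Ctx.num, consSeq]
  have h1 : Ar S (fun p : (α × M) × M => p.1.2 = p.2 * g p.1.1) :=
    DefFun.subst (P := fun (p : (α × M) × M) b => p.1.2 = p.2 * b) (f := fun p => g p.1.1)
      inferInstance h0
  exact ⟨DefFun.subst (P := fun (p : α × M) b => p.2 = b * g p.1) (f := fun p => f p.1)
      inferInstance h1⟩

instance pair [hf : DefFun S f] [hg : DefFun S g] : DefFun S (fun x => l2Pair (f x) (g x)) := by
  unfold l2Pair; infer_instance

end DefFun

instance DefSet.slice {F : α → Set M} {f : α → M} [DefSet S F] [DefFun S f] :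
    DefSet S (fun x => slice (F x) (f x)) := by
  unfold _root_.slice; infer_instance

instance DefSet.stageSet {F : α → Set M} {f g : α → M} [DefSet S F] [DefFun S f] [DefFun S g] :
    DefSet S (fun x => stageSet (F x) (f x) (g x)) := by
  unfold _root_.stageSet; infer_instance

instance Ar.setEq {F G : α → Set M} [DefSet S F] [DefSet S G] : Ar S (fun x => F x = G x) :=
  Ar.congr (P := fun x => ∀ a, a ∈ F x ↔ a ∈ G x) inferInstance fun _ => Set.ext_iff

end Definability

section Comprehension

variable {M : Type u} [L1Structure M] {S : Set (Set M)}

theorem ModelsACA0.empty_mem (h : ModelsACA0 S) : (∅ : Set M) ∈ S := by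
  obtain ⟨X, hX⟩ := h.nonempty
  have := h.comprehension (.neg (.eq .zero .zero)) trivial 0 (fun _ => 0) (fun _ => X) fun _ => hX
  simpa [L2Formula.Sat] using this

theorem ModelsACA0.defSet_mem (h : ModelsACA0 S) {F : Set M}
    [hF : DefSet S (fun _ : PUnit.{u + 1} => F)] : F ∈ S := by
  obtain ⟨p, V, Q, ⟨φ, hφ, hQ⟩, hV, hP⟩ := hF.out
  have hV' : ∀ j, interleave (fun _ => ∅) V j ∈ S := fun j => by
    unfold interleave; split_ifs
    · exact h.empty_mem
    · exact (hV _).elim id fun h' => by rw [h']; exact h.empty_mem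
  have := h.comprehension φ hφ 1 (fun k => interleave (fun _ => 0) p (k / 2)) _ hV'
  convert this using 1
  ext a
  rw [Set.mem_ofPred_eq, L2Formula.sat_iff_of_isArithmetical (S' := ∅) hφ, hQ]
  refine (hP (PUnit.unit, a)).trans (iff_of_eq ?_)
  have h0 : ∀ j, (2 * j + 1) / 2 = j := fun j => by omega
  congr 1
  apply eq_of_even_odd <;> intro j
  · cases j with
    | zero => simp [Ctx.num, consSeq]
    | succ j => simp [Ctx.num, consSeq, h0]
  · simp [h0]

theorem ModelsACA0.setOf_mem (h : ModelsACA0 S) {P : M → Prop}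
    [Ar S (fun p : PUnit.{u + 1} × M => P p.2)] : {a | P a} ∈ S :=
  h.defSet_mem

/-- Every operator that is given by an existential set quantifier in front of an arithmetical
predicate is the operator of a `Σ¹₁` formula. -/
theorem ModelsACA0.exists_formulaOperator_eq (h : ModelsACA0 S)
    {P : M → M → Set M → Set M → Prop}
    [hP : Ar S (fun p : (((PUnit.{u + 1} × M) × M) × Set M) × Set M =>
      P p.1.1.1.2 p.1.1.2 p.1.2 p.2)] :
    ∃ (φ : L2Formula) (v : ℕ → M) (V : ℕ → Set M), φ.IsSigmaOne 1 ∧ (∀ j, V j ∈ S) ∧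
      ∀ i Y, formulaOperator S φ v V i Y = {x | ∃ A ∈ S, P i x Y A} := by
  obtain ⟨p, V, Q, ⟨φ, hφ, hQ⟩, hV, hP⟩ := hP
  have hV' : ∀ j, interleave (fun _ => ∅) V (j - 2) ∈ S := fun j => by
    unfold interleave; split_ifs
    · exact h.empty_mem
    · exact (hV _).elim id fun h' => by rw [h']; exact h.empty_mem
  -- The variables for `x` and `i` are moved to the names `1` and `0`, those for the set bound by
  -- the quantifier and for `Y` to the names `1` and `0`; the parameters keep out of their way.
  refine ⟨.exSet 1 (φ.rename (fun n => if n / 2 = 0 then 1 else if n / 2 = 2 then 0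
      else 2 * (n / 2) + 1) (fun k => if k = 0 then 1 else if k = 2 then 0 else k + 2) 1),
    fun k => interleave (fun _ => 0) p (k / 2), fun j => interleave (fun _ => ∅) V (j - 2),
    .ex _ _ _ (.arith _ _ (hφ.rename _ _ _)), hV', fun i Y => ?_⟩
  ext x
  refine exists_congr fun A => and_congr_right fun _ => ?_
  rw [L2Formula.sat_rename (S' := ∅) hφ _ _ _ (fun j => by split_ifs <;> omega), hQ]
  refine Iff.symm ((hP ((((PUnit.unit, i), x), Y), A)).trans (iff_of_eq ?_))
  have h0 : ∀ j, (2 * j + 1) / 2 = j := fun j => by omega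
  congr 1
  · apply eq_of_even_odd <;> intro j
    · rcases j with _ | _ | j
      · simp [Ctx.num, consSeq]
      · simp only [Ctx.num]; exact interleave_even _ _ 1
      · simp [Ctx.num, consSeq, h0, Function.update]
    · have h1 : ¬ (2 * j + 1 = 2) := by omega
      simp [Ctx.num, h0, h1, Function.update]
  · apply eq_of_even_odd <;> intro j
    · rcases j with _ | _ | j
      · simp [Ctx.set, consSeq]
      · simp only [Ctx.set]; exact interleave_even _ _ 1
      · simp [Ctx.set, consSeq, Function.update]
    · have h1 : ¬ (2 * j + 1 = 2) := by omega
      simp [Ctx.set, h1, Function.update]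

end Comprehension

/-! ### Arithmetic in a model of `ACA₀` -/

namespace ModelsACA0

variable {M : Type u} [L1Structure M] {S : Set (Set M)}

theorem ind (h : ModelsACA0 S) {P : M → Prop} [Ar S (fun p : PUnit.{u + 1} × M => P p.2)]
    (h0 : P 0) (hs : ∀ a, P a → P (a + 1)) (a : M) : P a :=
  h.induction {a | P a} h.setOf_mem h0 hs a

theorem zero_add (h : ModelsACA0 S) (a : M) : 0 + a = a :=
  h.ind (P := fun a => 0 + a = a) (h.add_zero 0) (fun a ih => by rw [h.add_succ, ih]) a

theorem succ_add (h : ModelsACA0 S) (a b : M) : a + 1 + b = a + b + 1 :=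
  h.ind (P := fun b => a + 1 + b = a + b + 1) (by rw [h.add_zero, h.add_zero])
    (fun b ih => by rw [h.add_succ, ih, h.add_succ]) b

theorem add_comm (h : ModelsACA0 S) (a b : M) : a + b = b + a :=
  h.ind (P := fun b => a + b = b + a) (by rw [h.add_zero, h.zero_add])
    (fun b ih => by rw [h.add_succ, ih, h.succ_add]) b

theorem add_assoc (h : ModelsACA0 S) (a b c : M) : a + b + c = a + (b + c) :=
  h.ind (P := fun c => a + b + c = a + (b + c)) (by rw [h.add_zero, h.add_zero])
    (fun c ih => by rw [h.add_succ, ih, h.add_succ, h.add_succ]) c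

theorem zero_mul (h : ModelsACA0 S) (a : M) : 0 * a = 0 :=
  h.ind (P := fun a => 0 * a = 0) (h.mul_zero 0)
    (fun a ih => by rw [h.mul_succ, ih, h.add_zero]) a

theorem succ_mul (h : ModelsACA0 S) (a b : M) : (a + 1) * b = a * b + b :=
  h.ind (P := fun b => (a + 1) * b = a * b + b) (by rw [h.mul_zero, h.mul_zero, h.add_zero])
    (fun b ih => by
      rw [h.mul_succ, ih, h.mul_succ, h.add_succ (a * b + a), h.add_assoc, h.add_assoc,
        h.add_comm b (a + 1),
        h.succ_add, h.add_succ (a * b + a), ← h.add_assoc, ← h.add_assoc]) b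

theorem mul_comm (h : ModelsACA0 S) (a b : M) : a * b = b * a :=
  h.ind (P := fun b => a * b = b * a) (by rw [h.mul_zero, h.zero_mul])
    (fun b ih => by rw [h.mul_succ, ih, h.succ_mul]) b

theorem mul_add (h : ModelsACA0 S) (a b c : M) : a * (b + c) = a * b + a * c :=
  h.ind (P := fun c => a * (b + c) = a * b + a * c) (by rw [h.add_zero, h.mul_zero, h.add_zero])
    (fun c ih => by rw [h.add_succ, h.mul_succ, ih, h.mul_succ, h.add_assoc]) c

theorem mul_assoc (h : ModelsACA0 S) (a b c : M) : a * b * c = a * (b * c) :=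
  h.ind (P := fun c => a * b * c = a * (b * c)) (by rw [h.mul_zero, h.mul_zero, h.mul_zero])
    (fun c ih => by rw [h.mul_succ, ih, h.mul_succ, h.mul_add]) c

theorem mul_one (h : ModelsACA0 S) (a : M) : a * 1 = a := by
  rw [← h.zero_add 1, h.mul_succ, h.mul_zero, h.zero_add]

/-- The commutative semiring structure on the first-order part. -/
@[reducible] def commSemiring (h : ModelsACA0 S) : CommSemiring M where
  add_assoc := h.add_assoc
  zero_add := h.zero_add
  add_zero := h.add_zero
  add_comm := h.add_comm
  left_distrib := h.mul_add
  right_distrib a b c := by rw [h.mul_comm, h.mul_add, h.mul_comm c a, h.mul_comm c b]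
  zero_mul := h.zero_mul
  mul_zero := h.mul_zero
  mul_assoc := h.mul_assoc
  one_mul a := by rw [h.mul_comm, h.mul_one]
  mul_one := h.mul_one
  mul_comm := h.mul_comm
  nsmul := nsmulRec
  npow := npowRec

theorem eq_zero_or_succ (h : ModelsACA0 S) (a : M) : a = 0 ∨ ∃ b, a = b + 1 :=
  h.ind (P := fun a => a = 0 ∨ ∃ b, a = b + 1) (Or.inl rfl) (fun a _ => Or.inr ⟨a, rfl⟩) a

theorem add_right_cancel (h : ModelsACA0 S) {a b : M} (c : M) : a + c = b + c → a = b :=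
  h.ind (P := fun c => a + c = b + c → a = b) (by rw [h.add_zero, h.add_zero]; exact id)
    (fun c ih hc => by rw [h.add_succ, h.add_succ] at hc; exact ih (h.succ_inj _ _ hc)) c

theorem lt_iff (h : ModelsACA0 S) (a b : M) : a < b ↔ ∃ c, b = a + (c + 1) := by
  refine h.ind (P := fun b => a < b ↔ ∃ c, b = a + (c + 1)) ?_ (fun b ih => ?_) b
  · refine ⟨fun h' => (h.not_lt_zero a h').elim, fun ⟨c, hc⟩ => ?_⟩
    rw [h.add_succ] at hc
    exact (h.succ_ne_zero _ hc.symm).elim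
  · rw [h.lt_succ_iff, ih]
    constructor
    · rintro (⟨c, rfl⟩ | rfl)
      · exact ⟨c + 1, by rw [h.add_succ a (c + 1)]⟩
      · exact ⟨0, by rw [h.zero_add]⟩
    · rintro ⟨c, hc⟩
      rw [h.add_succ] at hc
      obtain rfl := h.succ_inj _ _ hc
      rcases h.eq_zero_or_succ c with rfl | ⟨c, rfl⟩
      · right; rw [h.add_zero]
      · left; exact ⟨c, rfl⟩

theorem lt_irrefl (h : ModelsACA0 S) (a : M) : ¬ a < a := by
  rw [h.lt_iff]
  rintro ⟨c, hc⟩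
  have : 0 + a = (c + 1) + a := by rw [h.zero_add, h.add_comm (c + 1) a]; exact hc
  exact h.succ_ne_zero c (h.add_right_cancel a this).symm

theorem lt_trans (h : ModelsACA0 S) {a b c : M} (hab : a < b) (hbc : b < c) : a < c := by
  rw [h.lt_iff] at *
  obtain ⟨d, rfl⟩ := hab
  obtain ⟨e, rfl⟩ := hbc
  exact ⟨d + 1 + e, by rw [h.add_assoc, h.add_succ (d + 1) e]⟩

theorem lt_succ_self (h : ModelsACA0 S) (a : M) : a < a + 1 := (h.lt_succ_iff a a).2 (Or.inr rfl)

theorem zero_lt_succ (h : ModelsACA0 S) (a : M) : 0 < a + 1 :=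
  (h.lt_iff _ _).2 ⟨a, (h.zero_add _).symm⟩

theorem lt_trichotomy (h : ModelsACA0 S) (a b : M) : a < b ∨ a = b ∨ b < a := by
  refine h.ind (P := fun b => a < b ∨ a = b ∨ b < a) ?_ (fun b ih => ?_) b
  · rcases h.eq_zero_or_succ a with rfl | ⟨c, rfl⟩
    exacts [Or.inr (Or.inl rfl), Or.inr (Or.inr (h.zero_lt_succ c))]
  · rcases ih with h' | rfl | h'
    · exact Or.inl (h.lt_trans h' (h.lt_succ_self b))
    · exact Or.inl (h.lt_succ_self a)
    · obtain ⟨c, rfl⟩ := (h.lt_iff _ _).1 h'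
      rcases h.eq_zero_or_succ c with rfl | ⟨c, rfl⟩
      · right; left; rw [h.zero_add]
      · right; right
        exact (h.lt_iff _ _).2 ⟨c, by rw [h.succ_add b (c + 1), h.add_succ b (c + 1)]⟩

theorem not_lt_iff (h : ModelsACA0 S) {a b : M} : ¬ a < b ↔ b < a ∨ b = a := by
  constructor
  · intro h'
    rcases h.lt_trichotomy a b with h'' | rfl | h''
    exacts [(h' h'').elim, Or.inr rfl, Or.inl h'']
  · rintro (h' | rfl) h''
    exacts [h.lt_irrefl _ (h.lt_trans h' h''), h.lt_irrefl _ h'']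

/-- The least number principle. -/
theorem exists_least (h : ModelsACA0 S) {P : M → Prop}
    [Ar S (fun p : PUnit.{u + 1} × M => P p.2)] (hP : ∃ a, P a) :
    ∃ a, P a ∧ ∀ b, b < a → ¬ P b := by
  by_contra! hc
  have : Fact ({a | P a} ∈ S) := ⟨h.setOf_mem⟩
  have key : ∀ a, ∀ b, b < a → ¬ P b := by
    refine h.ind (P := fun a => ∀ b, b < a → ¬ b ∈ {a | P a})
      (fun b hb => (h.not_lt_zero b hb).elim) fun a ih b hb hPb => ?_
    rcases (h.lt_succ_iff b a).1 hb with hb | rfl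
    · exact ih b hb hPb
    · obtain ⟨c, hc, hPc⟩ := hc b hPb
      exact ih c hc hPc
  obtain ⟨a, ha⟩ := hP
  exact key (a + 1) a (h.lt_succ_self a) ha

theorem pair_inj (h : ModelsACA0 S) {a b c d : M} :
    l2Pair a b = l2Pair c d ↔ a = c ∧ b = d := by
  let := h.commSemiring
  -- The square of `a + b` is the greatest square that is at most `(a + b)² + a`.
  have key : ∀ a b c d : M, a + b < c + d → l2Pair a b ≠ l2Pair c d := by
    intro a b c d hlt heq
    obtain ⟨e, he⟩ := (h.lt_iff _ _).1 hlt
    unfold l2Pair at heq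
    rw [he] at heq
    have : 0 + ((a + b) * (a + b) + a) =
        (a + b + b + (a + b) * e + (a + b) * e + e * e + e + e + c + 1) +
          ((a + b) * (a + b) + a) := by
      refine (h.zero_add _).trans (heq.trans ?_)
      ring
    exact h.succ_ne_zero _ (h.add_right_cancel _ this).symm
  constructor
  · intro heq
    rcases h.lt_trichotomy (a + b) (c + d) with hlt | hs | hlt
    · exact (key _ _ _ _ hlt heq).elim
    · unfold l2Pair at heq
      rw [hs, h.add_comm, h.add_comm _ c] at heq
      obtain rfl := h.add_right_cancel _ heq
      rw [h.add_comm, h.add_comm a d] at hs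
      exact ⟨rfl, h.add_right_cancel _ hs⟩
    · exact (key _ _ _ _ hlt heq.symm).elim
  · rintro ⟨rfl, rfl⟩; rfl

theorem lt_pair_left (h : ModelsACA0 S) (a b : M) : a < l2Pair a b + 1 := by
  let := h.commSemiring
  refine (h.lt_iff _ _).2 ⟨(a + b) * (a + b), ?_⟩
  unfold l2Pair; ring

theorem lt_pair_right (h : ModelsACA0 S) (a b : M) : b < l2Pair a b + 1 := by
  let := h.commSemiring
  rcases h.eq_zero_or_succ (a + b) with h0 | ⟨e, he⟩
  · rcases h.eq_zero_or_succ b with rfl | ⟨c, rfl⟩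
    · exact h.zero_lt_succ _
    · rw [h.add_succ] at h0
      exact (h.succ_ne_zero _ h0).elim
  · refine (h.lt_iff _ _).2 ⟨(e + 1) * e + a + a, ?_⟩
    have : l2Pair a b = (e + 1) * e + (a + b) + a := by unfold l2Pair; rw [he]; ring
    rw [this]; ring

theorem zero_ne_one (h : ModelsACA0 S) : (0 : M) ≠ 1 := fun h' =>
  h.succ_ne_zero 0 (by rw [h.zero_add]; exact h'.symm)

end ModelsACA0

/-- The standard natural number `k` as an element of the first-order part. -/
def num {M : Type u} [L1Structure M] : ℕ → M
  | 0 => 0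
  | k + 1 => num k + 1

theorem ModelsACA0.num_inj {M : Type u} [L1Structure M] {S : Set (Set M)} (h : ModelsACA0 S)
    {j k : ℕ} : (num j : M) = num k ↔ j = k := by
  refine ⟨fun hjk => ?_, fun hjk => by rw [hjk]⟩
  induction j generalizing k with
  | zero =>
    cases k with
    | zero => rfl
    | succ k => exact (h.succ_ne_zero _ hjk.symm).elim
  | succ j ih =>
    cases k with
    | zero => exact (h.succ_ne_zero _ hjk).elim
    | succ k => rw [ih (h.succ_inj _ _ hjk)]

/-! ### `Σ¹₁` comprehension -/

section SigmaComprehension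

variable {M : Type u} [L1Structure M] {S : Set (Set M)}

/-- Together with `CtxMap.pairSet` this generates all maps of contexts. It is not an instance, as
`β` cannot be found by unification. -/
theorem CtxMap.pairNum {α β γ : Type u} [Ctx M α] [Ctx M β] [Ctx M γ] (g : γ → α) (f : γ → β × M)
    [hg : CtxMap (M := M) g] [hf : CtxMap (M := M) f] :
    CtxMap (M := M) (fun x => (g x, (f x).2)) := by
  obtain ⟨⟨ρ, hρ⟩, ⟨σ, hσ⟩⟩ := hg
  obtain ⟨⟨ρ', hρ'⟩, _⟩ := hf
  refine ⟨⟨fun j => if j = 0 then ρ' 0 else ρ (j - 1), fun x => funext fun j => ?_⟩,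
    ⟨σ, fun x => hσ x⟩⟩
  cases j with
  | zero => exact congrFun (hρ' x) 0
  | succ j => exact congrFun (hρ x) j

theorem CtxMap.pairSet {α β γ : Type u} [Ctx M α] [Ctx M β] [Ctx M γ] (g : γ → α)
    (f : γ → β × Set M) [hg : CtxMap (M := M) g] [hf : CtxMap (M := M) f] :
    CtxMap (M := M) (fun x => (g x, (f x).2)) := by
  obtain ⟨⟨ρ, hρ⟩, ⟨σ, hσ⟩⟩ := hg
  obtain ⟨_, ⟨σ', hσ'⟩⟩ := hf
  refine ⟨⟨ρ, fun x => hρ x⟩,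
    ⟨fun j => if j = 0 then σ' 0 else σ (j - 1), fun x => funext fun j => ?_⟩⟩
  cases j with
  | zero => exact congrFun (hσ' x) 0
  | succ j => exact congrFun (hσ x) j

/-- `(M, S)` is a model of `ACA₀` with comprehension for `Σ¹₁` formulas. -/
class SigmaCA (S : Set (Set M)) : Prop where
  aca : ModelsACA0 S
  sigma : ∀ P : M → Set M → Prop, Ar S (fun p : (PUnit.{u + 1} × M) × Set M => P p.1.2 p.2) →
    {x | ∃ A ∈ S, P x A} ∈ S

/-- On contexts of type `α`, a set quantifier over `S` in front of an arithmetical predicate can be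
absorbed into the parameters. This holds, under `Σ¹₁` comprehension, for contexts consisting of
numbers. -/
class SigRule (S : Set (Set M)) (α : Type u) [Ctx M α] : Prop where
  out : ∀ P : α → Set M → Prop, Ar S (fun p : α × Set M => P p.1 p.2) →
    Ar S (fun x => ∃ A ∈ S, P x A)

instance SigRule.base [h : SigmaCA S] : SigRule S (PUnit.{u + 1} × M) where
  out P hP := by
    have : Fact ({x | ∃ A ∈ S, P (PUnit.unit, x) A} ∈ S) :=
      ⟨h.sigma (fun x => P (PUnit.unit, x)) hP⟩
    exact Ar.congr (P := fun p => p.2 ∈ {x | ∃ A ∈ S, P (PUnit.unit, x) A}) inferInstance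
      fun _ => Iff.rfl

instance SigRule.prod {α : Type u} [Ctx M α] [hS : SigmaCA S] [h : SigRule S (α × M)] :
    SigRule S ((α × M) × M) where
  out P hP := by
    -- The last two numbers of the context are merged into one.
    have := CtxMap.pairNum (M := M) (fun p : (((α × M) × Set M) × M) × M => p.1.1.1.1)
      (fun p => p.1)
    have := CtxMap.pairNum (M := M) (fun p : (((α × M) × Set M) × M) × M => (p.1.1.1.1, p.1.2))
      (fun p => p)
    have := CtxMap.pairSet (M := M)
      (fun p : (((α × M) × Set M) × M) × M => ((p.1.1.1.1, p.1.2), p.2)) (fun p => p.1.1)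
    have := CtxMap.pairNum (M := M) (fun p : ((α × M) × M) × M => p.1.1.1) (fun p => p)
    have h1 : Ar S (fun p : (((α × M) × Set M) × M) × M =>
        P ((p.1.1.1.1, p.1.2), p.2) p.1.1.2) :=
      hP.comp (fun p : (((α × M) × Set M) × M) × M => (((p.1.1.1.1, p.1.2), p.2), p.1.1.2))
    have h2 := h.out (fun x A => ∃ a b, x.2 = l2Pair a b ∧ P ((x.1, a), b) A) inferInstance
    have h3 := h2.comp (fun p : ((α × M) × M) × M => (p.1.1.1, p.2))
    have h4 := DefFun.subst (P := fun (x : (α × M) × M) c =>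
      ∃ A ∈ S, ∃ a b, c = l2Pair a b ∧ P ((x.1.1, a), b) A)
      (f := fun x => l2Pair x.1.2 x.2) inferInstance h3
    refine h4.congr fun x => exists_congr fun A => and_congr_right fun _ => ?_
    constructor
    · intro hx; exact ⟨_, _, rfl, hx⟩
    · rintro ⟨a, b, hab, hx⟩
      obtain ⟨rfl, rfl⟩ := hS.aca.pair_inj.1 hab
      exact hx

instance Ar.exSet {α : Type u} [Ctx M α] [h : SigRule S α] {P : α → Set M → Prop}
    [hP : Ar S (fun p : α × Set M => P p.1 p.2)] : Ar S (fun x => ∃ A ∈ S, P x A) := h.out P hP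

instance Ar.allSet {α : Type u} [Ctx M α] [h : SigRule S α] {P : α → Set M → Prop}
    [hP : Ar S (fun p : α × Set M => P p.1 p.2)] : Ar S (fun x => ∀ A ∈ S, P x A) :=
  Ar.congr (P := fun x => ¬ ∃ A ∈ S, ¬ P x A) inferInstance fun x => by simp

/-- Transfinite induction along a well-ordering. -/
theorem IsWellOrdering.induct (h : ModelsACA0 S) {R : Set M} (hR : IsWellOrdering S R)
    {P : M → Prop} [Ar S (fun p : PUnit.{u + 1} × M => P p.2)]
    (step : ∀ ξ ∈ relField R, (∀ ζ, ordLt R ζ ξ → P ζ) → P ξ) : ∀ ξ ∈ relField R, P ξ := by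
  by_contra! hc
  obtain ⟨ξ₀, hξ₀, hP⟩ := hc
  obtain ⟨ξ, ⟨hξP, hξ⟩, hmin⟩ := hR.wf {ξ | ¬ P ξ} h.setOf_mem ⟨ξ₀, hP, hξ₀⟩
  refine hξP (step ξ hξ fun ζ hζ => ?_)
  by_contra hPζ
  exact hζ.2 (hR.antisymm _ _ hζ.1 (hmin ζ ⟨hPζ, ξ, Or.inl hζ.1⟩))

theorem IsWellOrdering.ordLt_of_not_ordLe {R : Set M} (hR : IsWellOrdering S R) {ξ η : M}
    (hξ : ξ ∈ relField R) (hη : η ∈ relField R) (h : ¬ ordLe R ξ η) : ordLt R η ξ :=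
  ⟨(hR.total ξ hξ η hη).resolve_left h, fun he => h (he ▸ hR.refl ξ hξ)⟩

/-- Every point of a well-ordering is the first one, a successor or a limit. -/
theorem IsWellOrdering.cases {R : Set M} (hR : IsWellOrdering S R) {ξ : M}
    (hξ : ξ ∈ relField R) :
    (∀ η ∈ relField R, ordLe R ξ η) ∨ (∃ η, IsNext R η ξ) ∨ IsLimitPoint R ξ := by
  by_contra! hc
  obtain ⟨⟨η, hη, hle⟩, hnext, hlim⟩ := hc
  refine hlim ⟨⟨η, hR.ordLt_of_not_ordLe hξ hη hle⟩, fun ζ hζ => ?_⟩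
  by_contra! hno
  refine hnext ζ ⟨hζ, fun χ hχ => ?_⟩
  by_contra hle
  exact hno χ (hR.ordLt_of_not_ordLe ⟨ξ, Or.inl hχ.1⟩ ⟨ξ, Or.inl hζ.1⟩ hle) hχ

/-- A `Σ¹₁` set is obtained in the first step of the induction by the constant operator with this
value. -/
theorem ModelsACA0.sigmaCA (h : ModelsACA0 S) (hID : SigmaOneOneID S 1) : SigmaCA S where
  aca := h
  sigma P hP := by
    have := CtxMap.fstNum (M := M)
      (fun p : (((PUnit.{u + 1} × M) × M) × Set M) × Set M => p.1.1.1)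
    have := CtxMap.pairNum (M := M)
      (fun p : (((PUnit.{u + 1} × M) × M) × Set M) × Set M => p.1.1.1.1) (fun p => p.1.1)
    have := CtxMap.pairSet (M := M)
      (fun p : (((PUnit.{u + 1} × M) × M) × Set M) × Set M => (p.1.1.1.1, p.1.1.2)) (fun p => p)
    have : Ar S (fun p : (((PUnit.{u + 1} × M) × M) × Set M) × Set M => P p.1.1.2 p.2) :=
      hP.comp (fun p : (((PUnit.{u + 1} × M) × M) × Set M) × Set M =>
        ((p.1.1.1.1, p.1.1.2), p.2))
    obtain ⟨φ, v, V, hφ, hV, hΓ⟩ := h.exists_formulaOperator_eq (S := S) (P := fun _ x _ A => P x A)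
    obtain ⟨R, hRS, H, hHS, hRH⟩ := hID φ hφ v V hV
    have hwo := hRH.wellOrdering
    have h01 : (0 : M) < 1 := by
      have := h.zero_lt_succ 0
      rwa [h.zero_add] at this
    have hone : ∀ i : M, i < 1 → i = 0 := fun i hi => by
      rw [← h.zero_add 1, h.lt_succ_iff] at hi
      exact hi.resolve_left (h.not_lt_zero i)
    obtain ⟨ω, hω, hlast, hclosed⟩ := hRH.final
    have : Fact (R ∈ S) := ⟨hRS⟩
    have : Fact (H ∈ S) := ⟨hHS⟩
    obtain ⟨ξ, ⟨-, hξ⟩, hmin⟩ := hwo.wf {ξ | ξ = ξ} h.setOf_mem ⟨ω, rfl, hω⟩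
    have hmin' : ∀ η ∈ relField R, ordLe R ξ η := fun η hη => hmin η ⟨rfl, hη⟩
    have hempty := hRH.initial ξ hξ hmin' 0 h01
    by_cases hξω : ξ = ω
    · subst hξω
      have := hclosed 0 h01
      rw [hΓ, hempty, Set.subset_empty_iff] at this
      rw [this]
      exact h.empty_mem
    · obtain ⟨η, ⟨hη, hηf⟩, hηmin⟩ := hwo.wf {η | l2Pair ξ η ∈ R ∧ ξ ≠ η} h.setOf_mem
        ⟨ω, ⟨hmin' ω hω, hξω⟩, hω⟩
      have hnext : IsNext R ξ η := by
        refine ⟨hη, fun ζ hζ => ?_⟩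
        have hζf : ζ ∈ relField R := ⟨η, Or.inl hζ.1⟩
        by_contra hle
        exact hζ.2 (hwo.antisymm _ _ hζ.1
          (hηmin ζ ⟨hwo.ordLt_of_not_ordLe hζf hξ hle, hζf⟩))
      obtain ⟨i, hi, -, -, hT, -⟩ := hRH.next ξ η hnext
      obtain rfl := hone i hi
      have := hT 0 (Or.inr rfl)
      rw [hΓ, hempty, Set.empty_union] at this
      rw [← this]
      exact h.defSet_mem

end SigmaComprehension

/-! ### A finite basis for arithmetical comprehension -/

section SetOperations

variable {M : Type u} [L1Structure M] {S : Set (Set M)}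

/-- Finitely many operations on sets, closure under which amounts to arithmetical comprehension.
A set is read either as a set of numbers or as a binary relation, coded by pairs; `p` is a number
parameter, which only the constant operation uses. -/
def setOp : ℕ → M → Set M → Set M → Set M
  -- complement of the intersection
  | 0, _, X, B => {c | ¬ (c ∈ X ∧ c ∈ B)}
  -- inverse image of `B` under the relation `X`
  | 1, _, X, B => {c | ∃ d, l2Pair c d ∈ X ∧ d ∈ B}
  -- pointwise sum, product, equality and comparison of two functional relations
  | 2, _, X, B => {c | ∃ e y z, c = l2Pair e (y + z) ∧ l2Pair e y ∈ X ∧ l2Pair e z ∈ B}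
  | 3, _, X, B => {c | ∃ e y z, c = l2Pair e (y * z) ∧ l2Pair e y ∈ X ∧ l2Pair e z ∈ B}
  | 4, _, X, B => {e | ∃ y, l2Pair e y ∈ X ∧ l2Pair e y ∈ B}
  | 5, _, X, B => {e | ∃ y z, l2Pair e y ∈ X ∧ l2Pair e z ∈ B ∧ y < z}
  -- the constant function with value `p`, and the identity function
  | 6, p, _, _ => {c | ∃ e, c = l2Pair e p}
  | 7, _, _, _ => {c | ∃ e, c = l2Pair e e}
  -- the function `e ↦ (X e, B e)`
  | 8, _, X, B => {c | ∃ e y z, c = l2Pair e (l2Pair y z) ∧ l2Pair e y ∈ X ∧ l2Pair e z ∈ B}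
  -- the first projection, and the composition of `X` with the second projection
  | 9, _, _, _ => {c | ∃ a r, c = l2Pair (l2Pair a r) a}
  | 10, _, X, _ => {c | ∃ a r y, c = l2Pair (l2Pair a r) y ∧ l2Pair r y ∈ X}
  -- change of the first component, and the relation `X` on the second component
  | 11, _, _, _ => {c | ∃ a b r, c = l2Pair (l2Pair a r) (l2Pair b r)}
  | 12, _, X, _ => {c | ∃ a r s, c = l2Pair (l2Pair a r) (l2Pair a s) ∧ l2Pair r s ∈ X}
  | _ + 13, _, X, _ => X

instance DefSet.setOp {α : Type u} [Ctx M α] (k : ℕ) {p : α → M} {X B : α → Set M}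
    [DefFun S p] [DefSet S X] [DefSet S B] : DefSet S (fun x => setOp k (p x) (X x) (B x)) := by
  match k with
  | 0 | 1 | 2 | 3 | 4 | 5 | 6 | 7 | 8 | 9 | 10 | 11 | 12 | _ + 13 =>
    simp only [_root_.setOp]; infer_instance

/-- Closure of a nonempty family of sets under the operations `setOp`. -/
structure OpClosed (Z : Set (Set M)) : Prop where
  nonempty : Z.Nonempty
  op_mem : ∀ k p X B, X ∈ Z → B ∈ Z → setOp k p X B ∈ Z

theorem ModelsACA0.opClosed (h : ModelsACA0 S) : OpClosed S where
  nonempty := h.nonempty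
  op_mem k p X B hX hB := by
    have : Fact (X ∈ S) := ⟨hX⟩
    have : Fact (B ∈ S) := ⟨hB⟩
    exact h.defSet_mem

/-- A strict upper bound for the variables of a term. -/
def L2Term.bound : L2Term → ℕ
  | .var i => i + 1
  | .zero => 0
  | .one => 0
  | .add t s => max t.bound s.bound
  | .mul t s => max t.bound s.bound

/-- A strict upper bound for the number variables, free or bound, of a formula. -/
def L2Formula.bound : L2Formula → ℕ
  | .eq t s => max t.bound s.bound
  | .lt t s => max t.bound s.bound
  | .mem t _ => t.bound
  | .neg φ => φ.bound
  | .and φ ψ => max φ.bound ψ.bound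
  | .allNum i φ => max (i + 1) φ.bound
  | .exNum i φ => max (i + 1) φ.bound
  | .allSet _ φ => φ.bound
  | .exSet _ φ => φ.bound

/-- `e = (v₀, (v₁, (… (v_{N-1}, r) …)))` for some `r`: the number `e` codes the values of the first
`N` variables. -/
def IsEnv : ℕ → M → (ℕ → M) → Prop
  | 0, _, _ => True
  | N + 1, e, v => ∃ r, e = l2Pair (v 0) r ∧ IsEnv N r (fun j => v (j + 1))

theorem exists_isEnv (N : ℕ) (v : ℕ → M) : ∃ e, IsEnv N e v := by
  induction N generalizing v with
  | zero => exact ⟨0, trivial⟩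
  | succ N ih =>
    obtain ⟨r, hr⟩ := ih (fun j => v (j + 1))
    exact ⟨_, r, rfl, hr⟩

namespace OpClosed

variable {Z : Set (Set M)}

theorem exists_mem_var (h : ModelsACA0 S) (hZ : OpClosed Z) (i N : ℕ) (hi : i < N) :
    ∃ Q ∈ Z, ∀ e v, IsEnv N e v → ∀ x, l2Pair e x ∈ Q ↔ x = v i := by
  obtain ⟨X, hX⟩ := hZ.nonempty
  induction i generalizing N with
  | zero =>
    obtain ⟨N, rfl⟩ := Nat.exists_eq_succ_of_ne_zero hi.ne'
    refine ⟨_, hZ.op_mem 9 0 X X hX hX, fun e v he x => ?_⟩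
    obtain ⟨r, rfl, -⟩ := he
    constructor
    · rintro ⟨a, s, hc⟩
      obtain ⟨h1, rfl⟩ := h.pair_inj.1 hc
      exact (h.pair_inj.1 h1).1.symm
    · rintro rfl; exact ⟨_, _, rfl⟩
  | succ i ih =>
    obtain ⟨N, rfl⟩ := Nat.exists_eq_succ_of_ne_zero (Nat.ne_zero_of_lt hi)
    obtain ⟨Q, hQ, hi⟩ := ih N (by omega)
    refine ⟨_, hZ.op_mem 10 0 Q X hQ hX, fun e v he x => ?_⟩
    obtain ⟨r, rfl, hr⟩ := he
    rw [← hi r _ hr]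
    constructor
    · rintro ⟨a, s, y, hc, hy⟩
      obtain ⟨h1, rfl⟩ := h.pair_inj.1 hc
      obtain ⟨-, rfl⟩ := h.pair_inj.1 h1
      exact hy
    · intro hx; exact ⟨_, _, _, rfl, hx⟩

/-- The value of a term, as a function of the code of the variables, is a relation in `Z`. -/
theorem exists_mem_term (h : ModelsACA0 S) (hZ : OpClosed Z) (N : ℕ) (t : L2Term)
    (ht : t.bound ≤ N) : ∃ Q ∈ Z, ∀ e v, IsEnv N e v → ∀ x, l2Pair e x ∈ Q ↔ x = t.val v := by
  have hconst : ∀ p : M, ∃ Q ∈ Z, ∀ e x, l2Pair e x ∈ Q ↔ x = p := by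
    intro p
    obtain ⟨X, hX⟩ := hZ.nonempty
    refine ⟨_, hZ.op_mem 6 p X X hX hX, fun e x => ⟨?_, ?_⟩⟩
    · rintro ⟨d, hd⟩; exact (h.pair_inj.1 hd).2
    · rintro rfl; exact ⟨_, rfl⟩
  induction t with
  | var i => exact hZ.exists_mem_var h i N ht
  | zero =>
    obtain ⟨Q, hQ, hp⟩ := hconst 0
    exact ⟨Q, hQ, fun e _ _ x => hp e x⟩
  | one =>
    obtain ⟨Q, hQ, hp⟩ := hconst 1
    exact ⟨Q, hQ, fun e _ _ x => hp e x⟩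
  | add t s iht ihs =>
    obtain ⟨Q, hQ, h1⟩ := iht ((le_max_left _ _).trans ht)
    obtain ⟨Q', hQ', h2⟩ := ihs ((le_max_right _ _).trans ht)
    refine ⟨_, hZ.op_mem 2 0 Q Q' hQ hQ', fun e v he x => ⟨?_, ?_⟩⟩
    · rintro ⟨d, y, z, hc, hy, hz⟩
      obtain ⟨rfl, rfl⟩ := h.pair_inj.1 hc
      rw [(h1 _ v he y).1 hy, (h2 _ v he z).1 hz]; rfl
    · rintro rfl
      exact ⟨_, _, _, rfl, (h1 _ v he _).2 rfl, (h2 _ v he _).2 rfl⟩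
  | mul t s iht ihs =>
    obtain ⟨Q, hQ, h1⟩ := iht ((le_max_left _ _).trans ht)
    obtain ⟨Q', hQ', h2⟩ := ihs ((le_max_right _ _).trans ht)
    refine ⟨_, hZ.op_mem 3 0 Q Q' hQ hQ', fun e v he x => ⟨?_, ?_⟩⟩
    · rintro ⟨d, y, z, hc, hy, hz⟩
      obtain ⟨rfl, rfl⟩ := h.pair_inj.1 hc
      rw [(h1 _ v he y).1 hy, (h2 _ v he z).1 hz]; rfl
    · rintro rfl
      exact ⟨_, _, _, rfl, (h1 _ v he _).2 rfl, (h2 _ v he _).2 rfl⟩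

/-- The change of the value of a variable is a relation in `Z`. -/
theorem exists_mem_update (h : ModelsACA0 S) (hZ : OpClosed Z) (i N : ℕ) (hi : i < N) :
    ∃ Q ∈ Z, ∀ e v, IsEnv N e v →
      (∀ e', l2Pair e e' ∈ Q → ∃ a, IsEnv N e' (Function.update v i a)) ∧
        ∀ a, ∃ e', l2Pair e e' ∈ Q ∧ IsEnv N e' (Function.update v i a) := by
  obtain ⟨X, hX⟩ := hZ.nonempty
  induction i generalizing N with
  | zero =>
    obtain ⟨N, rfl⟩ := Nat.exists_eq_succ_of_ne_zero hi.ne'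
    refine ⟨_, hZ.op_mem 11 0 X X hX hX, fun e v he => ?_⟩
    obtain ⟨r, rfl, hr⟩ := he
    have key : ∀ b, IsEnv (N + 1) (l2Pair b r) (Function.update v 0 b) := fun b =>
      ⟨r, by simp, by simpa using hr⟩
    constructor
    · rintro e' ⟨a, b, s, hc⟩
      obtain ⟨h1, rfl⟩ := h.pair_inj.1 hc
      obtain ⟨-, rfl⟩ := h.pair_inj.1 h1
      exact ⟨b, key b⟩
    · intro a; exact ⟨_, ⟨_, _, _, rfl⟩, key a⟩
  | succ i ih =>
    obtain ⟨N, rfl⟩ := Nat.exists_eq_succ_of_ne_zero (Nat.ne_zero_of_lt hi)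
    obtain ⟨Q, hQ, hi⟩ := ih N (by omega)
    refine ⟨_, hZ.op_mem 12 0 Q X hQ hX, fun e v he => ?_⟩
    obtain ⟨r, rfl, hr⟩ := he
    obtain ⟨h1, h2⟩ := hi r _ hr
    have key : ∀ b s, IsEnv N s (Function.update (fun j => v (j + 1)) i b) →
        IsEnv (N + 1) (l2Pair (v 0) s) (Function.update v (i + 1) b) := fun b s hs => by
      refine ⟨s, by simp, ?_⟩
      convert hs using 1
      funext j
      simp [Function.update_apply]
    constructor
    · rintro e' ⟨a, s, s', hc, hs⟩
      obtain ⟨h3, rfl⟩ := h.pair_inj.1 hc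
      obtain ⟨rfl, rfl⟩ := h.pair_inj.1 h3
      obtain ⟨b, hb⟩ := h1 _ hs
      exact ⟨b, key b _ hb⟩
    · intro a
      obtain ⟨s, hs, hs'⟩ := h2 a
      exact ⟨_, ⟨_, _, _, rfl, hs⟩, key a s hs'⟩

/-- Functions `a ↦ (g₀ a, (g₁ a, …))`, where each `gⱼ` is constant or the identity, are in `Z`. -/
theorem exists_mem_env (h : ModelsACA0 S) (hZ : OpClosed Z) (N : ℕ) (i : ℕ) (v : ℕ → M) (b : Bool) :
    ∃ Q ∈ Z, ∃ f : M → M, (∀ a e, l2Pair a e ∈ Q ↔ e = f a) ∧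
      ∀ a, IsEnv N (f a) (if b then Function.update v i a else v) := by
  obtain ⟨X, hX⟩ := hZ.nonempty
  have hconst : ∀ p : M, ∃ Q ∈ Z, ∀ e x, l2Pair e x ∈ Q ↔ x = p := by
    intro p
    refine ⟨_, hZ.op_mem 6 p X X hX hX, fun e x => ⟨?_, ?_⟩⟩
    · rintro ⟨d, hd⟩; exact (h.pair_inj.1 hd).2
    · rintro rfl; exact ⟨_, rfl⟩
  have hid : ∃ Q ∈ Z, ∀ e x : M, l2Pair e x ∈ Q ↔ x = e := by
    refine ⟨_, hZ.op_mem 7 0 X X hX hX, fun e x => ⟨?_, ?_⟩⟩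
    · rintro ⟨d, hd⟩
      obtain ⟨rfl, rfl⟩ := h.pair_inj.1 hd; rfl
    · rintro rfl; exact ⟨_, rfl⟩
  induction N generalizing i v b with
  | zero =>
    obtain ⟨Q, hQ, hp⟩ := hconst 0
    exact ⟨Q, hQ, fun _ => 0, hp, fun _ => trivial⟩
  | succ N ih =>
    have hfork : ∀ g : M → M, (∃ Q ∈ Z, ∀ e x, l2Pair e x ∈ Q ↔ x = g e) → ∀ f : M → M,
        (∃ Q ∈ Z, ∀ e x, l2Pair e x ∈ Q ↔ x = f e) →
          ∃ Q ∈ Z, ∀ e x, l2Pair e x ∈ Q ↔ x = l2Pair (g e) (f e) := by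
      rintro g ⟨Q, hQ, hg⟩ f ⟨Q', hQ', hf⟩
      refine ⟨_, hZ.op_mem 8 0 Q Q' hQ hQ', fun e x => ⟨?_, ?_⟩⟩
      · rintro ⟨d, y, z, hc, hy, hz⟩
        obtain ⟨rfl, rfl⟩ := h.pair_inj.1 hc
        rw [(hg _ _).1 hy, (hf _ _).1 hz]
      · rintro rfl
        exact ⟨_, _, _, rfl, (hg _ _).2 rfl, (hf _ _).2 rfl⟩
    cases b with
    | false =>
      obtain ⟨Q, hQ, f, hf, henv⟩ := ih 0 (fun j => v (j + 1)) false
      obtain ⟨Q', hQ', hg⟩ := hfork (fun _ => v 0) (hconst _) f ⟨Q, hQ, hf⟩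
      exact ⟨Q', hQ', _, hg, fun a => ⟨_, rfl, henv a⟩⟩
    | true =>
      cases i with
      | zero =>
        obtain ⟨Q, hQ, f, hf, henv⟩ := ih 0 (fun j => v (j + 1)) false
        obtain ⟨Q', hQ', hg⟩ := hfork (fun a => a) hid f ⟨Q, hQ, hf⟩
        exact ⟨Q', hQ', _, hg, fun a => ⟨_, by simp; rfl, by simpa using henv a⟩⟩
      | succ i =>
        obtain ⟨Q, hQ, f, hf, henv⟩ := ih i (fun j => v (j + 1)) true
        obtain ⟨Q', hQ', hg⟩ := hfork (fun _ => v 0) (hconst _) f ⟨Q, hQ, hf⟩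
        refine ⟨Q', hQ', _, hg, fun a => ⟨_, by simp; rfl, ?_⟩⟩
        convert henv a using 1
        funext j
        simp [Function.update_apply]

end OpClosed

/-- A family of functions from a type `I` of inputs to sets that contains the constants from `Z`
and is closed under the first two operations `setOp`. -/
structure OpFamily {I : Type*} (Z : Set (Set M)) (F : Set (I → Set M)) : Prop where
  const : ∀ Q ∈ Z, (fun _ => Q) ∈ F
  nand : ∀ D ∈ F, ∀ E ∈ F, (fun J => setOp 0 0 (D J) (E J)) ∈ F
  image : ∀ Q ∈ Z, ∀ D ∈ F, (fun J => setOp 1 0 Q (D J)) ∈ F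

/-- The truth of an arithmetical formula whose set variables depend on an input belongs to every
`OpFamily` that contains these dependencies. -/
theorem OpFamily.exists_truth {I : Type*} {Z : Set (Set M)} {F : Set (I → Set M)}
    (hF : OpFamily Z F) (h : ModelsACA0 S) (hZ : OpClosed Z) (V : I → ℕ → Set M)
    (hV : ∀ j, (fun J => V J j) ∈ F) (N : ℕ) (φ : L2Formula) (hφ : φ.IsArithmetical)
    (hN : φ.bound ≤ N) :
    ∃ D ∈ F, ∀ J e v, IsEnv N e v → (e ∈ D J ↔ φ.Sat ∅ v (V J)) := by
  have hneg : ∀ φ : L2Formula,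
      (∃ D ∈ F, ∀ J e v, IsEnv N e v → (e ∈ D J ↔ φ.Sat ∅ v (V J))) →
        ∃ D ∈ F, ∀ J e v, IsEnv N e v → (e ∈ D J ↔ ¬ φ.Sat ∅ v (V J)) := by
    rintro φ ⟨D, hD, hs⟩
    refine ⟨_, hF.nand D hD D hD, fun J e v he => ?_⟩
    rw [← hs J e v he]
    exact not_congr and_self_iff
  have hex : ∀ i (P : I → (ℕ → M) → Prop), i < N →
      (∃ D ∈ F, ∀ J e v, IsEnv N e v → (e ∈ D J ↔ P J v)) →
        ∃ D ∈ F, ∀ J e v, IsEnv N e v → (e ∈ D J ↔ ∃ a, P J (Function.update v i a)) := by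
    rintro i P hi ⟨D, hD, hs⟩
    obtain ⟨Q, hQ, hupd⟩ := hZ.exists_mem_update h i N hi
    refine ⟨_, hF.image Q hQ D hD, fun J e v he => ⟨?_, ?_⟩⟩
    · rintro ⟨d, hd, hdD⟩
      obtain ⟨a, ha⟩ := (hupd e v he).1 d hd
      exact ⟨a, (hs J d _ ha).1 hdD⟩
    · rintro ⟨a, ha⟩
      obtain ⟨d, hd, hda⟩ := (hupd e v he).2 a
      exact ⟨d, hd, (hs J d _ hda).2 ha⟩
  induction φ with
  | eq t s =>
    obtain ⟨Q, hQ, h1⟩ := hZ.exists_mem_term h N t ((le_max_left _ _).trans hN)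
    obtain ⟨Q', hQ', h2⟩ := hZ.exists_mem_term h N s ((le_max_right _ _).trans hN)
    refine ⟨_, hF.const _ (hZ.op_mem 4 0 Q Q' hQ hQ'), fun J e v he => ⟨?_, fun hts => ?_⟩⟩
    · rintro ⟨y, hy, hz⟩
      exact ((h1 e v he y).1 hy).symm.trans ((h2 e v he y).1 hz)
    · exact ⟨_, (h1 e v he _).2 rfl, (h2 e v he _).2 hts⟩
  | lt t s =>
    obtain ⟨Q, hQ, h1⟩ := hZ.exists_mem_term h N t ((le_max_left _ _).trans hN)
    obtain ⟨Q', hQ', h2⟩ := hZ.exists_mem_term h N s ((le_max_right _ _).trans hN)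
    refine ⟨_, hF.const _ (hZ.op_mem 5 0 Q Q' hQ hQ'), fun J e v he => ⟨?_, fun hts => ?_⟩⟩
    · rintro ⟨y, z, hy, hz, hlt⟩
      rw [(h1 e v he y).1 hy, (h2 e v he z).1 hz] at hlt
      exact hlt
    · exact ⟨_, _, (h1 e v he _).2 rfl, (h2 e v he _).2 rfl, hts⟩
  | mem t j =>
    obtain ⟨Q, hQ, h1⟩ := hZ.exists_mem_term h N t hN
    refine ⟨_, hF.image Q hQ _ (hV j), fun J e v he => ⟨?_, fun ht => ?_⟩⟩
    · rintro ⟨d, hd, hdV⟩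
      rw [(h1 e v he d).1 hd] at hdV
      exact hdV
    · exact ⟨_, (h1 e v he _).2 rfl, ht⟩
  | neg φ ih => exact hneg φ (ih hφ hN)
  | and φ ψ ih₁ ih₂ =>
    obtain ⟨D, hD, h1⟩ := ih₁ hφ.1 ((le_max_left _ _).trans hN)
    obtain ⟨E, hE, h2⟩ := ih₂ hφ.2 ((le_max_right _ _).trans hN)
    have h3 := hF.nand D hD E hE
    refine ⟨_, hF.nand _ h3 _ h3, fun J e v he => ?_⟩
    rw [L2Formula.Sat, ← h1 J e v he, ← h2 J e v he]
    simp only [setOp, Set.mem_ofPred_eq, and_self, not_not]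
  | allNum i φ ih =>
    have hi : i < N := (le_max_left _ _).trans hN
    obtain ⟨D, hD, hs⟩ := hneg φ (ih hφ ((le_max_right _ _).trans hN))
    obtain ⟨E, hE, hs'⟩ := hex i (fun J v => ¬ φ.Sat ∅ v (V J)) hi ⟨D, hD, hs⟩
    refine ⟨_, hF.nand E hE E hE, fun J e v he => ?_⟩
    rw [L2Formula.Sat]
    simp only [setOp, Set.mem_ofPred_eq, and_self, hs' J e v he, not_exists, not_not]
  | exNum i φ ih =>
    have hi : i < N := (le_max_left _ _).trans hN
    exact hex i (fun J v => φ.Sat ∅ v (V J)) hi (ih hφ ((le_max_right _ _).trans hN))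
  | allSet | exSet => exact hφ.elim

/-- The operations `setOp` suffice for arithmetical comprehension. -/
theorem OpClosed.modelsACA0 {Z : Set (Set M)} (hZ : OpClosed Z) (h : ModelsACA0 S) (hZS : Z ⊆ S) :
    ModelsACA0 Z := by
  refine { h with
    nonempty := hZ.nonempty
    induction := fun X hX => h.induction X (hZS hX)
    comprehension := fun φ hφ i v V hV => ?_ }
  have hF : OpFamily (I := Unit) Z {D | D () ∈ Z} :=
    ⟨fun Q hQ => hQ, fun D hD E hE => hZ.op_mem 0 0 _ _ hD hE,
      fun Q hQ D hD => hZ.op_mem 1 0 _ _ hQ hD⟩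
  obtain ⟨D, hD, hs⟩ := hF.exists_truth h hZ (fun _ => V) hV _ φ hφ le_rfl
  obtain ⟨Q, hQ, f, hf, henv⟩ := hZ.exists_mem_env h φ.bound i v true
  convert hZ.op_mem 1 0 Q _ hQ hD using 1
  ext a
  simp only [setOp, Set.mem_ofPred_eq, hf, exists_eq_left]
  rw [hs () (f a) (Function.update v i a) (by simpa using henv a),
    L2Formula.sat_iff_of_isArithmetical (S' := ∅) hφ]

end SetOperations

/-! ### Clause systems -/

section Clauses

variable {M : Type u} [L1Structure M] {S : Set (Set M)}

/-- The literal `l` is true of the set `A`: the literals `(0, x)` and `(1, x)` express `x ∈ A` and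
`x ∉ A`. -/
def LitTrue (l : M) (A : Set M) : Prop :=
  (∃ x, l = l2Pair 0 x ∧ x ∈ A) ∨ ∃ x, l = l2Pair 1 x ∧ x ∉ A

/-- The set `A` satisfies the clause system `X`, whose `c`-th clause is the disjunction of the
literals `l` with `(l, c) ∈ X`. -/
def SatClauses (X A : Set M) : Prop := ∀ c, ∃ l, l2Pair l c ∈ X ∧ LitTrue l A

instance {α : Type u} [Ctx M α] {l : α → M} {A : α → Set M} [DefFun S l] [DefSet S A] :
    Ar S (fun x => LitTrue (l x) (A x)) := by
  unfold LitTrue; infer_instance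

instance {α : Type u} [Ctx M α] {X A : α → Set M} [DefSet S X] [DefSet S A] :
    Ar S (fun x => SatClauses (X x) (A x)) := by
  unfold SatClauses; infer_instance

theorem litTrue_zero (h : ModelsACA0 S) {x : M} {A : Set M} : LitTrue (l2Pair 0 x) A ↔ x ∈ A := by
  constructor
  · rintro (⟨y, hy, hyA⟩ | ⟨y, hy, -⟩)
    · rwa [(h.pair_inj.1 hy).2]
    · exact (h.zero_ne_one (h.pair_inj.1 hy).1).elim
  · intro hx; exact Or.inl ⟨x, rfl, hx⟩

theorem litTrue_one (h : ModelsACA0 S) {x : M} {A : Set M} : LitTrue (l2Pair 1 x) A ↔ x ∉ A := by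
  constructor
  · rintro (⟨y, hy, -⟩ | ⟨y, hy, hyA⟩)
    · exact (h.zero_ne_one (h.pair_inj.1 hy).1.symm).elim
    · rwa [(h.pair_inj.1 hy).2]
  · intro hx; exact Or.inr ⟨x, rfl, hx⟩

/-- The predicate `P` of sets is expressed by a clause system in `Z`. -/
def Clausal (Z : Set (Set M)) (P : Set M → Prop) : Prop := ∃ X ∈ Z, ∀ A, SatClauses X A ↔ P A

open Classical in
/-- The map that moves all numbers outside the sections `0` and `1` into the section `k`. -/
noncomputable def shift (k y : M) : M :=
  if ∃ x, y = l2Pair x 0 ∨ y = l2Pair x 1 then y else l2Pair y k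

instance {α : Type u} [Ctx M α] {k y : α → M} [DefFun S k] [DefFun S y] :
    DefFun S (fun x => shift (k x) (y x)) := by
  refine ⟨Ar.congr (P := fun p : α × M =>
    ((∃ x, y p.1 = l2Pair x 0 ∨ y p.1 = l2Pair x 1) ∧ p.2 = y p.1) ∨
      ((¬ ∃ x, y p.1 = l2Pair x 0 ∨ y p.1 = l2Pair x 1) ∧ p.2 = l2Pair (y p.1) (k p.1)))
    inferInstance fun p => ?_⟩
  unfold shift
  split_ifs with hc <;> simp only [hc] <;> simp

/-- The set that shares the sections `0` and `1` with `A` and is otherwise stored in the section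
`k` of `A`. -/
def packed (A : Set M) (k : M) : Set M := {y | shift k y ∈ A}

namespace Clausal

variable {P Q : Set M → Prop}

theorem congr (hP : Clausal S P) (h : ∀ A, P A ↔ Q A) : Clausal S Q := by
  obtain ⟨X, hX, hXP⟩ := hP
  exact ⟨X, hX, fun A => (hXP A).trans (h A)⟩

/-- The clauses with `N c` are made true by putting all literals into them. -/
theorem basic (h : ModelsACA0 S) (N : M → Prop) (L₀ L₁ : M → M → Prop)
    [Ar S (fun p : ((PUnit.{u + 1} × M) × M) × M => N p.2)]
    [Ar S (fun p : (((PUnit.{u + 1} × M) × M) × M) × M => L₀ p.1.2 p.2)]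
    [Ar S (fun p : (((PUnit.{u + 1} × M) × M) × M) × M => L₁ p.1.2 p.2)] :
    Clausal S (fun A => ∀ c, N c ∨ ∃ x, (L₀ c x ∧ x ∈ A) ∨ (L₁ c x ∧ x ∉ A)) := by
  refine ⟨{z | ∃ l c, z = l2Pair l c ∧
    (N c ∨ ∃ x, (l = l2Pair 0 x ∧ L₀ c x) ∨ (l = l2Pair 1 x ∧ L₁ c x))}, h.setOf_mem,
    fun A => forall_congr' fun c => ⟨?_, ?_⟩⟩
  · rintro ⟨l, ⟨l', c', hz, hc⟩, hl⟩
    obtain ⟨rfl, rfl⟩ := h.pair_inj.1 hz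
    rcases hc with hc | ⟨x, ⟨rfl, hx⟩ | ⟨rfl, hx⟩⟩
    · exact Or.inl hc
    · exact Or.inr ⟨x, Or.inl ⟨hx, (litTrue_zero h).1 hl⟩⟩
    · exact Or.inr ⟨x, Or.inr ⟨hx, (litTrue_one h).1 hl⟩⟩
  · rintro (hc | ⟨x, ⟨hx, hA⟩ | ⟨hx, hA⟩⟩)
    · by_cases h0 : (0 : M) ∈ A
      · exact ⟨_, ⟨_, _, rfl, Or.inl hc⟩, (litTrue_zero h).2 h0⟩
      · exact ⟨_, ⟨_, _, rfl, Or.inl hc⟩, (litTrue_one h).2 h0⟩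
    · exact ⟨_, ⟨_, _, rfl, Or.inr ⟨x, Or.inl ⟨rfl, hx⟩⟩⟩, (litTrue_zero h).2 hA⟩
    · exact ⟨_, ⟨_, _, rfl, Or.inr ⟨x, Or.inr ⟨rfl, hx⟩⟩⟩, (litTrue_one h).2 hA⟩

/-- The clauses of the two systems are numbered `(c, 0)` and `(c, 1)`; all other clauses contain
every literal. -/
theorem and (h : ModelsACA0 S) (hP : Clausal S P) (hQ : Clausal S Q) :
    Clausal S (fun A => P A ∧ Q A) := by
  obtain ⟨X, hX, hXP⟩ := hP
  obtain ⟨Y, hY, hYQ⟩ := hQ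
  have : Fact (X ∈ S) := ⟨hX⟩
  have : Fact (Y ∈ S) := ⟨hY⟩
  refine ⟨{z | ∃ l c, z = l2Pair l c ∧ ((∃ d, c = l2Pair d 0 ∧ l2Pair l d ∈ X) ∨
    (∃ d, c = l2Pair d 1 ∧ l2Pair l d ∈ Y) ∨ ¬ ∃ d, c = l2Pair d 0 ∨ c = l2Pair d 1)},
    h.setOf_mem, fun A => ?_⟩
  show _ ↔ P A ∧ Q A
  rw [← hXP, ← hYQ]
  constructor
  · intro hA
    refine ⟨fun c => ?_, fun c => ?_⟩
    · obtain ⟨l, ⟨l', c', hz, hc⟩, hl⟩ := hA (l2Pair c 0)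
      obtain ⟨rfl, rfl⟩ := h.pair_inj.1 hz
      rcases hc with ⟨d, hd, hm⟩ | ⟨d, hd, -⟩ | hno
      · obtain ⟨rfl, -⟩ := h.pair_inj.1 hd
        exact ⟨l, hm, hl⟩
      · exact (h.zero_ne_one (h.pair_inj.1 hd).2).elim
      · exact (hno ⟨c, Or.inl rfl⟩).elim
    · obtain ⟨l, ⟨l', c', hz, hc⟩, hl⟩ := hA (l2Pair c 1)
      obtain ⟨rfl, rfl⟩ := h.pair_inj.1 hz
      rcases hc with ⟨d, hd, -⟩ | ⟨d, hd, hm⟩ | hno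
      · exact (h.zero_ne_one (h.pair_inj.1 hd).2.symm).elim
      · obtain ⟨rfl, -⟩ := h.pair_inj.1 hd
        exact ⟨l, hm, hl⟩
      · exact (hno ⟨c, Or.inr rfl⟩).elim
  · rintro ⟨hA, hB⟩ c
    by_cases hc : ∃ d, c = l2Pair d 0 ∨ c = l2Pair d 1
    · obtain ⟨d, rfl | rfl⟩ := hc
      · obtain ⟨l, hl, hlA⟩ := hA d
        exact ⟨l, ⟨_, _, rfl, Or.inl ⟨d, rfl, hl⟩⟩, hlA⟩
      · obtain ⟨l, hl, hlA⟩ := hB d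
        exact ⟨l, ⟨_, _, rfl, Or.inr (Or.inl ⟨d, rfl, hl⟩)⟩, hlA⟩
    · by_cases h0 : (0 : M) ∈ A
      · exact ⟨_, ⟨_, _, rfl, Or.inr (Or.inr hc)⟩, (litTrue_zero h).2 h0⟩
      · exact ⟨_, ⟨_, _, rfl, Or.inr (Or.inr hc)⟩, (litTrue_one h).2 h0⟩

theorem preimage (h : ModelsACA0 S) (k : M) (hP : Clausal S P) :
    Clausal S (fun A => P (packed A k)) := by
  obtain ⟨X, hX, hXP⟩ := hP
  have : Fact (X ∈ S) := ⟨hX⟩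
  have hmem : {z | ∃ y c, (z = l2Pair (l2Pair 0 (shift k y)) c ∧ l2Pair (l2Pair 0 y) c ∈ X) ∨
    (z = l2Pair (l2Pair 1 (shift k y)) c ∧ l2Pair (l2Pair 1 y) c ∈ X)} ∈ S := h.setOf_mem
  refine ⟨_, hmem, fun A => ?_⟩
  show _ ↔ P (packed A k)
  rw [← hXP]
  refine forall_congr' fun c => ⟨?_, ?_⟩
  · rintro ⟨l, ⟨y, d, ⟨hz, hX⟩ | ⟨hz, hX⟩⟩, hl⟩ <;> obtain ⟨rfl, rfl⟩ := h.pair_inj.1 hz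
    · exact ⟨_, hX, (litTrue_zero h (A := packed A k)).2 ((litTrue_zero h).1 hl :)⟩
    · exact ⟨_, hX, (litTrue_one h (A := packed A k)).2 ((litTrue_one h).1 hl :)⟩
  · rintro ⟨l, hX, ⟨y, rfl, hy⟩ | ⟨y, rfl, hy⟩⟩
    · exact ⟨_, ⟨y, c, Or.inl ⟨rfl, hX⟩⟩, (litTrue_zero h).2 hy⟩
    · exact ⟨_, ⟨y, c, Or.inr ⟨rfl, hX⟩⟩, (litTrue_one h).2 hy⟩

theorem mem (h : ModelsACA0 S) (a : M) : Clausal S (fun A => a ∈ A) :=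
  (basic h (fun _ => False) (fun _ x => x = a) (fun _ _ => False)).congr fun A => by simp

theorem slice_eq (h : ModelsACA0 S) (a : M) {B : Set M} (hB : B ∈ S) :
    Clausal S (fun A => slice A a = B) := by
  have : Fact (B ∈ S) := ⟨hB⟩
  refine (basic h (fun _ => False) (fun c x => c ∈ B ∧ x = l2Pair c a)
    (fun c x => c ∉ B ∧ x = l2Pair c a)).congr fun A => ?_
  rw [Set.ext_iff]
  refine forall_congr' fun c => ?_
  by_cases hc : c ∈ B <;> simp [hc, slice]

/-- Two sections of a set coincide. -/
theorem slice_eq_slice (h : ModelsACA0 S) (a b : M) :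
    Clausal S (fun A => slice A a = slice A b) := by
  refine (and h (basic h (fun _ => False) (fun c x => x = l2Pair c a) (fun c x => x = l2Pair c b))
    (basic h (fun _ => False) (fun c x => x = l2Pair c b) (fun c x => x = l2Pair c a))).congr
    fun A => ?_
  rw [Set.ext_iff, ← forall_and]
  refine forall_congr' fun c => ?_
  simp only [false_or, exists_or, exists_eq_left, slice, Set.mem_ofPred_eq]
  tauto

theorem nand (h : ModelsACA0 S) (a b j k : M) :
    Clausal S (fun A => slice A a =
      setOp 0 0 {x | l2Pair (l2Pair x b) j ∈ A} {x | l2Pair (l2Pair x b) k ∈ A}) := by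
  refine (and h (basic h (fun _ => False) (fun _ _ => False) (fun c x => x = l2Pair c a ∨
      x = l2Pair (l2Pair c b) j ∨ x = l2Pair (l2Pair c b) k))
    (and h (basic h (fun _ => False) (fun c x => x = l2Pair c a ∨ x = l2Pair (l2Pair c b) j)
        (fun _ _ => False))
      (basic h (fun _ => False) (fun c x => x = l2Pair c a ∨ x = l2Pair (l2Pair c b) k)
        (fun _ _ => False)))).congr fun A => ?_
  rw [Set.ext_iff, ← forall_and, ← forall_and]
  refine forall_congr' fun c => ?_
  simp only [false_or, false_and, or_false, or_and_right, exists_or, exists_eq_left, slice, setOp,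
    Set.mem_ofPred_eq]
  tauto

theorem image (h : ModelsACA0 S) (a b k : M) {Q : Set M} (hQ : Q ∈ S) :
    Clausal S (fun A => slice A a = setOp 1 0 Q {x | l2Pair (l2Pair x b) k ∈ A}) := by
  have : Fact (Q ∈ S) := ⟨hQ⟩
  refine (and h (basic h (fun _ => False)
      (fun c x => ∃ d, l2Pair c d ∈ Q ∧ x = l2Pair (l2Pair d b) k) (fun c x => x = l2Pair c a))
    (basic h (fun z => ¬ ∃ c d, z = l2Pair c d ∧ z ∈ Q)
      (fun z x => ∃ c d, z = l2Pair c d ∧ x = l2Pair c a)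
      (fun z x => ∃ c d, z = l2Pair c d ∧ x = l2Pair (l2Pair d b) k))).congr fun A => ?_
  constructor
  · rintro ⟨h1, h2⟩
    ext c
    constructor
    · intro hc
      obtain h' | ⟨x, ⟨⟨d, hd, rfl⟩, hx⟩ | ⟨rfl, hx⟩⟩ := h1 c
      exacts [h'.elim, ⟨d, hd, hx⟩, (hx hc).elim]
    · rintro ⟨d, hd, hdA⟩
      obtain h' | ⟨x, ⟨⟨c', d', hz, rfl⟩, hx⟩ | ⟨⟨c', d', hz, rfl⟩, hx⟩⟩ := h2 (l2Pair c d)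
      · exact (h' ⟨c, d, rfl, hd⟩).elim
      · obtain ⟨rfl, rfl⟩ := h.pair_inj.1 hz
        exact hx
      · obtain ⟨rfl, rfl⟩ := h.pair_inj.1 hz
        exact (hx hdA).elim
  · intro hA
    have hA' : ∀ c, l2Pair c a ∈ A ↔ ∃ d, l2Pair c d ∈ Q ∧ l2Pair (l2Pair d b) k ∈ A :=
      fun c => Set.ext_iff.1 hA c
    refine ⟨fun c => Or.inr ?_, fun z => ?_⟩
    · by_cases hc : l2Pair c a ∈ A
      · obtain ⟨d, hd, hdA⟩ := (hA' c).1 hc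
        exact ⟨_, Or.inl ⟨⟨d, hd, rfl⟩, hdA⟩⟩
      · exact ⟨_, Or.inr ⟨rfl, hc⟩⟩
    · by_cases hz : ∃ c d, z = l2Pair c d ∧ z ∈ Q
      · obtain ⟨c, d, rfl, hd⟩ := hz
        by_cases hdA : l2Pair (l2Pair d b) k ∈ A
        · exact Or.inr ⟨_, Or.inl ⟨⟨c, d, rfl, rfl⟩, (hA' c).2 ⟨d, hd, hdA⟩⟩⟩
        · exact Or.inr ⟨_, Or.inr ⟨⟨c, d, rfl, rfl⟩, hdA⟩⟩
      · exact Or.inl hz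

end Clausal

/-- `F` is a function of two sets whose values can be described by clause systems in `Z`: some
clausal predicate of a set `G` forces the section `2` of `G` to be the value of `F` at the sections
`0` and `1`, and can be satisfied with arbitrary sections `0` and `1` in every model of `ACA₀`
extending `Z`. -/
def ClausalFun (Z : Set (Set M)) (F : Set M × Set M → Set M) : Prop :=
  ∃ P, Clausal Z P ∧ (∀ G, P G → slice G (num 2) = F (slice G 0, slice G 1)) ∧
    ∀ S', Z ⊆ S' → ModelsACA0 S' → ∀ B ∈ S', ∀ A ∈ S',
      F (B, A) ∈ S' ∧ ∃ G ∈ S', slice G 0 = B ∧ slice G 1 = A ∧ P G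

/-- The set with sections `B`, `A`, `D` at `0`, `1`, `2` and with `G`, `H` stored at `3`, `4`. -/
def bundle (B A D G H : Set M) : Set M :=
  {z | (∃ x, z = l2Pair x 0 ∧ x ∈ B) ∨ (∃ x, z = l2Pair x 1 ∧ x ∈ A) ∨
    (∃ x, z = l2Pair x (num 2) ∧ x ∈ D) ∨ (∃ x, z = l2Pair x (num 3) ∧ x ∈ G) ∨
      (∃ x, z = l2Pair x (num 4) ∧ x ∈ H)}

theorem ModelsACA0.bundle_mem (h : ModelsACA0 S) {B A D G H : Set M} (hB : B ∈ S) (hA : A ∈ S)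
    (hD : D ∈ S) (hG : G ∈ S) (hH : H ∈ S) : bundle B A D G H ∈ S := by
  have : Fact (B ∈ S) := ⟨hB⟩
  have : Fact (A ∈ S) := ⟨hA⟩
  have : Fact (D ∈ S) := ⟨hD⟩
  have : Fact (G ∈ S) := ⟨hG⟩
  have : Fact (H ∈ S) := ⟨hH⟩
  exact h.setOf_mem

theorem num_one (h : ModelsACA0 S) : (num 1 : M) = 1 := h.zero_add 1

theorem slice_bundle (h : ModelsACA0 S) (B A D G H : Set M) :
    slice (bundle B A D G H) 0 = B ∧ slice (bundle B A D G H) 1 = A ∧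
      slice (bundle B A D G H) (num 2) = D ∧ slice (bundle B A D G H) (num 3) = G ∧
        slice (bundle B A D G H) (num 4) = H := by
  have h0 : (0 : M) = num 0 := rfl
  simp only [Set.ext_iff, slice, bundle, Set.mem_ofPred_eq, h.pair_inj, ← num_one h, h0, h.num_inj]
  simp

/-- A set whose sections `0` and `1` agree with those of `bundle` is recovered from storage. -/
theorem packed_bundle (h : ModelsACA0 S) {B A D G H : Set M} :
    (slice G 0 = B → slice G 1 = A → packed (bundle B A D G H) (num 3) = G) ∧
      (slice H 0 = B → slice H 1 = A → packed (bundle B A D G H) (num 4) = H) := by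
  obtain ⟨h0, h1, -, h3, h4⟩ := slice_bundle h B A D G H
  constructor <;> rintro rfl rfl <;> ext y <;> unfold packed shift
  all_goals
    simp only [Set.mem_ofPred_eq]
    split_ifs with hy
  · obtain ⟨x, rfl | rfl⟩ := hy
    exacts [Set.ext_iff.1 h0 x, Set.ext_iff.1 h1 x]
  · exact Set.ext_iff.1 h3 y
  · obtain ⟨x, rfl | rfl⟩ := hy
    exacts [Set.ext_iff.1 h0 x, Set.ext_iff.1 h1 x]
  · exact Set.ext_iff.1 h4 y

theorem slice_packed (h : ModelsACA0 S) (G : Set M) (k : M) :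
    slice (packed G k) 0 = slice G 0 ∧ slice (packed G k) 1 = slice G 1 ∧
      slice (packed G k) (num 2) = {x | l2Pair (l2Pair x (num 2)) k ∈ G} := by
  have hno : ∀ x : M, ¬ ∃ y, l2Pair x (num 2) = l2Pair y 0 ∨ l2Pair x (num 2) = l2Pair y 1 := by
    rintro x ⟨y, hy | hy⟩
    · exact absurd ((h.num_inj (j := 2) (k := 0)).1 (h.pair_inj.1 hy).2) (by norm_num)
    · rw [← num_one h] at hy
      exact absurd (h.num_inj.1 (h.pair_inj.1 hy).2) (by norm_num)
  refine ⟨?_, ?_, ?_⟩ <;> ext x <;> simp only [slice, packed, shift, Set.mem_ofPred_eq]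
  · rw [if_pos ⟨x, Or.inl rfl⟩]
  · rw [if_pos ⟨x, Or.inr rfl⟩]
  · rw [if_neg (hno x)]

namespace ClausalFun

theorem base (h : ModelsACA0 S) (F : Set M × Set M → Set M)
    (hF : Clausal S fun G => slice G (num 2) = F (slice G 0, slice G 1))
    (hS : ∀ S', S ⊆ S' → ModelsACA0 S' → ∀ B ∈ S', ∀ A ∈ S', F (B, A) ∈ S') :
    ClausalFun S F := by
  refine ⟨_, hF, fun G hG => hG, fun S' hSS' h' B hB A hA => ⟨hS S' hSS' h' B hB A hA, ?_⟩⟩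
  refine ⟨_, h'.bundle_mem hB hA (hS S' hSS' h' B hB A hA) h'.empty_mem h'.empty_mem, ?_⟩
  obtain ⟨h0, h1, h2, -⟩ := slice_bundle h B A (F (B, A)) ∅ ∅
  exact ⟨h0, h1, by rw [h0, h1, h2]⟩

/-- Composition with an operation on sets: the auxiliary sets of the two arguments are stored in the
sections `3` and `4`. -/
theorem comp (h : ModelsACA0 S) (op : Set M → Set M → Set M) {D E : Set M × Set M → Set M}
    (hD : ClausalFun S D) (hE : ClausalFun S E)
    (hop : Clausal S fun G => slice G (num 2) = op {x | l2Pair (l2Pair x (num 2)) (num 3) ∈ G}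
      {x | l2Pair (l2Pair x (num 2)) (num 4) ∈ G})
    (hS : ∀ S', S ⊆ S' → ModelsACA0 S' → ∀ B ∈ S', ∀ A ∈ S', op B A ∈ S') :
    ClausalFun S (fun J => op (D J) (E J)) := by
  obtain ⟨P, hP, hPD, hPS⟩ := hD
  obtain ⟨Q, hQ, hQE, hQS⟩ := hE
  refine ⟨_, (hP.preimage h (num 3)).and h ((hQ.preimage h (num 4)).and h hop), ?_,
    fun S' hSS' h' B hB A hA => ?_⟩
  · rintro G ⟨h1, h2, h3⟩
    have h1 := hPD _ h1
    have h2 := hQE _ h2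
    obtain ⟨h30, h31, h32⟩ := slice_packed h G (num 3)
    obtain ⟨h40, h41, h42⟩ := slice_packed h G (num 4)
    rw [h30, h31, h32] at h1
    rw [h40, h41, h42] at h2
    rw [h3, h1, h2]
  · obtain ⟨hDS, G, hG, hG0, hG1, hPG⟩ := hPS S' hSS' h' B hB A hA
    obtain ⟨hES, H, hH, hH0, hH1, hQH⟩ := hQS S' hSS' h' B hB A hA
    have hR := hS S' hSS' h' _ hDS _ hES
    refine ⟨hR, _, h'.bundle_mem hB hA hR hG hH, ?_⟩
    obtain ⟨h0, h1, h2, h3, h4⟩ := slice_bundle h B A (op (D (B, A)) (E (B, A))) G H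
    have h5 := (packed_bundle h (D := op (D (B, A)) (E (B, A))) (H := H)).1 hG0 hG1
    have h6 := (packed_bundle h (D := op (D (B, A)) (E (B, A))) (G := G)).2 hH0 hH1
    refine ⟨h0, h1, by rwa [h5], by rwa [h6], ?_⟩
    rw [← (slice_packed h _ (num 3)).2.2, ← (slice_packed h _ (num 4)).2.2, h5, h6, h2, hPD G hPG,
      hQE H hQH, hG0, hG1, hH0, hH1]

theorem opFamily (h : ModelsACA0 S) : OpFamily S {F : Set M × Set M → Set M | ClausalFun S F} where
  const Q hQ := base h (fun _ => Q) (Clausal.slice_eq h _ hQ) fun _ hS _ _ _ _ _ => hS hQ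
  nand _ hD _ hE := comp h (setOp 0 0) hD hE (Clausal.nand h _ _ _ _)
    fun _ _ h' _ hB _ hA => h'.opClosed.op_mem _ _ _ _ hB hA
  image Q hQ _ hD := comp h (fun B _ => setOp 1 0 Q B) hD hD (Clausal.image h _ _ _ hQ)
    fun _ hS h' _ hB _ _ => h'.opClosed.op_mem _ _ _ _ (hS hQ) hB

end ClausalFun

/-- The normal form theorem for `Σ¹₁` formulas with a further set parameter `B`: satisfiability of a
clause system that does not depend on the ambient model. -/
theorem ModelsACA0.exists_clauses (h : ModelsACA0 S) {θ : L2Formula} (hθ : θ.IsArithmetical)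
    (i j : ℕ) (v : ℕ → M) (V : ℕ → Set M) (hV : ∀ k, V k ∈ S) :
    ∃ X ∈ S, ∀ S', S ⊆ S' → ModelsACA0 S' → ∀ B ∈ S',
      ((∃ A ∈ S', θ.Sat S' v (Function.update (Function.update V i B) j A)) ↔
        ∃ G ∈ S', slice G 0 = B ∧ SatClauses X G) := by
  obtain ⟨D, ⟨P, hP, hPD, hPS⟩, hs⟩ := (ClausalFun.opFamily h).exists_truth h h.opClosed
    (fun J => Function.update (Function.update V i J.1) j J.2) (fun k => by
      by_cases hj : k = j
      · subst hj
        simp only [Function.update_self]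
        exact ClausalFun.base h _ (Clausal.slice_eq_slice h _ _) fun _ _ _ _ _ _ hA => hA
      by_cases hi : k = i
      · subst hi
        simp only [Function.update_of_ne hj, Function.update_self]
        exact ClausalFun.base h _ (Clausal.slice_eq_slice h _ _) fun _ _ _ _ hB _ _ => hB
      · simp only [Function.update_of_ne hj, Function.update_of_ne hi]
        exact (ClausalFun.opFamily h).const _ (hV k)) _ θ hθ le_rfl
  obtain ⟨e, he⟩ := exists_isEnv θ.bound v
  obtain ⟨X, hX, hXP⟩ := hP.and h (Clausal.mem h (l2Pair e (num 2)))
  refine ⟨X, hX, fun S' hSS' h' B hB => ?_⟩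
  constructor
  · rintro ⟨A, hA, hsat⟩
    obtain ⟨-, G, hG, hG0, hG1, hPG⟩ := hPS S' hSS' h' B hB A hA
    refine ⟨G, hG, hG0, (hXP G).2 ⟨hPG, ?_⟩⟩
    show e ∈ slice G (num 2)
    rw [hPD G hPG, hG0, hG1, hs _ e v he]
    exact (L2Formula.sat_iff_of_isArithmetical hθ _ _).1 hsat
  · rintro ⟨G, hG, rfl, hX⟩
    obtain ⟨hPG, he'⟩ := (hXP G).1 hX
    have : Fact (G ∈ S') := ⟨hG⟩
    refine ⟨slice G 1, h'.defSet_mem, ?_⟩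
    rw [L2Formula.sat_iff_of_isArithmetical (S' := ∅) hθ]
    refine (hs (slice G 0, slice G 1) e v he).1 ?_
    rw [← hPD G hPG]
    exact he'

end Clauses

/-! ### Coded `β`-models -/

section CodedModels

variable {M : Type u} [L1Structure M] {S : Set (Set M)}

/-- The operation with index `q = (k + 1, p)` is `setOp k p`. -/
def indexedOp (q : M) (X B : Set M) : Set M :=
  {c | ∃ k, k < 12 + 1 ∧ ∃ p, q = l2Pair (num (k + 1)) p ∧ c ∈ setOp k p X B}

instance {α : Type u} [Ctx M α] {q : α → M} {X B : α → Set M} [DefFun S q] [DefSet S X]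
    [DefSet S B] : DefSet S (fun x => indexedOp (q x) (X x) (B x)) := by
  unfold indexedOp
  have : ∀ k, Ar S (fun x : α × M => ∃ p, q x.1 = l2Pair (num (k + 1)) p ∧
      x.2 ∈ setOp k p (X x.1) (B x.1)) := fun k => inferInstance
  exact ⟨Ar.exFin 12⟩

theorem indexedOp_pair (h : ModelsACA0 S) {k : ℕ} (hk : k < 13) (p : M) (X B : Set M) :
    indexedOp (l2Pair (num (k + 1)) p) X B = setOp k p X B := by
  ext c
  constructor
  · rintro ⟨k', -, p', hq, hc⟩
    obtain ⟨hk', rfl⟩ := h.pair_inj.1 hq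
    obtain rfl : k = k' := by have := h.num_inj.1 hk'; omega
    exact hc
  · intro hc; exact ⟨k, hk, p, rfl, hc⟩

/-- The problem with index `q` for the sets `X` and `B`: for `q = 0` it is the clause system `X`,
and otherwise the clause system that is satisfied by `indexedOp q X B` only. -/
def problem (q : M) (X B : Set M) : Set M :=
  {z | (q = 0 ∧ z ∈ X) ∨ (q ≠ 0 ∧ ∃ c, (z = l2Pair (l2Pair 0 c) c ∧ c ∈ indexedOp q X B) ∨
    (z = l2Pair (l2Pair 1 c) c ∧ c ∉ indexedOp q X B))}

instance {α : Type u} [Ctx M α] {q : α → M} {X B : α → Set M} [DefFun S q] [DefSet S X]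
    [DefSet S B] : DefSet S (fun x => problem (q x) (X x) (B x)) := by
  unfold problem; infer_instance

theorem problem_zero (X B : Set M) : problem 0 X B = X := by
  ext z; simp [problem]

theorem satClauses_problem (h : ModelsACA0 S) {q : M} (hq : q ≠ 0) {X B A : Set M} :
    SatClauses (problem q X B) A ↔ A = indexedOp q X B := by
  constructor
  · intro hA
    ext c
    obtain ⟨l, ⟨h0, -⟩ | ⟨-, d, ⟨hd, hm⟩ | ⟨hd, hm⟩⟩, hl⟩ := hA c
    · exact (hq h0).elim
    · obtain ⟨rfl, rfl⟩ := h.pair_inj.1 hd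
      exact iff_of_true ((litTrue_zero h).1 hl) hm
    · obtain ⟨rfl, rfl⟩ := h.pair_inj.1 hd
      exact iff_of_false ((litTrue_one h).1 hl) hm
  · rintro rfl c
    by_cases hc : c ∈ indexedOp q X B
    · exact ⟨_, Or.inr ⟨hq, c, Or.inl ⟨rfl, hc⟩⟩, (litTrue_zero h).2 hc⟩
    · exact ⟨_, Or.inr ⟨hq, c, Or.inr ⟨rfl, hc⟩⟩, (litTrue_one h).2 hc⟩

/-- The model coded by `C` contains a solution of each solvable problem for two of its sets. -/
def SolvesProblems (S : Set (Set M)) (C : Set M) : Prop :=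
  ∀ q x b, ∃ y, (∃ A ∈ S, SatClauses (problem q (slice C x) (slice C b)) A) →
    SatClauses (problem q (slice C x) (slice C b)) (slice C y)

instance {α : Type u} [Ctx M α] [SigmaCA S] [SigRule S (α × M)] {C : α → Set M} [DefSet S C] :
    Ar S (fun x => SolvesProblems S (C x)) := by
  unfold SolvesProblems; infer_instance

theorem codedSets_subset (h : ModelsACA0 S) {C : Set M} (hC : C ∈ S) : codedSets C ⊆ S := by
  rintro _ ⟨i, rfl⟩
  have : Fact (C ∈ S) := ⟨hC⟩
  exact h.defSet_mem

namespace SolvesProblems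

variable {C D : Set M}

theorem opClosed (hC : SolvesProblems S C) (h : ModelsACA0 S) (hCS : C ∈ S) :
    OpClosed (codedSets C) where
  nonempty := ⟨_, 0, rfl⟩
  op_mem k p X B hX hB := by
    by_cases hk : k < 13
    · obtain ⟨x, rfl⟩ := hX
      obtain ⟨b, rfl⟩ := hB
      have hq : l2Pair (num (k + 1)) p ≠ (0 : M) := fun h0 =>
        h.succ_ne_zero _ ((h.add_succ _ _).symm.trans h0)
      obtain ⟨y, hy⟩ := hC (l2Pair (num (k + 1)) p) x b
      rw [← indexedOp_pair h hk]
      have : Fact (C ∈ S) := ⟨hCS⟩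
      exact ⟨y, (satClauses_problem h hq).1
        (hy ⟨_, h.defSet_mem, (satClauses_problem h hq).2 rfl⟩)⟩
    · obtain ⟨k, rfl⟩ : ∃ j, k = j + 13 := ⟨k - 13, by omega⟩
      exact hX

theorem modelsACA0 (hC : SolvesProblems S C) (h : ModelsACA0 S) (hCS : C ∈ S) :
    ModelsACA0 (codedSets C) :=
  (hC.opClosed h hCS).modelsACA0 h (codedSets_subset h hCS)

theorem exists_satClauses (hC : SolvesProblems S C) {X : Set M} (hX : X ∈ codedSets C)
    (hA : ∃ A ∈ S, SatClauses X A) : ∃ A ∈ codedSets C, SatClauses X A := by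
  obtain ⟨x, rfl⟩ := hX
  obtain ⟨y, hy⟩ := hC 0 x x
  rw [problem_zero] at hy
  exact ⟨_, ⟨y, rfl⟩, hy hA⟩

theorem exists_satClauses_slice (hC : SolvesProblems S C) (h : ModelsACA0 S) (hCS : C ∈ S)
    {X B : Set M} (hX : X ∈ codedSets C) (hB : B ∈ codedSets C)
    (hG : ∃ G ∈ S, slice G 0 = B ∧ SatClauses X G) :
    ∃ G ∈ codedSets C, slice G 0 = B ∧ SatClauses X G := by
  have h' := hC.modelsACA0 h hCS
  obtain ⟨Y, hY, hYX⟩ := (Clausal.slice_eq h' 0 hB).and h' ⟨X, hX, fun _ => Iff.rfl⟩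
  obtain ⟨G, hG, hGB⟩ := hG
  obtain ⟨A, hA, hAY⟩ := hC.exists_satClauses hY ⟨G, hG, (hYX G).2 hGB⟩
  exact ⟨A, hA, (hYX A).1 hAY⟩

/-- A coded model that solves its problems is a `β`-model. -/
theorem isBetaSubmodel_one (hC : SolvesProblems S C) (h : ModelsACA0 S) (hCS : C ∈ S) :
    IsBetaSubmodel 1 (codedSets C) S := by
  refine ⟨codedSets_subset h hCS, fun φ hφ v V hV => ?_⟩
  have h' := hC.modelsACA0 h hCS
  cases hφ with | ex k j θ hθ =>
  cases hθ with | arith b θ hθ =>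
  obtain ⟨X, hX, hXS⟩ := h'.exists_clauses hθ j j v V hV
  have h1 := hXS _ subset_rfl h' _ (hV 0)
  have h2 := hXS _ (codedSets_subset h hCS) h _ (codedSets_subset h hCS (hV 0))
  simp only [Function.update_idem] at h1 h2
  refine h1.trans (Iff.trans ⟨?_, ?_⟩ h2.symm)
  · rintro ⟨G, hG, hGX⟩
    exact ⟨G, codedSets_subset h hCS hG, hGX⟩
  · exact hC.exists_satClauses_slice h hCS hX (hV 0)

/-- A criterion for `β₂`-submodels in terms of a single form of `Σ¹₂` sentences. -/
theorem isBetaSubmodel_two (hC : SolvesProblems S C) (hD : SolvesProblems S D) (h : ModelsACA0 S)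
    (hCS : C ∈ S) (hDS : D ∈ S) (hCD : codedSets C ⊆ codedSets D)
    (href : ∀ X ∈ codedSets C,
      (∃ B ∈ codedSets D, ∀ A ∈ codedSets D, slice A 0 = B → ¬ SatClauses X A) →
        ∃ B ∈ codedSets C, ∀ A ∈ S, slice A 0 = B → ¬ SatClauses X A) :
    IsBetaSubmodel 2 (codedSets C) (codedSets D) := by
  refine ⟨hCD, fun φ hφ v V hV => ?_⟩
  have hC' := hC.modelsACA0 h hCS
  have hD' := hD.modelsACA0 h hDS
  cases hφ with | ex k i θ hθ =>
  cases hθ with | all k j θ hθ =>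
  cases hθ with | arith b θ hθ =>
  obtain ⟨X, hX, hXS⟩ := hC'.exists_clauses (θ := .neg θ) hθ i j v V hV
  -- The given formula says that some `B` is not the section `0` of a solution of `X`.
  have key : ∀ Z, codedSets C ⊆ Z → ModelsACA0 Z →
      ((L2Formula.exSet i (.allSet j θ)).Sat Z v V ↔
        ∃ B ∈ Z, ∀ A ∈ Z, slice A 0 = B → ¬ SatClauses X A) := by
    intro Z hZ hZ'
    refine exists_congr fun B => and_congr_right fun hB => ?_
    have := not_congr (hXS Z hZ hZ' B hB)
    simp only [L2Formula.Sat, not_exists, not_and, not_not] at this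
    exact this
  rw [key _ subset_rfl hC', key _ hCD hD']
  constructor
  · rintro ⟨B, hB, hBA⟩
    refine ⟨B, hCD hB, fun A hA hAB hAX => ?_⟩
    obtain ⟨G, hG, hGB, hGX⟩ := hC.exists_satClauses_slice h hCS hX hB
      ⟨A, codedSets_subset h hDS hA, hAB, hAX⟩
    exact hBA G hG hGB hGX
  · intro hB
    obtain ⟨B, hB, hBA⟩ := href X hX hB
    exact ⟨B, hB, fun A hA => hBA A (codedSets_subset h hCS hA)⟩

end SolvesProblems

end CodedModels

-- The definability of the predicates that follow leads to large instance problems.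

set_option synthInstance.maxSize 2000
set_option synthInstance.maxHeartbeats 200000

/-! ### The operators -/

section Operators

variable {M : Type u} [L1Structure M] {S : Set (Set M)}

/-- The cell `d` of level `k` is decided in the state `T`. -/
def Decided (T : Set M) (k d : M) : Prop := l2Pair k (l2Pair 0 d) ∈ T

/-- The content of the cell `d` of level `k` in the state `T`. -/
def content (T : Set M) (k d : M) : Set M := {l | l2Pair k (l2Pair (l + 1) d) ∈ T}

/-- The entries of the state `T` that belong to levels above `k`. -/
def above (T : Set M) (k : M) : Set M := {z | z ∈ T ∧ ∃ j y, z = l2Pair j y ∧ k < j}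

/-- The entries of the state `T` that belong to the levels from `k` on. -/
def fromLevel (T : Set M) (k : M) : Set M := {z | z ∈ T ∧ ∃ j y, z = l2Pair j y ∧ ¬ j < k}

/-- The literal chosen for the clause `c` of the problem `m`: the least one in the cell
`(m, c)`. -/
def Chosen (T : Set M) (m c l : M) : Prop :=
  l ∈ content T 0 (l2Pair m c) ∧ ∀ l', l' < l → l' ∉ content T 0 (l2Pair m c)

/-- The sets `Z₀, Z₁, …` of the `β`-model constructed at level `0`. The set `Z₀` combines the
parameter `W` with all entries of higher levels; for `m > 0` the set `Zₘ` is determined by the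
literals chosen for the clauses of the problem `m`. -/
def betaSet (W T : Set M) (m : M) : Set M :=
  {y | (m = 0 ∧ ((∃ a, y = l2Pair a 0 ∧ a ∈ W) ∨ ∃ a, y = l2Pair a 1 ∧ a ∈ above T 0)) ∨
    (m ≠ 0 ∧ ∃ c, Chosen T m c (l2Pair 0 y))}

/-- The set `A` witnesses that the literal `l` may be chosen for the clause `c` of the problem
`m = (q, (x, b)) + 1`, the problem with index `q` for `Zₓ` and `Z_b`: the literal belongs to the
clause, and `A` is a solution of the problem that makes `l` and all earlier choices true. -/
def Candidate (W T : Set M) (m c l : M) (A : Set M) : Prop :=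
  ∃ q x b, m = l2Pair q (l2Pair x b) + 1 ∧
    l2Pair l c ∈ problem q (betaSet W T x) (betaSet W T b) ∧
    SatClauses (problem q (betaSet W T x) (betaSet W T b)) A ∧ LitTrue l A ∧
    ∀ c' l', c' < c → Chosen T m c' l' → LitTrue l' A

/-- The code of the model at level `k`. For `k > 0` the set with index `(w, j) + 1` is the `j`-th
set of the model whose code is the content of the cell `w`. -/
def levelModel (W T : Set M) (k : M) : Set M :=
  {z | (k = 0 ∧ ∃ y m, z = l2Pair y m ∧ y ∈ betaSet W T m) ∨
    (k ≠ 0 ∧ ∃ a w j, z = l2Pair a (l2Pair w j + 1) ∧ l2Pair a j ∈ content T k w)}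

/-- The cell `d` of level `k` is to be decided next in the state `T`. At level `0` this is the least
undecided cell in the lexicographic ordering. At a level `k + 1` these are the undecided cells
`d = 0` and `d = (w, j) + 1` with `w` decided for which the model at level `k` satisfies the
`Σ¹₂` sentence: some set is not the section `0` of a solution of the `d`-th set of level
`k + 1`. -/
def Due (W T : Set M) (k d : M) : Prop :=
  ¬ Decided T k d ∧
    ((k = 0 ∧ ∃ m c, d = l2Pair m c ∧ (∀ m' c', m' < m → Decided T 0 (l2Pair m' c')) ∧
      ∀ c', c' < c → Decided T 0 (l2Pair m c')) ∨
    ∃ k', k = k' + 1 ∧ (d = 0 ∨ ∃ w j, d = l2Pair w j + 1 ∧ Decided T k w ∧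
      ∃ b, ∀ a, slice (slice (levelModel W T k') a) 0 = slice (levelModel W T k') b →
        ¬ SatClauses (slice (levelModel W T k) d) (slice (levelModel W T k') a)))

/-- The matrix of the operators: `∃ A, StepEntry W k z T A` says that the operator `k` puts `z` into
the state `T`. The content of a new cell consists of the candidates at level `0`, and is the code of
the model at the preceding level otherwise. -/
def StepEntry (W : Set M) (k z : M) (T A : Set M) : Prop :=
  ∃ d, Due W T k d ∧ (z = l2Pair k (l2Pair 0 d) ∨ ∃ l, z = l2Pair k (l2Pair (l + 1) d) ∧
    ((k = 0 ∧ ∃ m c, d = l2Pair m c ∧ Candidate W T m c l A) ∨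
      ∃ k', k = k' + 1 ∧ l ∈ levelModel W T k'))

/-- The operator with index `k`. -/
def stepOperator (S : Set (Set M)) (W : Set M) (k : M) (T : Set M) : Set M :=
  {z | ∃ A ∈ S, StepEntry W k z T A}

section Instances

variable {α : Type u} [Ctx M α] {W T A : α → Set M} {k d m c l : α → M} [DefSet S W] [DefSet S T]
  [DefSet S A] [DefFun S k] [DefFun S d] [DefFun S m] [DefFun S c] [DefFun S l]

instance : Ar S (fun x => Decided (T x) (k x) (d x)) := by unfold Decided; infer_instance

instance : DefSet S (fun x => content (T x) (k x) (d x)) := by unfold content; infer_instance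

instance : DefSet S (fun x => above (T x) (k x)) := by unfold above; infer_instance

instance : DefSet S (fun x => fromLevel (T x) (k x)) := by unfold fromLevel; infer_instance

instance : Ar S (fun x => Chosen (T x) (m x) (c x) (l x)) := by unfold Chosen; infer_instance

instance : DefSet S (fun x => betaSet (W x) (T x) (m x)) := by unfold betaSet; infer_instance

instance : Ar S (fun x => Candidate (W x) (T x) (m x) (c x) (l x) (A x)) := by
  unfold Candidate; infer_instance

instance : DefSet S (fun x => levelModel (W x) (T x) (k x)) := by
  unfold levelModel; infer_instance

instance : Ar S (fun x => Due (W x) (T x) (k x) (d x)) := by unfold Due; infer_instance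

instance : Ar S (fun x => StepEntry (W x) (k x) (l x) (T x) (A x)) := by
  unfold StepEntry; infer_instance

end Instances

end Operators

/-! ### Invariants of the states -/

section Invariants

variable {M : Type u} [L1Structure M] {S : Set (Set M)} {W T T' : Set M} {k : M}

/-- The decided cells of level `0` form an initial segment of the lexicographic ordering, and each
of them contains precisely the candidates. -/
def InvZero (S : Set (Set M)) (W T : Set M) : Prop :=
  (∀ m c m' c', Decided T 0 (l2Pair m c) → m' < m ∨ (m' = m ∧ c' < c) →
    Decided T 0 (l2Pair m' c')) ∧
  ∀ d l, l ∈ content T 0 d ↔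
    Decided T 0 d ∧ ∃ m c, d = l2Pair m c ∧ ∃ A ∈ S, Candidate W T m c l A

/-- The model at level `k` is a `β`-model that contains the parameter and all entries of higher
levels. -/
def Ready (S : Set (Set M)) (W T : Set M) (k : M) : Prop :=
  SolvesProblems S (levelModel W T k) ∧ (∃ i, W = slice (levelModel W T k) i) ∧
    ∃ i, above T k = slice (levelModel W T k) i

/-- The invariant of the levels `k > 0`: as soon as some cell is decided, the model is a `β`-model,
and it satisfies the sentence recorded by each decided cell. -/
def InvSucc (S : Set (Set M)) (W T : Set M) (k : M) : Prop :=
  (∀ w l, l ∈ content T k w → Decided T k w) ∧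
  ∀ w, Decided T k w → Ready S W T k ∧ (w = 0 ∨ ∃ w' j, w = l2Pair w' j + 1 ∧ Decided T k w' ∧
    ∃ b, ∀ A ∈ S, slice A 0 = slice (levelModel W T k) b →
      ¬ SatClauses (slice (levelModel W T k) w) A)

/-- The invariant of level `k`. -/
def LevelInv (S : Set (Set M)) (W T : Set M) (k : M) : Prop :=
  (k = 0 → InvZero S W T) ∧ (k ≠ 0 → InvSucc S W T k)

/-- The states `T` and `T'` agree on the levels above `k` and on the cells of level `k` that are
decided in `T`. -/
def Extends (k : M) (T T' : Set M) : Prop :=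
  ∀ z, ((∃ j y, z = l2Pair j y ∧ k < j) ∨ ∃ l d, z = l2Pair k (l2Pair l d) ∧ Decided T k d) →
    (z ∈ T ↔ z ∈ T')

section Instances

variable {α : Type u} [Ctx M α] {W T T' : α → Set M} {k : α → M} [DefSet S W] [DefSet S T]
  [DefSet S T'] [DefFun S k]

instance : Ar S (fun x => Extends (k x) (T x) (T' x)) := by unfold Extends; infer_instance

variable [SigmaCA S] [SigRule S (α × M)]

instance : Ar S (fun x => InvZero S (W x) (T x)) := by unfold InvZero; infer_instance

instance : Ar S (fun x => Ready S (W x) (T x) (k x)) := by unfold Ready; infer_instance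

instance : Ar S (fun x => InvSucc S (W x) (T x) (k x)) := by unfold InvSucc; infer_instance

instance [SigRule S α] : Ar S (fun x => LevelInv S (W x) (T x) (k x)) := by
  unfold LevelInv; infer_instance

end Instances

theorem Extends.decided (h : Extends k T T') {d : M} (hd : Decided T k d) : Decided T' k d :=
  (h _ (Or.inr ⟨0, d, rfl, hd⟩)).1 hd

theorem Extends.content_eq (h : Extends k T T') {d : M} (hd : Decided T k d) :
    content T k d = content T' k d :=
  Set.ext fun l => h _ (Or.inr ⟨l + 1, d, rfl, hd⟩)

theorem Extends.above_eq (h : Extends k T T') : above T k = above T' k :=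
  Set.ext fun z => and_congr_left fun hz => h z (Or.inl hz)

/-! #### The model at a level above the first one -/

theorem slice_levelModel_zero (h : ModelsACA0 S) (m : M) :
    slice (levelModel W T 0) m = betaSet W T m := by
  ext y
  constructor
  · rintro (⟨-, y', m', hz, hy⟩ | ⟨h0, -⟩)
    · obtain ⟨rfl, rfl⟩ := h.pair_inj.1 hz
      exact hy
    · exact (h0 rfl).elim
  · intro hy; exact Or.inl ⟨rfl, _, _, rfl, hy⟩

theorem slice_levelModel_index_zero (h : ModelsACA0 S) (hk : k ≠ 0) :
    slice (levelModel W T k) 0 = ∅ := by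
  rw [Set.eq_empty_iff_forall_notMem]
  rintro y (⟨h0, -⟩ | ⟨-, a, w, j, hz, -⟩)
  · exact hk h0
  · exact h.succ_ne_zero _ (h.pair_inj.1 hz).2.symm

theorem mem_slice_levelModel (h : ModelsACA0 S) (hk : k ≠ 0) {a w j : M} :
    a ∈ slice (levelModel W T k) (l2Pair w j + 1) ↔ l2Pair a j ∈ content T k w := by
  constructor
  · rintro (⟨h0, -⟩ | ⟨-, a', w', j', hz, hm⟩)
    · exact (hk h0).elim
    · obtain ⟨rfl, hi⟩ := h.pair_inj.1 hz
      obtain ⟨rfl, rfl⟩ := h.pair_inj.1 (h.succ_inj _ _ hi)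
      exact hm
  · intro hm; exact Or.inr ⟨hk, _, _, _, rfl, hm⟩

theorem slice_levelModel_cases (h : ModelsACA0 S) (hk : k ≠ 0)
    (hT : ∀ w l, l ∈ content T k w → Decided T k w) (i : M) :
    slice (levelModel W T k) i = ∅ ∨ ∃ w j, i = l2Pair w j + 1 ∧ Decided T k w := by
  rw [or_iff_not_imp_left, ← ne_eq, ← Set.nonempty_iff_ne_empty]
  rintro ⟨y, ⟨h0, -⟩ | ⟨-, a, w, j, hz, hm⟩⟩
  · exact (hk h0).elim
  · exact ⟨w, j, (h.pair_inj.1 hz).2, hT _ _ hm⟩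

theorem Extends.slice_levelModel_eq (hTT' : Extends k T T') (h : ModelsACA0 S) (hk : k ≠ 0) {w : M}
    (hw : Decided T k w) (j : M) :
    slice (levelModel W T k) (l2Pair w j + 1) = slice (levelModel W T' k) (l2Pair w j + 1) := by
  ext a
  rw [mem_slice_levelModel h hk, mem_slice_levelModel h hk, hTT'.content_eq hw]

theorem Extends.codedSets_subset (hTT' : Extends k T T') (h : ModelsACA0 S) (hk : k ≠ 0)
    (hT : ∀ w l, l ∈ content T k w → Decided T k w) :
    codedSets (levelModel W T k) ⊆ codedSets (levelModel W T' k) := by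
  rintro _ ⟨i, rfl⟩
  rcases slice_levelModel_cases (W := W) h hk hT i with h0 | ⟨w, j, rfl, hw⟩
  · exact ⟨0, by rw [h0, slice_levelModel_index_zero h hk]⟩
  · exact ⟨_, (hTT'.slice_levelModel_eq h hk hw j).symm⟩

theorem content_above {j : M} (hj : k < j) (w : M) : content (above T k) j w = content T j w :=
  Set.ext fun _ => ⟨fun hl => hl.1, fun hl => ⟨hl, _, _, rfl, hj⟩⟩

theorem levelModel_above {j : M} (hj : k < j) (hj0 : j ≠ 0) :
    levelModel W (above T k) j = levelModel W T j := by
  simp only [levelModel, content_above hj, hj0, false_and, false_or]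

theorem above_above (h : ModelsACA0 S) {j : M} (hj : k < j) : above (above T k) j = above T j :=
  Set.ext fun _ => ⟨fun hz => ⟨hz.1.1, hz.2⟩, fun ⟨hz, i, y, hi, hji⟩ =>
    ⟨⟨hz, i, y, hi, h.lt_trans hj hji⟩, i, y, hi, hji⟩⟩

theorem solvesProblems_iff {C : Set M} : SolvesProblems S C ↔
    ∀ q, ∀ X ∈ codedSets C, ∀ B ∈ codedSets C, (∃ A ∈ S, SatClauses (problem q X B) A) →
      ∃ Y ∈ codedSets C, SatClauses (problem q X B) Y := by
  constructor
  · rintro hC q _ ⟨x, rfl⟩ _ ⟨b, rfl⟩ hA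
    obtain ⟨y, hy⟩ := hC q x b
    exact ⟨_, ⟨y, rfl⟩, hy hA⟩
  · intro hC q x b
    by_cases hA : ∃ A ∈ S, SatClauses (problem q (slice C x) (slice C b)) A
    · obtain ⟨_, ⟨y, rfl⟩, hy⟩ := hC q _ ⟨x, rfl⟩ _ ⟨b, rfl⟩ hA
      exact ⟨y, fun _ => hy⟩
    · exact ⟨0, fun h => (hA h).elim⟩

/-! #### Changes of the state -/

/-- A level without entries satisfies its invariant. -/
theorem levelInv_of_empty (hT : ∀ y, l2Pair k y ∉ T) : LevelInv S W T k := by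
  refine ⟨?_, fun _ => ⟨fun w l hl => (hT _ hl).elim, fun w hw => (hT _ hw).elim⟩⟩
  rintro rfl
  exact ⟨fun m c m' c' hd => (hT _ hd).elim, fun d l =>
    ⟨fun hl => (hT _ hl).elim, fun hd => (hT _ hd.1).elim⟩⟩

/-- The invariant of level `k` depends only on the entries of the levels from `k` on. -/
theorem LevelInv.congr (hT : LevelInv S W T k)
    (hTT' : ∀ j y, ¬ j < k → (l2Pair j y ∈ T ↔ l2Pair j y ∈ T')) (h : ModelsACA0 S) :
    LevelInv S W T' k := by
  have hd : Decided T' k = Decided T k :=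
    funext fun d => propext (hTT' _ _ (h.lt_irrefl k)).symm
  have hc : content T' k = content T k :=
    funext fun d => Set.ext fun l => (hTT' _ _ (h.lt_irrefl k)).symm
  have ha : above T' k = above T k := by
    ext z
    refine and_congr_left ?_
    rintro ⟨j, y, rfl, hj⟩
    exact (hTT' j y (h.not_lt_iff.2 (Or.inl hj))).symm
  by_cases hk : k = 0
  · subst hk
    have hch : Chosen T' = Chosen T := by
      funext m c l; simp only [Chosen, hc]
    have hb : betaSet W T' = betaSet W T := by
      funext m; simp only [betaSet, ha, hch]
    refine ⟨fun _ => ?_, fun h0 => (h0 rfl).elim⟩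
    have := hT.1 rfl
    simp only [InvZero, Candidate, hd, hc, hb, hch] at this ⊢
    exact this
  · have hl : levelModel W T' k = levelModel W T k := by
      simp only [levelModel, hk, hc, false_and, false_or]
    refine ⟨fun h0 => (hk h0).elim, fun _ => ?_⟩
    have := hT.2 hk
    simp only [InvSucc, Ready, hd, hc, ha, hl] at this ⊢
    exact this

section Step

/-- The state after the application of the operator with index `k`. -/
def nextState (S : Set (Set M)) (W T : Set M) (k : M) : Set M :=
  fromLevel T k ∪ stepOperator S W k T

theorem mem_fromLevel (h : ModelsACA0 S) {j y : M} :
    l2Pair j y ∈ fromLevel T k ↔ l2Pair j y ∈ T ∧ ¬ j < k := by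
  refine and_congr_right fun _ => ⟨?_, fun hj => ⟨j, y, rfl, hj⟩⟩
  rintro ⟨j', y', hz, hj⟩
  obtain ⟨rfl, rfl⟩ := h.pair_inj.1 hz
  exact hj

theorem stepOperator_level {z : M} (hz : z ∈ stepOperator S W k T) :
    ∃ l d, z = l2Pair k (l2Pair l d) ∧ Due W T k d := by
  obtain ⟨A, -, d, hd, rfl | ⟨l, rfl, -⟩⟩ := hz
  exacts [⟨_, _, rfl, hd⟩, ⟨_, _, rfl, hd⟩]

theorem decided_of_mem_stepOperator (h : ModelsACA0 S) {d : M} :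
    l2Pair k (l2Pair 0 d) ∈ stepOperator S W k T ↔ Due W T k d := by
  constructor
  · intro hz
    obtain ⟨l, d', hz, hd⟩ := stepOperator_level hz
    obtain ⟨-, rfl⟩ := h.pair_inj.1 (h.pair_inj.1 hz).2
    exact hd
  · intro hd
    obtain ⟨A, hA⟩ := h.nonempty
    exact ⟨A, hA, d, hd, Or.inl rfl⟩

theorem content_of_mem_stepOperator (h : ModelsACA0 S) {d l : M} :
    l2Pair k (l2Pair (l + 1) d) ∈ stepOperator S W k T ↔ Due W T k d ∧
      ((k = 0 ∧ ∃ m c, d = l2Pair m c ∧ ∃ A ∈ S, Candidate W T m c l A) ∨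
        ∃ k', k = k' + 1 ∧ l ∈ levelModel W T k') := by
  constructor
  · rintro ⟨A, hA, d', hd, hz | ⟨l', hz, hl⟩⟩
    · exact (h.succ_ne_zero _ (h.pair_inj.1 (h.pair_inj.1 hz).2).1).elim
    · obtain ⟨hl', rfl⟩ := h.pair_inj.1 (h.pair_inj.1 hz).2
      obtain rfl := h.succ_inj _ _ hl'
      refine ⟨hd, hl.imp_left ?_⟩
      rintro ⟨h0, m, c, hmc, hC⟩
      exact ⟨h0, m, c, hmc, A, hA, hC⟩
  · rintro ⟨hd, ⟨h0, m, c, hmc, A, hA, hC⟩ | hl⟩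
    · exact ⟨A, hA, d, hd, Or.inr ⟨l, rfl, Or.inl ⟨h0, m, c, hmc, hC⟩⟩⟩
    · obtain ⟨A, hA⟩ := h.nonempty
      exact ⟨A, hA, d, hd, Or.inr ⟨l, rfl, Or.inr hl⟩⟩

theorem stepOperator_subset_iff (h : ModelsACA0 S) :
    stepOperator S W k T ⊆ T ↔ ∀ d, ¬ Due W T k d := by
  constructor
  · intro hT d hd
    exact hd.1 (hT ((decided_of_mem_stepOperator h).2 hd))
  · intro hd z hz
    obtain ⟨l, d, -, hdue⟩ := stepOperator_level hz
    exact (hd d hdue).elim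

theorem mem_nextState_of_lt (h : ModelsACA0 S) {j y : M} (hj : k < j) :
    l2Pair j y ∈ nextState S W T k ↔ l2Pair j y ∈ T := by
  constructor
  · rintro (hz | hz)
    · exact hz.1
    · obtain ⟨l, d, hz, -⟩ := stepOperator_level hz
      rw [(h.pair_inj.1 hz).1] at hj
      exact (h.lt_irrefl _ hj).elim
  · intro hz
    exact Or.inl ((mem_fromLevel h).2 ⟨hz, h.not_lt_iff.2 (Or.inl hj)⟩)

theorem notMem_nextState (h : ModelsACA0 S) {j y : M} (hj : j < k) :
    l2Pair j y ∉ nextState S W T k := by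
  rintro (hz | hz)
  · exact ((mem_fromLevel h).1 hz).2 hj
  · obtain ⟨l, d, hz, -⟩ := stepOperator_level hz
    rw [(h.pair_inj.1 hz).1] at hj
    exact h.lt_irrefl _ hj

theorem mem_nextState_self (h : ModelsACA0 S) {y : M} :
    l2Pair k y ∈ nextState S W T k ↔ l2Pair k y ∈ T ∨ l2Pair k y ∈ stepOperator S W k T :=
  or_congr_left ((mem_fromLevel h).trans (and_iff_left (h.lt_irrefl k)))

theorem decided_nextState (h : ModelsACA0 S) {d : M} :
    Decided (nextState S W T k) k d ↔ Decided T k d ∨ Due W T k d := by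
  rw [Decided, mem_nextState_self h, decided_of_mem_stepOperator h]; rfl

theorem mem_content_nextState (h : ModelsACA0 S) {d l : M} :
    l ∈ content (nextState S W T k) k d ↔ l ∈ content T k d ∨ (Due W T k d ∧
      ((k = 0 ∧ ∃ m c, d = l2Pair m c ∧ ∃ A ∈ S, Candidate W T m c l A) ∨
        ∃ k', k = k' + 1 ∧ l ∈ levelModel W T k')) :=
  (mem_nextState_self h).trans (or_congr_right (content_of_mem_stepOperator h))

/-- Operators with an index up to `k` preserve the higher levels and the decided cells of
level `k`. -/
theorem extends_nextState (h : ModelsACA0 S) {i : M} (hi : ¬ k < i) :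
    Extends k T (nextState S W T i) := by
  rintro z (⟨j, y, rfl, hj⟩ | ⟨l, d, rfl, hd⟩)
  · refine (mem_nextState_of_lt h ?_).symm
    rcases h.not_lt_iff.1 hi with hik | rfl
    exacts [h.lt_trans hik hj, hj]
  · rcases h.not_lt_iff.1 hi with hik | rfl
    · exact (mem_nextState_of_lt h hik).symm
    · rw [mem_nextState_self h]
      refine ⟨Or.inl, fun hz => hz.resolve_right fun hz => ?_⟩
      obtain ⟨l', d', hz, hd'⟩ := stepOperator_level hz
      obtain ⟨-, rfl⟩ := h.pair_inj.1 (h.pair_inj.1 hz).2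
      exact hd'.1 hd

end Step

end Invariants

/-! ### Preservation of the invariants -/

section Preservation

variable {M : Type u} [L1Structure M] {S : Set (Set M)} {W T T' : Set M} {k : M}

theorem Extends.chosen_iff (hE : Extends 0 T T') {m c l : M} (hd : Decided T 0 (l2Pair m c)) :
    Chosen T m c l ↔ Chosen T' m c l := by
  rw [Chosen, Chosen, hE.content_eq hd]

theorem Extends.betaSet_eq (hE : Extends 0 T T') {m : M} (hd : ∀ c, Decided T 0 (l2Pair m c)) :
    betaSet W T m = betaSet W T' m := by
  ext y
  simp only [betaSet, hE.above_eq, hE.chosen_iff (hd _)]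

/-- Whether `l` is a candidate for the cell `(m, c)` depends only on the preceding cells. -/
theorem Extends.candidate_iff (hE : Extends 0 T T') (h : ModelsACA0 S) {m c l : M} {A : Set M}
    (hd : ∀ m' c', m' < m ∨ (m' = m ∧ c' < c) → Decided T 0 (l2Pair m' c')) :
    Candidate W T m c l A ↔ Candidate W T' m c l A := by
  refine exists_congr fun q => exists_congr fun x => exists_congr fun b =>
    and_congr_right fun hm => ?_
  have hxb : l2Pair x b < m := hm ▸ h.lt_pair_right q _
  have hlt : ∀ {y}, y < l2Pair x b + 1 → y < m := fun hy => by
    rcases (h.lt_succ_iff _ _).1 hy with hy | rfl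
    exacts [h.lt_trans hy hxb, hxb]
  rw [hE.betaSet_eq fun c' => hd x c' (Or.inl (hlt (h.lt_pair_left x b))),
    hE.betaSet_eq fun c' => hd b c' (Or.inl (hlt (h.lt_pair_right x b)))]
  refine and_congr_right fun _ => and_congr_right fun _ => and_congr_right fun _ =>
    forall_congr' fun c' => forall_congr' fun l' => forall_congr' fun hc' => ?_
  rw [hE.chosen_iff (hd m c' (Or.inr ⟨rfl, hc'⟩))]

theorem due_zero_iff (h : ModelsACA0 S) {d : M} : Due W T 0 d ↔ ¬ Decided T 0 d ∧
    ∃ m c, d = l2Pair m c ∧ ∀ m' c', m' < m ∨ (m' = m ∧ c' < c) → Decided T 0 (l2Pair m' c') := by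
  refine and_congr_right fun _ => ⟨?_, ?_⟩
  · rintro (⟨-, m, c, hd, h1, h2⟩ | ⟨k', hk', -⟩)
    · refine ⟨m, c, hd, ?_⟩
      rintro m' c' (hm | ⟨rfl, hc⟩)
      exacts [h1 _ _ hm, h2 _ hc]
    · exact (h.succ_ne_zero k' hk'.symm).elim
  · rintro ⟨m, c, hd, hlt⟩
    exact Or.inl ⟨rfl, m, c, hd, fun m' c' hm => hlt _ _ (Or.inl hm),
      fun c' hc => hlt _ _ (Or.inr ⟨rfl, hc⟩)⟩

theorem invZero_nextState (h : ModelsACA0 S) (hT : InvZero S W T) :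
    InvZero S W (nextState S W T 0) := by
  have hE : Extends 0 T (nextState S W T 0) := extends_nextState h (h.lt_irrefl 0)
  -- All cells that precede a cell decided in the new state were decided in the old one.
  have hlt : ∀ m c m' c', Decided (nextState S W T 0) 0 (l2Pair m c) →
      m' < m ∨ (m' = m ∧ c' < c) → Decided T 0 (l2Pair m' c') := by
    intro m c m' c' hd hm
    rcases (decided_nextState h).1 hd with hd | hd
    · exact hT.1 m c m' c' hd hm
    · obtain ⟨-, m₀, c₀, hmc, hlt⟩ := (due_zero_iff h).1 hd
      obtain ⟨rfl, rfl⟩ := h.pair_inj.1 hmc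
      exact hlt m' c' hm
  refine ⟨fun m c m' c' hd hm => hE.decided (hlt m c m' c' hd hm), fun d l => ?_⟩
  have hcand : Decided (nextState S W T 0) 0 d →
      ((∃ m c, d = l2Pair m c ∧ ∃ A ∈ S, Candidate W T m c l A) ↔
        ∃ m c, d = l2Pair m c ∧ ∃ A ∈ S, Candidate W (nextState S W T 0) m c l A) := by
    intro hd
    refine exists_congr fun m => exists_congr fun c => and_congr_right fun hmc =>
      exists_congr fun A => and_congr_right fun _ => hE.candidate_iff h fun m' c' => ?_
    subst hmc
    exact hlt m c m' c' hd
  rw [and_congr_right fun hd => (hcand hd).symm, mem_content_nextState h, decided_nextState h,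
    hT.2 d l, or_and_right]
  refine or_congr_right (and_congr_right fun _ => ⟨?_, fun hd => Or.inl ⟨rfl, hd⟩⟩)
  rintro (⟨-, hd⟩ | ⟨k', hk', -⟩)
  exacts [hd, (h.succ_ne_zero k' hk'.symm).elim]

/-- The sets of the model at level `k + 1` belong to the `β`-model at level `k`. -/
theorem slice_levelModel_mem (h : ModelsACA0 S) (hT : levelModel W T k ∈ S)
    (hR : Ready S W T k) (i : M) :
    slice (levelModel W T (k + 1)) i ∈ codedSets (levelModel W T k) := by
  obtain ⟨hC, -, ⟨j, hj⟩⟩ := id hR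
  have h' := hC.modelsACA0 h hT
  have : Fact (above T k ∈ codedSets (levelModel W T k)) := ⟨j, hj.symm⟩
  rw [← levelModel_above (h.lt_succ_self k) (h.succ_ne_zero k)]
  have : Fact (W ∈ codedSets (levelModel W T k)) := ⟨hR.2.1.imp fun _ => Eq.symm⟩
  exact h'.defSet_mem

theorem invSucc_nextState (h : ModelsACA0 S) (hTk : levelModel W T k ∈ S)
    (hR : Ready S W T k) (hT : InvSucc S W T (k + 1)) {d₀ : M} (hd₀ : Due W T (k + 1) d₀) :
    InvSucc S W (nextState S W T (k + 1)) (k + 1) := by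
  have hk : k + 1 ≠ 0 := h.succ_ne_zero k
  have hE : Extends (k + 1) T (nextState S W T (k + 1)) := extends_nextState h (h.lt_irrefl _)
  have hnew : ∀ d, Due W T (k + 1) d →
      content (nextState S W T (k + 1)) (k + 1) d = levelModel W T k := by
    intro d hd
    ext l
    rw [mem_content_nextState h]
    constructor
    · rintro (hl | ⟨-, ⟨h0, -⟩ | ⟨k', hk', hl⟩⟩)
      · exact (hd.1 (hT.1 _ _ hl)).elim
      · exact (hk h0).elim
      · rwa [h.succ_inj _ _ hk']
    · exact fun hl => Or.inr ⟨hd, Or.inr ⟨k, rfl, hl⟩⟩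
  have hslice : ∀ d, Due W T (k + 1) d → ∀ j,
      slice (levelModel W (nextState S W T (k + 1)) (k + 1)) (l2Pair d j + 1) =
        slice (levelModel W T k) j := by
    intro d hd j
    ext a
    rw [mem_slice_levelModel h hk, hnew d hd]
    rfl
  have hsub : ∀ w l, l ∈ content (nextState S W T (k + 1)) (k + 1) w →
      Decided (nextState S W T (k + 1)) (k + 1) w := by
    intro w l hl
    rw [decided_nextState h]
    rcases (mem_content_nextState h).1 hl with hl | hl
    exacts [Or.inl (hT.1 _ _ hl), Or.inr hl.1]
  have hC := hR.1
  have h' := hC.modelsACA0 h hTk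
  -- The new model at level `k + 1` has the same sets as the old one at level `k`.
  have hcoded : codedSets (levelModel W (nextState S W T (k + 1)) (k + 1)) =
      codedSets (levelModel W T k) := by
    refine subset_antisymm ?_ ?_
    · rintro _ ⟨i, rfl⟩
      rcases slice_levelModel_cases (W := W) h hk hsub i with h0 | ⟨w, j, rfl, hw⟩
      · rw [h0]; exact h'.empty_mem
      · rcases (decided_nextState h).1 hw with hw | hw
        · rw [← hE.slice_levelModel_eq h hk hw]
          exact slice_levelModel_mem h hTk hR _
        · rw [hslice w hw]; exact ⟨j, rfl⟩
    · rintro _ ⟨j, rfl⟩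
      exact ⟨_, hslice d₀ hd₀ j⟩
  have hready : Ready S W (nextState S W T (k + 1)) (k + 1) := by
    refine ⟨?_, ?_, ?_⟩
    · rw [solvesProblems_iff, hcoded, ← solvesProblems_iff]; exact hC
    · suffices W ∈ codedSets (levelModel W (nextState S W T (k + 1)) (k + 1)) from
        this.imp fun _ => Eq.symm
      rw [hcoded]
      exact hR.2.1.imp fun _ => Eq.symm
    · suffices above (nextState S W T (k + 1)) (k + 1) ∈
          codedSets (levelModel W (nextState S W T (k + 1)) (k + 1)) from
        this.imp fun _ => Eq.symm
      rw [hcoded, ← hE.above_eq, ← above_above h (h.lt_succ_self k)]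
      have : Fact (above T k ∈ codedSets (levelModel W T k)) := ⟨hR.2.2.imp fun _ => Eq.symm⟩
      exact h'.defSet_mem
  refine ⟨hsub, fun w hw => ⟨hready, ?_⟩⟩
  rcases (decided_nextState h).1 hw with hw | hw
  · refine ((hT.2 w hw).2).imp_right ?_
    rintro ⟨w', j, rfl, hw', b, hb⟩
    obtain ⟨b', hb'⟩ := hE.codedSets_subset (W := W) h hk hT.1 ⟨b, rfl⟩
    refine ⟨w', j, rfl, hE.decided hw', b', ?_⟩
    rwa [hb', ← hE.slice_levelModel_eq h hk hw']
  · obtain ⟨-, ⟨h0, -⟩ | ⟨k', hk', hw0⟩⟩ := hw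
    · exact (hk h0).elim
    obtain rfl := h.succ_inj _ _ hk'
    refine hw0.imp_right ?_
    rintro ⟨w', j, rfl, hw', b, hb⟩
    obtain ⟨b', hb'⟩ : slice (levelModel W T k) b ∈
        codedSets (levelModel W (nextState S W T (k + 1)) (k + 1)) := hcoded ▸ ⟨b, rfl⟩
    refine ⟨w', j, rfl, hE.decided hw', b', ?_⟩
    rw [hb', ← hE.slice_levelModel_eq h hk hw']
    intro A hA hAb hAX
    -- The model at level `k` is a `β`-model, hence would contain a solution as well.
    obtain ⟨G, ⟨a, rfl⟩, hGb, hGX⟩ := hC.exists_satClauses_slice h hTk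
      (slice_levelModel_mem h hTk hR _) ⟨b, rfl⟩ ⟨A, hA, hAb, hAX⟩
    exact hb a hGb hGX

/-- The invariant is preserved by limits. -/
theorem levelInv_of_directed (h : ModelsACA0 S) (hT : ∀ z₁ ∈ T, ∀ z₂ ∈ T, ∃ T', Extends k T' T ∧
      LevelInv S W T' k ∧ z₁ ∈ T' ∧ z₂ ∈ T') : LevelInv S W T k := by
  refine ⟨?_, fun hk => ?_⟩
  · rintro rfl
    refine ⟨fun m c m' c' hd hm => ?_, fun d l => ⟨fun hl => ?_, ?_⟩⟩
    · obtain ⟨T', hE, hT', hd', -⟩ := hT _ hd _ hd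
      exact hE.decided ((hT'.1 rfl).1 m c m' c' hd' hm)
    · obtain ⟨T', hE, hT', hl', -⟩ := hT _ hl _ hl
      obtain ⟨hd, m, c, rfl, A, hA, hC⟩ := ((hT'.1 rfl).2 d l).1 hl'
      exact ⟨hE.decided hd, m, c, rfl, A, hA,
        (hE.candidate_iff h fun m' c' => (hT'.1 rfl).1 m c m' c' hd).1 hC⟩
    · rintro ⟨hd, m, c, rfl, A, hA, hC⟩
      obtain ⟨T', hE, hT', hd', -⟩ := hT _ hd _ hd
      have hd' : Decided T' 0 (l2Pair m c) := hd'
      rw [← hE.content_eq hd']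
      exact ((hT'.1 rfl).2 _ l).2 ⟨hd', m, c, rfl, A, hA,
        (hE.candidate_iff h fun m' c' => (hT'.1 rfl).1 m c m' c' hd').2 hC⟩
  · have hsub : ∀ w l, l ∈ content T k w → Decided T k w := by
      intro w l hl
      obtain ⟨T', hE, hT', hl', -⟩ := hT _ hl _ hl
      exact hE.decided ((hT'.2 hk).1 w l hl')
    refine ⟨hsub, fun w hw => ⟨⟨?_, ?_, ?_⟩, ?_⟩⟩
    · rw [solvesProblems_iff]
      rintro q _ ⟨x, rfl⟩ _ ⟨b, rfl⟩ hA
      -- Each set of the model at level `k` belongs to the model of a smaller state.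
      have hmem : ∀ i, ∃ w', Decided T k w' ∧ ∀ T', Extends k T' T → Decided T' k w' →
          slice (levelModel W T k) i ∈ codedSets (levelModel W T' k) := by
        intro i
        rcases slice_levelModel_cases (W := W) h hk hsub i with h0 | ⟨w', j, rfl, hw'⟩
        · exact ⟨w, hw, fun T' _ _ => ⟨0, by rw [h0, slice_levelModel_index_zero h hk]⟩⟩
        · exact ⟨w', hw', fun T' hE hd => ⟨_, hE.slice_levelModel_eq h hk hd j⟩⟩
      obtain ⟨w₁, hw₁, hx⟩ := hmem x
      obtain ⟨w₂, hw₂, hb⟩ := hmem b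
      obtain ⟨T', hE, hT', hw₁', hw₂'⟩ := hT _ hw₁ _ hw₂
      obtain ⟨Y, hY, hYX⟩ := solvesProblems_iff.1 ((hT'.2 hk).2 w₁ hw₁').1.1 q _
        (hx T' hE hw₁') _ (hb T' hE hw₂') hA
      exact ⟨Y, hE.codedSets_subset h hk (hT'.2 hk).1 hY, hYX⟩
    all_goals
      obtain ⟨T', hE, hT', hw', -⟩ := hT _ hw _ hw
      have hcoded := hE.codedSets_subset (W := W) h hk (hT'.2 hk).1
      obtain ⟨⟨-, ⟨i, hi⟩, ⟨j, hj⟩⟩, hfact⟩ := (hT'.2 hk).2 w hw'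
    · exact (hcoded ⟨i, hi.symm⟩).imp fun _ => Eq.symm
    · exact (hcoded ⟨j, hj.symm⟩).imp fun _ hi => hE.above_eq ▸ hi.symm
    · refine hfact.imp_right ?_
      rintro ⟨w', j, rfl, hd, b, hb⟩
      obtain ⟨b', hb'⟩ := hcoded ⟨b, rfl⟩
      refine ⟨w', j, rfl, hE.decided hd, b', ?_⟩
      rwa [hb', ← hE.slice_levelModel_eq h hk hd]

/-- When no cell of level `0` is left to be decided, all of them are decided. -/
theorem decided_of_not_due (h : ModelsACA0 S) (hT : T ∈ S) (hdue : ∀ d, ¬ Due W T 0 d) (m c : M) :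
    Decided T 0 (l2Pair m c) := by
  have : Fact (T ∈ S) := ⟨hT⟩
  by_contra hd
  obtain ⟨m₀, ⟨c₁, hc₁⟩, hm₀⟩ := h.exists_least
    (P := fun m => ∃ c, ¬ Decided T 0 (l2Pair m c)) ⟨m, c, hd⟩
  obtain ⟨c₀, hc₀, hlt⟩ := h.exists_least (P := fun c => ¬ Decided T 0 (l2Pair m₀ c)) ⟨c₁, hc₁⟩
  refine hdue _ ((due_zero_iff h).2 ⟨hc₀, m₀, c₀, rfl, ?_⟩)
  rintro m' c' (hm' | ⟨rfl, hc'⟩)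
  · by_contra hno
    exact hm₀ m' hm' ⟨c', hno⟩
  · exact not_not.1 (hlt c' hc')

/-- If some set solves the problem `m`, then at each stage of the choice of literals there is a
solution that makes all earlier choices true. -/
theorem exists_solution_choices [SigmaCA S] (h : ModelsACA0 S) (hWS : W ∈ S) (hTS : T ∈ S)
    (hT : InvZero S W T) (hdec : ∀ m c, Decided T 0 (l2Pair m c)) {q x b m : M}
    (hm : m = l2Pair q (l2Pair x b) + 1)
    (hA : ∃ A ∈ S, SatClauses (problem q (betaSet W T x) (betaSet W T b)) A) (c : M) :
    (∃ l, Chosen T m c l ∧ l2Pair l c ∈ problem q (betaSet W T x) (betaSet W T b)) ∧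
    ∃ A ∈ S, SatClauses (problem q (betaSet W T x) (betaSet W T b)) A ∧
      ∀ c' l', c' < c → Chosen T m c' l' → LitTrue l' A := by
  have : Fact (T ∈ S) := ⟨hTS⟩
  have : Fact (W ∈ S) := ⟨hWS⟩
  have hchoice : ∀ c, (∃ A ∈ S, SatClauses (problem q (betaSet W T x) (betaSet W T b)) A ∧
      ∀ c' l', c' < c → Chosen T m c' l' → LitTrue l' A) → ∃ l, Chosen T m c l := by
    rintro c ⟨A, hAS, hA, hlt⟩
    obtain ⟨l, hl, hlA⟩ := hA c
    obtain ⟨l₀, hl₀, hmin⟩ := h.exists_least (P := fun l => l ∈ content T 0 (l2Pair m c))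
      ⟨l, (hT.2 _ _).2 ⟨hdec m c, m, c, rfl, A, hAS, q, x, b, hm, hl, hA, hlA, hlt⟩⟩
    exact ⟨l₀, hl₀, hmin⟩
  -- A chosen literal is a candidate.
  have hcand : ∀ c l, Chosen T m c l →
      ∃ A ∈ S, l2Pair l c ∈ problem q (betaSet W T x) (betaSet W T b) ∧
        SatClauses (problem q (betaSet W T x) (betaSet W T b)) A ∧ LitTrue l A ∧
        ∀ c' l', c' < c → Chosen T m c' l' → LitTrue l' A := by
    intro c l hl
    obtain ⟨-, m', c', hmc, A, hAS, q', x', b', hm', hC⟩ := (hT.2 _ _).1 hl.1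
    obtain ⟨rfl, rfl⟩ := h.pair_inj.1 hmc
    obtain ⟨rfl, hxb⟩ := h.pair_inj.1 (h.succ_inj _ _ (hm.symm.trans hm'))
    obtain ⟨rfl, rfl⟩ := h.pair_inj.1 hxb
    exact ⟨A, hAS, hC⟩
  have key : ∃ A ∈ S, SatClauses (problem q (betaSet W T x) (betaSet W T b)) A ∧
      ∀ c' l', c' < c → Chosen T m c' l' → LitTrue l' A := by
    refine h.ind (P := fun c => ∃ A ∈ S, SatClauses (problem q (betaSet W T x) (betaSet W T b)) A ∧
      ∀ c' l', c' < c → Chosen T m c' l' → LitTrue l' A) ?_ (fun c ih => ?_) c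
    · obtain ⟨A, hAS, hA⟩ := hA
      exact ⟨A, hAS, hA, fun c' _ hc' => (h.not_lt_zero c' hc').elim⟩
    · obtain ⟨l, hl⟩ := hchoice c ih
      obtain ⟨A, hAS, -, hA, hlA, hlt⟩ := hcand c l hl
      refine ⟨A, hAS, hA, fun c' l' hc' hl' => ?_⟩
      rcases (h.lt_succ_iff _ _).1 hc' with hc' | rfl
      · exact hlt c' l' hc' hl'
      · rcases h.lt_trichotomy l l' with hll | rfl | hll
        exacts [(hl'.2 l hll hl.1).elim, hlA, (hl.2 l' hll hl'.1).elim]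
  refine ⟨?_, key⟩
  obtain ⟨l, hl⟩ := hchoice c key
  obtain ⟨A, -, hA, -⟩ := hcand c l hl
  exact ⟨l, hl, hA⟩

/-- When no cell of level `0` is left to be decided, the model at level `0` is a `β`-model. -/
theorem ready_zero [SigmaCA S] (h : ModelsACA0 S) (hWS : W ∈ S) (hTS : T ∈ S)
    (hT : InvZero S W T) (hdue : ∀ d, ¬ Due W T 0 d) : Ready S W T 0 := by
  have : Fact (T ∈ S) := ⟨hTS⟩
  have : Fact (W ∈ S) := ⟨hWS⟩
  have hdec := decided_of_not_due h hTS hdue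
  have hsol : SolvesProblems S (levelModel W T 0) := by
    intro q x b
    refine ⟨l2Pair q (l2Pair x b) + 1, ?_⟩
    simp only [slice_levelModel_zero h]
    intro hA c
    have hall := exists_solution_choices h hWS hTS hT hdec rfl hA
    have hm0 : l2Pair q (l2Pair x b) + 1 ≠ 0 := h.succ_ne_zero _
    obtain ⟨⟨l, hl, hlP⟩, -⟩ := hall c
    refine ⟨l, hlP, ?_⟩
    -- Any two chosen literals are true of a common set, so they do not contradict each other.
    have hcommon : ∀ c' l', Chosen T (l2Pair q (l2Pair x b) + 1) c' l' →
        ∃ A, LitTrue l A ∧ LitTrue l' A := by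
      intro c' l' hl'
      rcases h.lt_trichotomy c c' with hcc | rfl | hcc
      · obtain ⟨-, A, -, -, hlt⟩ := hall (c' + 1)
        exact ⟨A, hlt c l (h.lt_trans hcc (h.lt_succ_self _)) hl,
          hlt c' l' (h.lt_succ_self _) hl'⟩
      · obtain ⟨-, A, -, -, hlt⟩ := hall (c + 1)
        exact ⟨A, hlt c l (h.lt_succ_self _) hl, hlt c l' (h.lt_succ_self _) hl'⟩
      · obtain ⟨-, A, -, -, hlt⟩ := hall (c + 1)
        exact ⟨A, hlt c l (h.lt_succ_self _) hl,
          hlt c' l' (h.lt_trans hcc (h.lt_succ_self _)) hl'⟩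
    obtain ⟨A₀, hA₀, -⟩ := hcommon c l hl
    rcases hA₀ with ⟨y, rfl, -⟩ | ⟨y, rfl, -⟩
    · exact (litTrue_zero h).2 (Or.inr ⟨hm0, c, hl⟩)
    · refine (litTrue_one h).2 ?_
      rintro (⟨h0, -⟩ | ⟨-, c', hc'⟩)
      · exact hm0 h0
      · obtain ⟨A, hA1, hA2⟩ := hcommon c' _ hc'
        exact (litTrue_one h).1 hA1 ((litTrue_zero h).1 hA2)
  have h' := hsol.modelsACA0 h h.defSet_mem
  have : Fact (betaSet W T 0 ∈ codedSets (levelModel W T 0)) := ⟨0, slice_levelModel_zero h 0⟩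
  have hzero : slice (betaSet W T 0) 0 = W := by
    ext a
    constructor
    · rintro (⟨-, ⟨a', haa', ha⟩ | ⟨a', haa', -⟩⟩ | ⟨h0, -⟩)
      · rwa [(h.pair_inj.1 haa').1]
      · exact (h.zero_ne_one (h.pair_inj.1 haa').2).elim
      · exact (h0 rfl).elim
    · exact fun ha => Or.inl ⟨rfl, Or.inl ⟨a, rfl, ha⟩⟩
  have hone : slice (betaSet W T 0) 1 = above T 0 := by
    ext a
    constructor
    · rintro (⟨-, ⟨a', haa', -⟩ | ⟨a', haa', ha⟩⟩ | ⟨h0, -⟩)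
      · exact (h.zero_ne_one (h.pair_inj.1 haa').2.symm).elim
      · rwa [(h.pair_inj.1 haa').1]
      · exact (h0 rfl).elim
    · exact fun ha => Or.inl ⟨rfl, Or.inr ⟨a, rfl, ha⟩⟩
  have hmem : ∀ i, slice (betaSet W T 0) i ∈ codedSets (levelModel W T 0) := fun i => h'.defSet_mem
  have h0 := hmem 0
  have h1 := hmem 1
  rw [hzero] at h0
  rw [hone] at h1
  exact ⟨hsol, h0.imp fun _ => Eq.symm, h1.imp fun _ => Eq.symm⟩

/-- When no cell of a level is left to be decided, the model at this level is a `β`-model. -/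
theorem LevelInv.ready [SigmaCA S] (h : ModelsACA0 S) (hWS : W ∈ S) (hTS : T ∈ S)
    (hT : LevelInv S W T k) (hdue : ∀ d, ¬ Due W T k d) : Ready S W T k := by
  rcases h.eq_zero_or_succ k with rfl | ⟨k, rfl⟩
  · exact ready_zero h hWS hTS (hT.1 rfl) hdue
  · refine ((hT.2 (h.succ_ne_zero k)).2 0 ?_).1
    by_contra hd
    exact hdue 0 ⟨hd, Or.inr ⟨k, rfl, Or.inl rfl⟩⟩

/-- The application of the operator with index `k` preserves the invariant of level `k`, provided
that the preceding levels are finished. -/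
theorem levelInv_nextState [SigmaCA S] (h : ModelsACA0 S) (hWS : W ∈ S) (hTS : T ∈ S)
    (hT : ∀ j, j < k ∨ j = k → LevelInv S W T j) (hlt : ∀ j, j < k → ∀ d, ¬ Due W T j d)
    {d : M} (hd : Due W T k d) : LevelInv S W (nextState S W T k) k := by
  rcases h.eq_zero_or_succ k with rfl | ⟨k, rfl⟩
  · exact ⟨fun _ => invZero_nextState h ((hT 0 (Or.inr rfl)).1 rfl), fun h0 => (h0 rfl).elim⟩
  · refine ⟨fun h0 => (h.succ_ne_zero k h0).elim, fun _ => ?_⟩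
    have hk := h.lt_succ_self k
    have : Fact (T ∈ S) := ⟨hTS⟩
    have : Fact (W ∈ S) := ⟨hWS⟩
    exact invSucc_nextState h h.defSet_mem ((hT k (Or.inl hk)).ready h hWS hTS (hlt k hk))
      ((hT _ (Or.inr rfl)).2 (h.succ_ne_zero k)) hd

end Preservation

/-! ### The run of the induction -/

section Run

variable {M : Type u} [L1Structure M] {S : Set (Set M)} {W : Set M} {n : M} {R H : Set M}

instance {α : Type u} [Ctx M α] {R : α → Set M} {ξ η : α → M} [DefSet S R] [DefFun S ξ]
    [DefFun S η] : Ar S (fun x => ordLe (R x) (ξ x) (η x)) := by unfold ordLe; infer_instance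

instance {α : Type u} [Ctx M α] {R : α → Set M} {ξ η : α → M} [DefSet S R] [DefFun S ξ]
    [DefFun S η] : Ar S (fun x => ordLt (R x) (ξ x) (η x)) := by unfold ordLt; infer_instance

theorem fromLevel_empty (k : M) : fromLevel ∅ k = ∅ :=
  Set.eq_empty_of_forall_notMem fun _ hz => hz.1

theorem Extends.trans {k : M} {T₁ T₂ T₃ : Set M} (h₁ : Extends k T₁ T₂) (h₂ : Extends k T₂ T₃) :
    Extends k T₁ T₃ := fun z hz => (h₁ z hz).trans
  (h₂ z (hz.imp_right fun ⟨l, d, hz, hd⟩ => ⟨l, d, hz, h₁.decided hd⟩))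

theorem fromLevel_nextState_of_lt (h : ModelsACA0 S) {T : Set M} {i j : M} (hij : i < j) :
    fromLevel (nextState S W T i) j = fromLevel T j := by
  ext z
  refine and_congr_left ?_
  rintro ⟨k, y, rfl, hk⟩
  refine mem_nextState_of_lt h ?_
  rcases h.not_lt_iff.1 hk with hjk | rfl
  exacts [h.lt_trans hij hjk, hij]

theorem fromLevel_nextState (h : ModelsACA0 S) {T : Set M} {i j : M} (hij : ¬ i < j) :
    fromLevel (nextState S W T i) j = nextState S W T i := by
  refine subset_antisymm (fun z hz => hz.1) fun z hz => ⟨hz, ?_⟩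
  obtain ⟨k, y, rfl⟩ : ∃ k y, z = l2Pair k y := by
    rcases hz with ⟨-, k, y, rfl, -⟩ | hz
    · exact ⟨k, y, rfl⟩
    · obtain ⟨l, d, rfl, -⟩ := stepOperator_level hz
      exact ⟨_, _, rfl⟩
  refine ⟨k, y, rfl, fun hkj => notMem_nextState h ?_ hz⟩
  rcases h.not_lt_iff.1 hij with hji | rfl
  exacts [h.lt_trans hkj hji, hkj]

namespace IsCombinedInduction

/-- The set recorded for level `j` consists of the entries of the current state for the levels
from `j` on. -/
theorem stageSet_eq (hH : IsCombinedInduction S n (stepOperator S W) R H) (h : ModelsACA0 S)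
    (hHS : H ∈ S) {ξ : M} (hξ : ξ ∈ relField R) {j : M} (hj : j < n) :
    stageSet H ξ j = fromLevel (stageSet H ξ 0) j := by
  have : Fact (H ∈ S) := ⟨hHS⟩
  have hR := hH.wellOrdering
  have h0 : ∀ {j}, j < n → (0 : M) < n := fun {j} hj => by
    rcases h.eq_zero_or_succ n with rfl | ⟨n, rfl⟩
    exacts [(h.not_lt_zero j hj).elim, h.zero_lt_succ n]
  refine hR.induct h (P := fun ξ => ∀ j, j < n → stageSet H ξ j = fromLevel (stageSet H ξ 0) j)
    (fun ξ hξ ih j hj => ?_) ξ hξ j hj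
  rcases hR.cases hξ with hmin | ⟨η, hη⟩ | hlim
  · rw [hH.initial ξ hξ hmin j hj, hH.initial ξ hξ hmin 0 (h0 hj), fromLevel_empty]
  · obtain ⟨i, hi, -, -, hle, hgt⟩ := hH.next η ξ hη
    have hi0 : (0 : M) < i ∨ 0 = i := h.not_lt_iff.1 (h.not_lt_zero i)
    have hnext : stageSet H ξ 0 = nextState S W (stageSet H η 0) i := by
      rw [hle 0 hi0, ih η hη.1 i hi]; rfl
    rw [hnext]
    by_cases hij : i < j
    · rw [fromLevel_nextState_of_lt h hij, hgt j hij hj, ih η hη.1 j hj]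
    · rw [fromLevel_nextState h hij, hle j (h.not_lt_iff.1 hij), ih η hη.1 i hi]; rfl
  · rw [hH.limit ξ hlim j hj, hH.limit ξ hlim 0 (h0 hj)]
    ext z
    constructor
    · rintro ⟨η, hη, hz⟩
      have hz' : ∀ ζ, ordLe R η ζ → ordLt R ζ ξ → z ∈ fromLevel (stageSet H ζ 0) j :=
        fun ζ h1 h2 => ih ζ h2 j hj ▸ hz ζ h1 h2
      exact ⟨⟨η, hη, fun ζ h1 h2 => (hz' ζ h1 h2).1⟩, (hz' η (hR.refl _ ⟨ξ, Or.inl hη.1⟩) hη).2⟩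
    · rintro ⟨⟨η, hη, hz⟩, hzj⟩
      exact ⟨η, hη, fun ζ h1 h2 => (ih ζ h2 j hj).symm ▸ ⟨hz ζ h1 h2, hzj⟩⟩

/-- At a successor stage some operator, of an index such that all preceding ones are finished, is
applied to the state. -/
theorem exists_nextState (hH : IsCombinedInduction S n (stepOperator S W) R H) (h : ModelsACA0 S)
    (hHS : H ∈ S) {ξ η : M} (hη : IsNext R ξ η) : ∃ i, i < n ∧
      (∃ d, Due W (stageSet H ξ 0) i d) ∧ (∀ j, j < i → ∀ d, ¬ Due W (stageSet H ξ 0) j d) ∧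
      stageSet H η 0 = nextState S W (stageSet H ξ 0) i := by
  obtain ⟨i, hi, hnot, hlt, hle, -⟩ := hH.next ξ η hη
  refine ⟨i, hi, ?_, fun j hj => (stepOperator_subset_iff h).1 (hlt j hj), ?_⟩
  · rw [stepOperator_subset_iff h] at hnot
    push Not at hnot
    exact hnot
  · rw [hle 0 (h.not_lt_iff.1 (h.not_lt_zero i)),
      hH.stageSet_eq h hHS ⟨η, Or.inl hη.1.1⟩ hi]
    rfl

end IsCombinedInduction

theorem IsWellOrdering.exists_ordLe_ordLe (hR : IsWellOrdering S R) {ξ η₁ η₂ : M}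
    (h₁ : ordLt R η₁ ξ) (h₂ : ordLt R η₂ ξ) :
    ∃ ζ, ordLt R ζ ξ ∧ ordLe R η₁ ζ ∧ ordLe R η₂ ζ := by
  have h₁' : η₁ ∈ relField R := ⟨ξ, Or.inl h₁.1⟩
  have h₂' : η₂ ∈ relField R := ⟨ξ, Or.inl h₂.1⟩
  rcases hR.total _ h₁' _ h₂' with hle | hle
  exacts [⟨η₂, h₂, hle, hR.refl _ h₂'⟩, ⟨η₁, h₁, hR.refl _ h₁', hle⟩]

theorem IsWellOrdering.ordLt_of_ordLe_of_ordLt (hR : IsWellOrdering S R) {ξ η ζ : M}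
    (h₁ : ordLe R ξ η) (h₂ : ordLt R η ζ) : ordLt R ξ ζ :=
  ⟨hR.trans _ _ _ h₁ h₂.1, by rintro rfl; exact h₂.2 (hR.antisymm _ _ h₂.1 h₁)⟩

namespace IsCombinedInduction

theorem extends_limit (hH : IsCombinedInduction S n (stepOperator S W) R H) (hn : 0 < n)
    {k ξ ζ : M} (hξ : IsLimitPoint R ξ) (hζ : ordLt R ζ ξ)
    (hE : ∀ χ, ordLe R ζ χ → ordLt R χ ξ → Extends k (stageSet H ζ 0) (stageSet H χ 0)) :
    Extends k (stageSet H ζ 0) (stageSet H ξ 0) := by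
  intro z hz
  rw [hH.limit ξ hξ 0 hn]
  constructor
  · exact fun hzζ => ⟨ζ, hζ, fun χ h1 h2 => (hE χ h1 h2 z hz).1 hzζ⟩
  · rintro ⟨η, hη, hzη⟩
    obtain ⟨χ, hχ, h1, h2⟩ := hH.wellOrdering.exists_ordLe_ordLe hζ hη
    exact (hE χ h1 hχ z hz).2 (hzη χ h2 hχ)

/-- If level `k` has an entry in the state at a limit, then the operators with an index above `k`
have not been used from some earlier stage on, so that the state at the limit extends the
states from there on. -/
theorem exists_extends (hH : IsCombinedInduction S n (stepOperator S W) R H) (h : ModelsACA0 S)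
    (hHS : H ∈ S) (hRS : R ∈ S) (hn : 0 < n) {k y ξ : M} (hξ : IsLimitPoint R ξ)
    (hy : l2Pair k y ∈ stageSet H ξ 0) : ∃ η, ordLt R η ξ ∧
      ∀ ζ, ordLe R η ζ → ordLt R ζ ξ → Extends k (stageSet H ζ 0) (stageSet H ξ 0) := by
  have : Fact (H ∈ S) := ⟨hHS⟩
  have : Fact (R ∈ S) := ⟨hRS⟩
  have hR := hH.wellOrdering
  rw [hH.limit ξ hξ 0 hn] at hy
  obtain ⟨η, hη, hy⟩ := hy
  refine ⟨η, hη, fun ζ h1 h2 => hH.extends_limit hn hξ h2 fun χ h3 h4 => ?_⟩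
  refine hR.induct h (P := fun χ => ordLt R χ ξ → ∀ ζ, ordLe R η ζ → ordLe R ζ χ →
    Extends k (stageSet H ζ 0) (stageSet H χ 0)) (fun χ hχ ih hχξ ζ hηζ hζχ => ?_) χ
    ⟨ξ, Or.inl h4.1⟩ h4 ζ h1 h3
  by_cases heq : ζ = χ
  · rw [heq]; exact fun _ _ => Iff.rfl
  have hζlt : ordLt R ζ χ := ⟨hζχ, heq⟩
  rcases hR.cases hχ with hmin | ⟨ρ, hρ⟩ | hlim
  · exact (heq (hR.antisymm _ _ hζχ (hmin ζ ⟨χ, Or.inl hζχ⟩))).elim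
  · obtain ⟨i, -, -, -, hnext⟩ := hH.exists_nextState h hHS hρ
    have hζρ := hρ.2 ζ hζlt
    refine (ih ρ hρ.1 (hR.ordLt_of_ordLe_of_ordLt hρ.1.1 hχξ) ζ hηζ hζρ).trans ?_
    have hyχ := hy χ (hR.trans _ _ _ hηζ hζχ) hχξ
    rw [hnext] at hyχ ⊢
    exact extends_nextState h fun hki => notMem_nextState h hki hyχ
  · exact hH.extends_limit hn hlim hζlt fun ρ h5 h6 =>
      ih ρ h6 (hR.ordLt_of_ordLe_of_ordLt h6.1 hχξ) ζ hηζ h5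

/-- All states of the run satisfy the invariants. -/
theorem levelInv [SigmaCA S] (hH : IsCombinedInduction S n (stepOperator S W) R H)
    (h : ModelsACA0 S) (hWS : W ∈ S) (hHS : H ∈ S) (hRS : R ∈ S) {ξ : M} (hξ : ξ ∈ relField R)
    {k : M} (hk : k < n) : LevelInv S W (stageSet H ξ 0) k := by
  have : Fact (H ∈ S) := ⟨hHS⟩
  have : Fact (W ∈ S) := ⟨hWS⟩
  have hR := hH.wellOrdering
  have hn : 0 < n := by
    rcases h.eq_zero_or_succ n with rfl | ⟨n, rfl⟩
    exacts [(h.not_lt_zero k hk).elim, h.zero_lt_succ n]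
  refine hR.induct h (P := fun ξ => ∀ k, k < n → LevelInv S W (stageSet H ξ 0) k)
    (fun ξ hξ ih k hk => ?_) ξ hξ k hk
  rcases hR.cases hξ with hmin | ⟨η, hη⟩ | hlim
  · rw [hH.initial ξ hξ hmin 0 hn]
    exact levelInv_of_empty fun _ => id
  · obtain ⟨i, hi, ⟨d, hd⟩, hlt, hnext⟩ := hH.exists_nextState h hHS hη
    rw [hnext]
    rcases h.lt_trichotomy k i with hki | rfl | hik
    · exact levelInv_of_empty fun y => notMem_nextState h hki
    · refine levelInv_nextState h hWS h.defSet_mem (fun j hj => ih η hη.1 j ?_) hlt hd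
      rcases hj with hj | rfl
      exacts [h.lt_trans hj hi, hi]
    · refine (ih η hη.1 k hk).congr (fun j y hj => (mem_nextState_of_lt h ?_).symm) h
      rcases h.not_lt_iff.1 hj with hkj | rfl
      exacts [h.lt_trans hik hkj, hik]
  · by_cases hy : ∃ y, l2Pair k y ∈ stageSet H ξ 0
    · obtain ⟨y, hy⟩ := hy
      obtain ⟨η, hη, hE⟩ := hH.exists_extends h hHS hRS hn hlim hy
      refine levelInv_of_directed h fun z₁ hz₁ z₂ hz₂ => ?_
      rw [hH.limit ξ hlim 0 hn] at hz₁ hz₂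
      obtain ⟨η₁, hη₁, hz₁⟩ := hz₁
      obtain ⟨η₂, hη₂, hz₂⟩ := hz₂
      obtain ⟨χ, hχ, h1, h2⟩ := hR.exists_ordLe_ordLe hη₁ hη₂
      obtain ⟨ζ, hζ, h3, h4⟩ := hR.exists_ordLe_ordLe hη hχ
      exact ⟨_, hE ζ h3 hζ, ih ζ hζ k hk, hz₁ ζ (hR.trans _ _ _ h1 h4) hζ,
        hz₂ ζ (hR.trans _ _ _ h2 h4) hζ⟩
    · exact levelInv_of_empty fun y hky => hy ⟨y, hky⟩

end IsCombinedInduction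

end Run

/-! ### The chain of `β₂`-submodels -/

section Chain

variable {M : Type u} [L1Structure M] {S : Set (Set M)} {W T : Set M} {n : M}

theorem not_satClauses_empty (A : Set M) : ¬ SatClauses ∅ A := fun hA => by
  obtain ⟨l, hl, -⟩ := hA 0
  exact hl

/-- When no cell of the levels `k` and `k + 1` is left to be decided, the model at level `k + 1` is
a `β₂`-submodel of the model at level `k`. -/
theorem isBetaSubmodel_levelModel [SigmaCA S] (h : ModelsACA0 S) (hWS : W ∈ S) (hTS : T ∈ S) {k : M}
    (hT : LevelInv S W T k) (hdue : ∀ d, ¬ Due W T k d) (hT' : LevelInv S W T (k + 1))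
    (hdue' : ∀ d, ¬ Due W T (k + 1) d) :
    IsBetaSubmodel 2 (codedSets (levelModel W T (k + 1))) (codedSets (levelModel W T k)) := by
  have : Fact (T ∈ S) := ⟨hTS⟩
  have : Fact (W ∈ S) := ⟨hWS⟩
  have hk : k + 1 ≠ 0 := h.succ_ne_zero k
  have hready := hT.ready h hWS hTS hdue
  have hinv := hT'.2 hk
  refine (hT'.ready h hWS hTS hdue').1.isBetaSubmodel_two hready.1 h h.defSet_mem h.defSet_mem ?_ ?_
  · rintro _ ⟨i, rfl⟩
    exact slice_levelModel_mem h h.defSet_mem hready i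
  · rintro _ ⟨i, rfl⟩ ⟨_, ⟨b, rfl⟩, hB⟩
    rcases slice_levelModel_cases (W := W) h hk hinv.1 i with h0 | ⟨w, j, rfl, hw⟩
    · exact ⟨_, ⟨0, rfl⟩, fun A _ _ => h0 ▸ not_satClauses_empty A⟩
    · -- The sentence holds in the model at level `k`, so its cell has been decided.
      have hd : Decided T (k + 1) (l2Pair w j + 1) := by
        by_contra hd
        exact hdue' _ ⟨hd, Or.inr ⟨k, rfl, Or.inr ⟨w, j, rfl, hw, b, fun a => hB _ ⟨a, rfl⟩⟩⟩⟩
      obtain h0 | ⟨-, -, -, -, b', hb'⟩ := (hinv.2 _ hd).2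
      · exact (h.succ_ne_zero _ h0).elim
      · exact ⟨_, ⟨b', rfl⟩, hb'⟩

/-- The code of the chain of the models at the levels `n, …, 0`. -/
def chain (W T : Set M) (n : M) : Set M :=
  {z | ∃ q k j, z = l2Pair q k ∧ k + j = n ∧ q ∈ levelModel W T j}

theorem slice_chain (h : ModelsACA0 S) {k j : M} (hkj : k + j = n) :
    slice (chain W T n) k = levelModel W T j := by
  ext q
  constructor
  · rintro ⟨q', k', j', hz, hn, hq⟩
    obtain ⟨rfl, rfl⟩ := h.pair_inj.1 hz
    rw [← hn, h.add_comm k, h.add_comm k] at hkj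
    rwa [h.add_right_cancel _ hkj]
  · exact fun hq => ⟨q, k, j, rfl, hkj, hq⟩

/-- A state in which the operators with an index up to `n` are finished yields the required sequence
of models. -/
theorem exists_chain [SigmaCA S] (h : ModelsACA0 S) (hWS : W ∈ S) (hTS : T ∈ S)
    (hT : ∀ k, k < n + 1 → LevelInv S W T k) (hdue : ∀ k, k < n + 1 → ∀ d, ¬ Due W T k d) :
    ∃ Y ∈ S, W ∈ codedSets (slice Y 0) ∧
      (∀ k : M, k < n → slice Y k ∈ codedSets (slice Y (k + 1))) ∧
      (∀ k : M, k < n ∨ k = n → ModelsACA0 (codedSets (slice Y k))) ∧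
      (∀ k : M, k < n → IsBetaSubmodel 2 (codedSets (slice Y k)) (codedSets (slice Y (k + 1)))) ∧
      IsBetaSubmodel 1 (codedSets (slice Y n)) S := by
  have : Fact (T ∈ S) := ⟨hTS⟩
  have : Fact (W ∈ S) := ⟨hWS⟩
  have hready : ∀ k, k < n + 1 → Ready S W T k := fun k hk =>
    (hT k hk).ready h hWS hTS (hdue k hk)
  have hlt : ∀ {k j}, k + j = n → j < n + 1 := fun {k j} hkj => by
    rw [h.lt_iff, ← hkj]
    exact ⟨k, by rw [h.add_succ, h.add_comm j]⟩
  -- The model that follows the one with index `k < n` is found one level below.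
  have hsucc : ∀ {k}, k < n → ∃ j, k + (j + 1) = n ∧ k + 1 + j = n := fun {k} hk => by
    obtain ⟨j, hj⟩ := (h.lt_iff k n).1 hk
    exact ⟨j, hj.symm, by rw [hj, h.succ_add, h.add_succ]⟩
  refine ⟨chain W T n, by unfold chain; exact h.defSet_mem, ?_, ?_, ?_, ?_, ?_⟩
  · rw [slice_chain h (h.zero_add n)]
    exact (hready n (h.lt_succ_self n)).2.1.imp fun _ => Eq.symm
  · intro k hk
    obtain ⟨j, hj, hj'⟩ := hsucc hk
    rw [slice_chain h hj, slice_chain h hj', ← levelModel_above (h.lt_succ_self j)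
      (h.succ_ne_zero j)]
    obtain ⟨hC, hW, hA⟩ := hready j (hlt hj')
    have : Fact (W ∈ codedSets (levelModel W T j)) := ⟨hW.imp fun _ => Eq.symm⟩
    have : Fact (above T j ∈ codedSets (levelModel W T j)) := ⟨hA.imp fun _ => Eq.symm⟩
    exact (hC.modelsACA0 h h.defSet_mem).defSet_mem
  · intro k hk
    obtain ⟨j, hj⟩ : ∃ j, k + j = n := by
      rcases hk with hk | rfl
      · obtain ⟨j, hj, -⟩ := hsucc hk
        exact ⟨_, hj⟩
      · exact ⟨0, h.add_zero k⟩
    rw [slice_chain h hj]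
    exact (hready j (hlt hj)).1.modelsACA0 h h.defSet_mem
  · intro k hk
    obtain ⟨j, hj, hj'⟩ := hsucc hk
    rw [slice_chain h hj, slice_chain h hj']
    exact isBetaSubmodel_levelModel h hWS hTS (hT _ (hlt hj')) (hdue _ (hlt hj')) (hT _ (hlt hj))
      (hdue _ (hlt hj))
  · rw [slice_chain h (h.add_zero n)]
    exact (hready 0 (h.zero_lt_succ n)).1.isBetaSubmodel_one h h.defSet_mem

end Chain

theorem mainTheorem4 {M : Type*} [L1Structure M] (S : Set (Set M)) (hACA : ModelsACA0 S)
    (hID : ∀ n : M, SigmaOneOneID S n) :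
    ∀ n : M, Psi S 1 2 n := by
  intro n X hX
  have := hACA.sigmaCA (hID 1)
  have : Fact (X ∈ S) := ⟨hX⟩
  obtain ⟨φ, v, V, hφ, hV, hΓ⟩ := hACA.exists_formulaOperator_eq (P := StepEntry X)
  obtain ⟨R, hRS, H, hHS, hH⟩ := hID (n + 1) φ hφ v V hV
  have hop : formulaOperator S φ v V = stepOperator S X := funext fun i => funext fun T => hΓ i T
  rw [hop] at hH
  have : Fact (H ∈ S) := ⟨hHS⟩
  obtain ⟨ξ, hξ, -, hclosed⟩ := hH.final
  exact exists_chain hACA hX (T := stageSet H ξ 0) hACA.defSet_mem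
    (fun k hk => hH.levelInv hACA hX hHS hRS hξ hk)
    fun k hk => (stepOperator_subset_iff hACA).1 (hclosed k hk)
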